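/- **Setting.** A GBS graph $(\Gamma,\psi)$ is a finite graph $\Gamma$ (oriented edges $e$ with reverse $\overline e\neq e$, initial vertex $\iota(e)$, terminal vertex $\tau(e)=\iota(\overline e)$) with a function $\psi:E(\Gamma)\to\mathbb Z\setminus\{0\}$. Let $\mathcal P$ be the set of primes dividing some $\psi(e)$, let $\mathbf A=\mathbb Z/2\oplus\mathbb Z^{\mathcal P}$, and let $\mathbf A^+$ be the set of its elements whose $\mathbb Z$-components are all $\ge 0$; the support $\operatorname{supp}(\mathbf x)\subseteq\mathcal P$ of $\mathbf x\in\mathbf A$ ignores the $\mathbb Z/2$ component. The affine representation $\Lambda$ has vertex set $V(\Gamma)\times\mathbf A^+$ and the same edges: the terminal vertex of $e$ in $\Lambda$ is $\tau(e)$ together with the exponents of the factorization of $\psi(e)$ as a sign times a product of primes. Below, endpoints of edges are taken in $\Lambda$. Write $(v,\mathbf a)+\mathbf w=(v,\mathbf a+\mathbf w)$, and $p\le q$ if $q=p+\mathbf w$ with $\mathbf w\in\mathbf A^+$. Points $p,q$ are conjugate, $p\sim_c q$, if $q$ is reached from $p$ by finitely many steps $\iota(e)+\mathbf w\to\tau(e)+\mathbf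 w$ ($e$ an edge, $\mathbf w\in\mathbf A^+$); $p\preceq_c q$ means $p\le q'$ for some $q'\sim_c q$; $p\sim_{qc}q$ means $p\preceq_c q\preceq_c p$. For a $\sim_{qc}$-class $Q$ and $p\in Q$ let - $\min Q$ be the set of the $q\in Q$ such that $q\le q'$ for all $q'\in Q$ with $q'\le q$ (the minimal points; points that differ only in the $\mathbb Z/2$ component are regarded as one minimal point), - $\operatorname{supp}Q=\bigcup\{\operatorname{supp}\mathbf u:\mathbf u\in\mathbf A^+,\ p+\mathbf u\in Q\}$, - $\operatorname{la}Q=\{\mathbf w-\mathbf w':\mathbf w,\mathbf w'\in\mathbf A^+,\ p+\mathbf w\sim_c p+\mathbf w'\sim_c p\}$ (the linear algebra). Two points $(v,\mathbf a),(v,\mathbf b)$ of $Q$ at the same vertex $v$ are in the same family if $\operatorname{supp}(\mathbf b-\mathbf a)\subseteq\operatorname{supp}Q$. A point $q$ lies above $p\in Q$ with full-support gap if $q=p+\mathbf w$ with $\mathbf w\in\mathbf A^+$, $\operatorname{supp}\mathbf w=\operatorname{supp}Q$. The graph has one qc-class if all its edges have their endpoints in a single class $Q$. It is then clean if every minimal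 point is an endpoint of exactly one edge, at exactly one of its ends, and no edge has both endpoints at minimal points; it has floating pieces if $\operatorname{supp}Q\ne\emptyset$ and there are strictly more edges than minimal points. A floating edge is one with no endpoint at a minimal point. A clean graph is in normal form with respect to a family $F_0$ and minimal points $m_F\in F$ (one for every family $F\ne F_0$) if 1. for $F\ne F_0$, the edge $e$ with $\iota(e)=m_F$ has $\tau(e)$ in $F_0$, above all minimal points of $F_0$ with full-support gap; 2. for every family $F$ and every minimal point $m$ in $F$ other than $m_F$ (no exception if $F=F_0$), the edge $e$ with $\iota(e)=m$ has $\tau(e)$ in $F$, above all minimal points of $F$ with full-support gap; 3. both endpoints of every floating edge are in $F_0$, above all minimal points of $F_0$ with full-support gap. **Moves.** They keep the vertex set. - Edge sign-change: replace $\psi(d),\psi(\overline d)$ by their negatives, for one edge $d$. - Slide, for $d\ne e,\overline e$ with $\tau(d)=\iota(e)$, $\psi(d)=\ell\,\psi(\overline e)$: the terminal vertex of $d$ becomes $\tau(e)$ and $\psi(d)$ becomes $\ell\,\psi(e)$. - Swap, for loops $e_1,e_2$ at one vertex, $e_1\neq e_2,\overline{e_2}$, with $\psi(\overline{e_1})=n$,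 $\psi(e_1)=\ell_1n$, $\psi(\overline{e_2})=m$, $\psi(e_2)=\ell_2m$, $n\mid m$, $m\mid\ell_1^{k_1}n$, $m\mid\ell_2^{k_2}n$ for some $k_1,k_2\ge 0$: these labels become $m,\ \ell_1m,\ n,\ \ell_2n$ respectively. - Connection, for $d\neq e,\overline e$ with $\iota(d)=u$, $\tau(d)=\iota(e)=\tau(e)=v$ (possibly $u=v$), $\psi(\overline d)=m$, $\psi(d)=\ell_1n$, $\psi(\overline e)=n$, $\psi(e)=\ell n$, $\ell_1\ell_2=\ell^k$ for some $k\ge 0$: $d,e$ are replaced by $d'$ from $v$ to $u$ with $\psi(\overline{d'})=n$, $\psi(d')=\ell_2m$ and a loop $e'$ at $u$ with $\psi(\overline{e'})=m$, $\psi(e')=\ell m$. **Proposition.** Let $(\Gamma,\psi),(\Delta,\phi)$ be GBS graphs with the same vertex set and the same set of primes, so that their affine representations have the same vertex set. Suppose that both have one qc-class, are clean, have floating pieces, and are in normal form with respect to the same family $F_0$ and the same minimal points $\{m_F\}_{F\ne F_0}$. Suppose that they have the same $\min Q$, $\operatorname{supp}Q$, $\operatorname{la}Q$ and that, possibly after changing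 $(\Gamma,\psi)$ by edge sign-changes, the conjugacy classes containing at least one edge are the same for both graphs, with the same number of edges in each. Then there is a sequence of edge sign-changes, slides, swaps and connections going from $(\Gamma,\psi)$ to $(\Delta,\phi)$ (up to renaming the edges, and inducing the identity on the vertices). -/

import Mathlib

/-- A GBS graph with vertex set `V` and set of oriented edges `E`: a graph in the sense of Serre
together with a nonzero integer `label e` at the terminal end of every oriented edge `e`. -/
structure GBSGraph (V E : Type*) where
  rev : E → E
  rev_ne : ∀ e, rev e ≠ e
  rev_rev : ∀ e, rev (rev e) = e
  init : E → V
  label : E → ℤ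
  label_ne_zero : ∀ e, label e ≠ 0

/-- The group `𝐀 = ℤ/2 ⊕ ⨁_{r ∈ P} ℤ`. -/
abbrev AffGroup (P : Finset ℕ) : Type := ZMod 2 × (P → ℤ)

/-- The positive cone `𝐀⁺` of `𝐀` (no condition on the `ℤ/2` component). -/
abbrev AffCone (P : Finset ℕ) : Type := ZMod 2 × (P → ℕ)

/-- The inclusion `𝐀⁺ → 𝐀`. -/
def AffCone.toGroup {P : Finset ℕ} (w : AffCone P) : AffGroup P :=
  (w.1, fun r => (w.2 r : ℤ))

/-- The support of an element of `𝐀⁺`; the `ℤ/2` component is ignored. -/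
def AffCone.supp {P : Finset ℕ} (w : AffCone P) : Set P := {r | w.2 r ≠ 0}

/-- The vertices `V × 𝐀⁺` of the affine representation. -/
abbrev AffPoint (V : Type*) (P : Finset ℕ) : Type _ := V × AffCone P

namespace AffPoint

variable {V : Type*} {P : Finset ℕ}

/-- The point `p + w`. -/
def shift (p : AffPoint V P) (w : AffCone P) : AffPoint V P := (p.1, p.2 + w)

/-- `p ≤ q`: `q = p + w` for some `w ∈ 𝐀⁺`. -/
def Below (p q : AffPoint V P) : Prop := ∃ w : AffCone P, q = p.shift w

/-- `p` and `q` coincide up to the `ℤ/2` component. -/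
def Near (p q : AffPoint V P) : Prop := p.Below q ∧ q.Below p

end AffPoint

namespace GBSGraph

variable {V E E' : Type*}

/-- The terminal vertex of an oriented edge. -/
def ter (G : GBSGraph V E) (e : E) : V := G.init (G.rev e)

/-- The set of primes of a GBS graph. -/
def primes (G : GBSGraph V E) : Set ℕ := {r | r.Prime ∧ ∃ e, (r : ℤ) ∣ G.label e}

/-! ### The affine representation

Below, `P` is the finite set of primes with respect to which the representation is written; it is
the affine representation of `G` when `P` is the set of primes of `G`. -/

/-- The element of `𝐀⁺` given by the signed prime factorization of a nonzero integer. -/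
def factor (P : Finset ℕ) (n : ℤ) : AffCone P :=
  (if n < 0 then 1 else 0, fun r => n.natAbs.factorization r)

/-- The terminal vertex of `e` in the affine representation. -/
def affTer (P : Finset ℕ) (G : GBSGraph V E) (e : E) : AffPoint V P :=
  (G.ter e, factor P (G.label e))

/-- The initial vertex of `e` in the affine representation. -/
def affInit (P : Finset ℕ) (G : GBSGraph V E) (e : E) : AffPoint V P :=
  G.affTer P (G.rev e)

/-- One step of an affine path: travelling along a translate of an edge. -/
def AffStep (P : Finset ℕ) (G : GBSGraph V E) (p q : AffPoint V P) : Prop :=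
  ∃ (e : E) (w : AffCone P), p = (G.affInit P e).shift w ∧ q = (G.affTer P e).shift w

/-- Conjugacy: there is an affine path (possibly of length zero) from `p` to `q`. -/
def Conj (P : Finset ℕ) (G : GBSGraph V E) (p q : AffPoint V P) : Prop :=
  Relation.ReflTransGen (G.AffStep P) p q

/-- `p ⪯ q`: `p ≤ q'` for some `q'` conjugate to `q`. -/
def ConjLE (P : Finset ℕ) (G : GBSGraph V E) (p q : AffPoint V P) : Prop :=
  ∃ q', G.Conj P q' q ∧ p.Below q'

/-- Quasi-conjugacy. -/
def QConj (P : Finset ℕ) (G : GBSGraph V E) (p q : AffPoint V P) : Prop :=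
  G.ConjLE P p q ∧ G.ConjLE P q p

/-- The minimal points of the quasi-conjugacy class of `p`. Together with a point this set contains
the point that differs from it in the `ℤ/2` component only. -/
def qcMin (P : Finset ℕ) (G : GBSGraph V E) (p : AffPoint V P) : Set (AffPoint V P) :=
  {q | G.QConj P q p ∧ ∀ q', G.QConj P q' p → q'.Below q → q.Below q'}

/-- The quasi-conjugacy support of `p`. -/
def qcSupp (P : Finset ℕ) (G : GBSGraph V E) (p : AffPoint V P) : Set P :=
  {r | ∃ u : AffCone P, G.QConj P (p.shift u) p ∧ r ∈ u.supp}

/-- The linear algebra of `p`. -/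
def linAlg (P : Finset ℕ) (G : GBSGraph V E) (p : AffPoint V P) : Set (AffGroup P) :=
  {x | ∃ w w' : AffCone P, x = w.toGroup - w'.toGroup ∧
    G.Conj P (p.shift w) (p.shift w') ∧ G.Conj P (p.shift w') p}

/-- `C` is a conjugacy class containing at least one edge. -/
def IsEdgeConjClass (P : Finset ℕ) (G : GBSGraph V E) (C : Set (AffPoint V P)) : Prop :=
  (∃ p, C = {q | G.Conj P p q}) ∧ ∃ e, G.affInit P e ∈ C

/-- The set of oriented edges in the conjugacy class `C` (two for every geometric edge). -/
def conjEdges (P : Finset ℕ) (G : GBSGraph V E) (C : Set (AffPoint V P)) : Set E :=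
  {e | G.affInit P e ∈ C}

/-- `G` and `H` have the same conjugacy classes containing at least one edge, and the same number
of edges in each of them. -/
def SameConjEdgeNumbers (P : Finset ℕ) (G : GBSGraph V E) (H : GBSGraph V E') : Prop :=
  ∀ C : Set (AffPoint V P), (G.IsEdgeConjClass P C ↔ H.IsEdgeConjClass P C) ∧
    (G.IsEdgeConjClass P C → (G.conjEdges P C).ncard = (H.conjEdges P C).ncard)

/-! ### Families, clean graphs, floating pieces, normal form -/

/-- `a` and `b` are in the same family. -/
def SameFamily (P : Finset ℕ) (G : GBSGraph V E) (a b : AffPoint V P) : Prop :=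
  G.QConj P a b ∧ a.1 = b.1 ∧ ∀ r : P, a.2.2 r ≠ b.2.2 r → r ∈ G.qcSupp P a

/-- `F` is a family contained in the quasi-conjugacy class of `p`. -/
def IsFamily (P : Finset ℕ) (G : GBSGraph V E) (p : AffPoint V P) (F : Set (AffPoint V P)) : Prop :=
  ∃ a, G.QConj P a p ∧ F = {b | G.SameFamily P a b}

/-- `q` lies above `p` with full-support gap. -/
def FullGap (P : Finset ℕ) (G : GBSGraph V E) (p q : AffPoint V P) : Prop :=
  ∃ w : AffCone P, q = p.shift w ∧ w.supp = G.qcSupp P p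

/-- All edges of `G` belong to the quasi-conjugacy class of `p`. -/
def OneQCClass (P : Finset ℕ) (G : GBSGraph V E) (p : AffPoint V P) : Prop :=
  ∀ e, G.QConj P (G.affInit P e) p

/-- Clean: up to the `ℤ/2` component, every minimal point is an endpoint of exactly one edge, at
exactly one of its ends; and no edge has both endpoints at minimal points. (The ends of the edges
correspond to the oriented edges starting there.) -/
def Clean (P : Finset ℕ) (G : GBSGraph V E) (p : AffPoint V P) : Prop :=
  (∀ m ∈ G.qcMin P p, ∃! e, (G.affInit P e).Near m) ∧
    ∀ e, ¬ (G.affInit P e ∈ G.qcMin P p ∧ G.affTer P e ∈ G.qcMin P p)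

/-- The number of minimal points, counted up to the `ℤ/2` component. -/
noncomputable def numMinPoints (P : Finset ℕ) (G : GBSGraph V E) (p : AffPoint V P) : ℕ :=
  ((fun q : AffPoint V P => (q.1, q.2.2)) '' G.qcMin P p).ncard

/-- The number of geometric edges, that is, of pairs `{e, rev e}`. -/
noncomputable def numEdges (_ : GBSGraph V E) : ℕ := Nat.card E / 2

/-- Floating pieces: nonempty support, and strictly more edges than minimal points. -/
def HasFloatingPieces (P : Finset ℕ) (G : GBSGraph V E) (p : AffPoint V P) : Prop :=
  (G.qcSupp P p).Nonempty ∧ G.numMinPoints P p < G.numEdges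

/-- The point `q` lies in `F` and above all minimal points of `F` with full-support gap. -/
def DeepIn (P : Finset ℕ) (G : GBSGraph V E) (p : AffPoint V P) (F : Set (AffPoint V P))
    (q : AffPoint V P) : Prop :=
  q ∈ F ∧ ∀ m ∈ G.qcMin P p, m ∈ F → G.FullGap P m q

/-- Normal form with respect to the family `F₀` and the minimal points `mF F`, for `F` a family
different from `F₀` (the other values of `mF` are irrelevant). -/
structure NormalForm (P : Finset ℕ) (G : GBSGraph V E) (p : AffPoint V P)
    (F₀ : Set (AffPoint V P)) (mF : Set (AffPoint V P) → AffPoint V P) : Prop where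
  isFamily : G.IsFamily P p F₀
  chosen : ∀ F, G.IsFamily P p F → F ≠ F₀ → mF F ∈ G.qcMin P p ∧ mF F ∈ F
  /-- The edge at a chosen minimal point `mF F` goes to `F₀`. -/
  connecting : ∀ F, G.IsFamily P p F → F ≠ F₀ →
    ∀ e, (G.affInit P e).Near (mF F) → G.DeepIn P p F₀ (G.affTer P e)
  /-- The edge at any other minimal point stays in the family. -/
  staying : ∀ F, G.IsFamily P p F → ∀ m ∈ G.qcMin P p, m ∈ F → (F ≠ F₀ → ¬ m.Near (mF F)) →
    ∀ e, (G.affInit P e).Near m → G.DeepIn P p F (G.affTer P e)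
  /-- The floating edges have both endpoints in `F₀`. -/
  floating : ∀ e, G.affInit P e ∉ G.qcMin P p → G.affTer P e ∉ G.qcMin P p →
    G.DeepIn P p F₀ (G.affInit P e) ∧ G.DeepIn P p F₀ (G.affTer P e)

/-! ### Moves

A move keeps the vertex set and the set of oriented edges with its reverse map. -/

/-- `G` and `G'` have the same initial vertex and the same label at `f`. -/
def AgreeAt (G G' : GBSGraph V E) (f : E) : Prop :=
  G'.init f = G.init f ∧ G'.label f = G.label f

/-- Edge sign-change. -/
def EdgeSignChange (G G' : GBSGraph V E) : Prop :=
  G'.rev = G.rev ∧ G'.init = G.init ∧ ∃ d : E,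
    G'.label d = - G.label d ∧ G'.label (G.rev d) = - G.label (G.rev d) ∧
    ∀ f, f ≠ d → f ≠ G.rev d → G'.label f = G.label f

/-- Slide of the terminal end of `d` along `e`. -/
def Slide (G G' : GBSGraph V E) : Prop :=
  G'.rev = G.rev ∧ ∃ (d e : E) (l : ℤ), d ≠ e ∧ d ≠ G.rev e ∧
    G.ter d = G.init e ∧ G.label d = l * G.label (G.rev e) ∧
    G'.init d = G.init d ∧ G'.ter d = G.ter e ∧
    G'.label (G.rev d) = G.label (G.rev d) ∧ G'.label d = l * G.label e ∧
    ∀ f, f ≠ d → f ≠ G.rev d → G.AgreeAt G' f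

/-- Swap of the loops `e₁` and `e₂`. -/
def Swap (G G' : GBSGraph V E) : Prop :=
  G'.rev = G.rev ∧ G'.init = G.init ∧
    ∃ (e₁ e₂ : E) (v : V) (n m l₁ l₂ : ℤ) (k₁ k₂ : ℕ), e₁ ≠ e₂ ∧ e₁ ≠ G.rev e₂ ∧
    G.init e₁ = v ∧ G.ter e₁ = v ∧ G.init e₂ = v ∧ G.ter e₂ = v ∧
    G.label (G.rev e₁) = n ∧ G.label e₁ = l₁ * n ∧
    G.label (G.rev e₂) = m ∧ G.label e₂ = l₂ * m ∧
    n ∣ m ∧ m ∣ l₁ ^ k₁ * n ∧ m ∣ l₂ ^ k₂ * n ∧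
    G'.label (G.rev e₁) = m ∧ G'.label e₁ = l₁ * m ∧
    G'.label (G.rev e₂) = n ∧ G'.label e₂ = l₂ * n ∧
    ∀ f, f ≠ e₁ → f ≠ G.rev e₁ → f ≠ e₂ → f ≠ G.rev e₂ → G'.label f = G.label f

/-- Connection of the edge `d` and the loop `e`. -/
def Connection (G G' : GBSGraph V E) : Prop :=
  G'.rev = G.rev ∧
    ∃ (d e : E) (u v : V) (n m l l₁ l₂ : ℤ) (k : ℕ), d ≠ e ∧ d ≠ G.rev e ∧
    G.init d = u ∧ G.ter d = v ∧ G.init e = v ∧ G.ter e = v ∧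
    G.label (G.rev d) = m ∧ G.label d = l₁ * n ∧
    G.label (G.rev e) = n ∧ G.label e = l * n ∧ l₁ * l₂ = l ^ k ∧
    G'.init d = v ∧ G'.ter d = u ∧ G'.init e = u ∧ G'.ter e = u ∧
    G'.label (G.rev d) = n ∧ G'.label d = l₂ * m ∧
    G'.label (G.rev e) = m ∧ G'.label e = l * m ∧
    ∀ f, f ≠ d → f ≠ G.rev d → f ≠ e → f ≠ G.rev e → G.AgreeAt G' f

/-- An edge sign-change, a slide, a swap or a connection. -/
def Move (G G' : GBSGraph V E) : Prop :=
  G.EdgeSignChange G' ∨ G.Slide G' ∨ G.Swap G' ∨ G.Connection G'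

/-- `G` and `H` are the same GBS graph on `V`, up to renaming the edges. -/
def SameUpToEdgeNames (G : GBSGraph V E) (H : GBSGraph V E') : Prop :=
  ∃ φ : E ≃ E', ∀ e, φ (G.rev e) = H.rev (φ e) ∧ H.init (φ e) = G.init e ∧
    H.label (φ e) = G.label e

end GBSGraph

/-!
Two clean graphs in normal form with floating pieces, with the same invariants, are connected by
edge sign-changes, slides and swaps; connections are not needed.

Everything takes place in the affine representation (`AffGraph`, with the moves `AffMove`; the
passage to GBS graphs and back is `GBSGraph.exists_moves_of_reach`). An orientation is chosen so
that the edges at minimal points start there. One minimal point `m₀` of the distinguished family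
is the start of the root edge, which leads from `m₀` to `m₀ + w` with `w` of full support; this
makes every point above `m₀` movable in all directions of the support. The remaining edges that
stay in their family have a displacement vector, end minus start, and the edges at the chosen
minimal points `m_F` carry the other families into the distinguished one. Transporting affine
paths along the latter shows that the displacement vectors generate the linear algebra
(`GBSGraph.IsNormal.coe_span_eq_linAlg`), so that two conjugate points of one family differ by a
combination of displacement vectors (`GBSGraph.IsNormal.sub_mem_of_conj`).

Counting edges in conjugacy classes up to sign, and matching the edges at equal minimal points,
gives a bijection between the edges of the two graphs that preserves these classes
(`GBSGraph.exists_matching`). After sign-changes, both graphs are in standard position with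
respect to one and the same `Frame`, the starts of edges at minimal points agree, and the other
endpoints in the distinguished family are conjugate. It remains to move one affine graph to the
other (`Frame.reach_of_good`), in two stages.

First the displacement vectors are made equal. The two tuples generate the same subgroup of `ℤ/2 ⊕
ℤⁿ` and have the same length, so they differ by an invertible integer matrix
(`exists_matrix_of_span_eq`). Slides add to any displacement vector except that of the root edge a
combination of the others, reversing a floating edge changes the sign of its vector, and a swap
exchanges the vectors of the root edge and of a floating edge if the latter is positive on the
support. As the end of a slide has to stay above the minimal points, the operations on the other
vectors are performed modulo the root vector, which is harmless (`Frame.Ach`). These operations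
generate all invertible matrices that are compatible with the positivity of the root vector
(`ElementaryClosed.maps`): the first row is concentrated in two columns by the Euclidean algorithm
in the other columns, and is then treated by a continued fraction expansion all of whose
intermediate root vectors are positive.

Then the endpoints are brought into place. An edge slides along the displacements of the other
edges. A floating edge can also be moved by its own displacement, by three swaps with the root
edge (`Frame.Good.reach_advance`). The end of the edge at `m_F` slides along the displacements of
the edges in the family `F` after these have been transferred to a floating edge
(`Frame.Good.slide_hub`).
-/

/-! ### Tuples in an abelian group and integer column operations -/

/-- The combination `∑ j, c j • w j`. -/
def linComb {ι A : Type*} [Fintype ι] [AddCommGroup A] (w : ι → A) (c : ι → ℤ) : A :=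
  ∑ j, c j • w j

/-- Add `c j` times the column `i` to the column `j`, for all `j` at once; used with `c i = 0`. -/
def Matrix.colAdd {ι : Type*} (M : Matrix ι ι ℤ) (i : ι) (c : ι → ℤ) : Matrix ι ι ℤ :=
  fun r j => M r j + M r i * c j

/-- A set of tuples closed under the operations that the moves induce on the vectors of the edges.
The entry at `i₀` has to stay positive, and can only be changed by a swap with the entry at `i₁`.
The condition `divide` holds for the interior of a cone; it says that an element is positive if a
positive multiple of it is the sum of a positive element and a nonnegative multiple of another one. -/
structure ElementaryClosed {ι A : Type*} [Fintype ι] [DecidableEq ι] [AddCommGroup A]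
    (Ach : (ι → A) → Prop) (Pos : A → Prop) (i₀ i₁ : ι) : Prop where
  ne : i₀ ≠ i₁
  pos : ∀ w, Ach w → Pos (w i₀)
  add : ∀ w i c, Ach w → i ≠ i₀ → c i = 0 → Ach (Function.update w i (w i + linComb w c))
  swap : ∀ w, Ach w → Pos (w i₁) → Ach (w ∘ Equiv.swap i₀ i₁)
  neg : ∀ w, Ach w → Ach (Function.update w i₁ (- w i₁))
  not_neg : ∀ a, Pos a → ¬ Pos (-a)
  divide : ∀ (a b c : A) (n k : ℕ), Pos a → Pos b → 0 < k → k • c = a + n • b → Pos c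

namespace ElementaryClosed

variable {ι A : Type*} [Fintype ι] [DecidableEq ι] [AddCommGroup A]
  {Ach : (ι → A) → Prop} {Pos : A → Prop} {i₀ i₁ : ι}

/-- The matrix `M` takes every tuple of the set to a tuple of the set, if positivity permits. -/
def Maps (Ach : (ι → A) → Prop) (Pos : A → Prop) (i₀ : ι) (M : Matrix ι ι ℤ) : Prop :=
  ∀ w, Ach w → Pos (linComb w (M i₀)) → Ach (fun i => linComb w (M i))

omit [DecidableEq ι] in
lemma linComb_add (w : ι → A) (c d : ι → ℤ) :
    linComb w (fun j => c j + d j) = linComb w c + linComb w d := by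
  simp [linComb, add_smul, Finset.sum_add_distrib]

omit [DecidableEq ι] in
lemma linComb_mul (w : ι → A) (k : ℤ) (c : ι → ℤ) :
    linComb w (fun j => k * c j) = k • linComb w c := by
  simp [linComb, mul_smul, Finset.smul_sum]

lemma linComb_update (w : ι → A) (i : ι) (a : A) (c : ι → ℤ) :
    linComb (Function.update w i a) c = linComb w c + c i • (a - w i) := by
  unfold linComb
  rw [← Finset.add_sum_erase _ _ (Finset.mem_univ i),
    ← Finset.add_sum_erase Finset.univ (fun j => c j • w j) (Finset.mem_univ i)]
  rw [Finset.sum_congr rfl (g := fun j => c j • w j)]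
  · simp only [Function.update_self, smul_sub]; abel
  · intro j hj
    rw [Function.update_of_ne (Finset.ne_of_mem_erase hj)]

lemma linComb_single (w : ι → A) (i : ι) (k : ℤ) : linComb w (Pi.single i k) = k • w i := by
  unfold linComb
  rw [Finset.sum_eq_single i] <;> simp +contextual

lemma isUnit_colAdd {M : Matrix ι ι ℤ} (hM : IsUnit M) (i : ι) (c : ι → ℤ) (hc : c i = 0) :
    IsUnit (M.colAdd i c) := by
  have hE : Matrix.vecMulVec (Pi.single i 1) c * Matrix.vecMulVec (Pi.single i 1) c = 0 := by
    rw [Matrix.vecMulVec_mul_vecMulVec]; simp [hc]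
  have h1 : M.colAdd i c = M * (1 + Matrix.vecMulVec (Pi.single i 1) c) := by
    ext r j
    rw [mul_add, mul_one, Matrix.add_apply]
    simp [Matrix.colAdd, Matrix.mul_apply, Matrix.vecMulVec_apply, Pi.single_apply]
  rw [h1]
  refine hM.mul ⟨⟨_, 1 - Matrix.vecMulVec (Pi.single i 1) c, ?_, ?_⟩, rfl⟩ <;>
  · simp only [mul_sub, sub_mul, mul_add, add_mul, hE, one_mul, mul_one]; abel

lemma maps_of_colAdd (h : ElementaryClosed Ach Pos i₀ i₁) {M : Matrix ι ι ℤ} {i : ι} {c : ι → ℤ}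
    (hi : i ≠ i₀) (hc : c i = 0) (hM : Maps Ach Pos i₀ (M.colAdd i c)) : Maps Ach Pos i₀ M := by
  have key : ∀ (w : ι → A) r,
      linComb (Function.update w i (w i + linComb w (fun j => - c j))) (M.colAdd i c r) =
        linComb w (M r) := by
    intro w r
    have h1 : linComb w (fun j => - c j) = - linComb w c := by simp [linComb]
    rw [linComb_update]
    unfold Matrix.colAdd
    rw [linComb_add, linComb_mul, hc, h1]
    simp
  intro w hw hp
  have := hM _ (h.add w i (fun j => - c j) hw hi (by simp [hc])) (by rw [key]; exact hp)
  simpa only [key] using this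

omit [DecidableEq ι] in
lemma linComb_swap (w : ι → A) (σ : Equiv.Perm ι) (c : ι → ℤ) :
    linComb (w ∘ σ) (c ∘ σ) = linComb w c := by
  unfold linComb
  exact Equiv.sum_comp σ (fun j => c j • w j)

lemma isUnit_perm {M : Matrix ι ι ℤ} (hM : IsUnit M) (σ : Equiv.Perm ι) :
    IsUnit (M.submatrix id σ) := by
  rw [Matrix.isUnit_iff_isUnit_det] at hM ⊢
  rw [Matrix.det_permute']
  exact ((Equiv.Perm.sign σ).isUnit.map (Int.castRingHom ℤ)).mul hM

/-- Change the sign of the column `i`. -/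
def negCol (M : Matrix ι ι ℤ) (i : ι) : Matrix ι ι ℤ :=
  fun r j => if j = i then - M r j else M r j

lemma isUnit_negCol {M : Matrix ι ι ℤ} (hM : IsUnit M) (i : ι) : IsUnit (negCol M i) := by
  have h1 : negCol M i = M * Matrix.diagonal (fun j => if j = i then -1 else 1) := by
    ext r j
    rw [Matrix.mul_diagonal]
    by_cases hj : j = i <;> simp [negCol, hj]
  rw [h1]
  refine hM.mul ?_
  have h2 : Matrix.diagonal (fun j => if j = i then (-1 : ℤ) else 1) *
      Matrix.diagonal (fun j => if j = i then (-1 : ℤ) else 1) = 1 := by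
    rw [Matrix.diagonal_mul_diagonal, ← Matrix.diagonal_one]
    congr 1
    ext j
    by_cases hj : j = i <;> simp [hj]
  exact ⟨⟨_, _, h2, h2⟩, rfl⟩

lemma maps_of_negCol (h : ElementaryClosed Ach Pos i₀ i₁) {M : Matrix ι ι ℤ}
    (hM : Maps Ach Pos i₀ (negCol M i₁)) : Maps Ach Pos i₀ M := by
  have key : ∀ (w : ι → A) r,
      linComb (Function.update w i₁ (- w i₁)) (negCol M i₁ r) = linComb w (M r) := by
    intro w r
    unfold linComb
    refine Finset.sum_congr rfl fun j _ => ?_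
    by_cases hj : j = i₁
    · subst hj; simp [negCol]
    · simp [negCol, hj]
  intro w hw hp
  have := hM _ (h.neg w hw) (by rw [key]; exact hp)
  simpa only [key] using this

/-- `M'` is obtained from `M` by column operations among the columns in `J`. -/
inductive ColOps (J : Finset ι) : Matrix ι ι ℤ → Matrix ι ι ℤ → Prop
  | refl (M) : ColOps J M M
  | step (M M' : Matrix ι ι ℤ) (i j : ι) (k : ℤ) (hi : i ∈ J) (hj : j ∈ J) (hij : i ≠ j)
      (h : ColOps J (M.colAdd i (Pi.single j k)) M') : ColOps J M M'

lemma ColOps.isUnit {J : Finset ι} {M M' : Matrix ι ι ℤ} (h : ColOps J M M') (hM : IsUnit M) :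
    IsUnit M' := by
  induction h with
  | refl => exact hM
  | step M M' i j k hi hj hij _ ih => exact ih (isUnit_colAdd hM i _ (by simp [hij]))

lemma ColOps.maps {J : Finset ι} {M M' : Matrix ι ι ℤ} (h : ElementaryClosed Ach Pos i₀ i₁)
    (hJ : i₀ ∉ J) (hMM : ColOps J M M') (hM : Maps Ach Pos i₀ M') : Maps Ach Pos i₀ M := by
  induction hMM with
  | refl => exact hM
  | step M M' i j k hi hj hij _ ih =>
    exact h.maps_of_colAdd (i := i) (fun e => hJ (e ▸ hi)) (by simp [hij]) (ih hM)

omit [Fintype ι] in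
lemma ColOps.row_eq {J : Finset ι} {M M' : Matrix ι ι ℤ} (h : ColOps J M M') (d : ι)
    (hd : ∀ j ∈ J, M d j = 0) : M' d = M d := by
  induction h with
  | refl => rfl
  | step M M' i j k hi hj hij _ ih =>
    have : M.colAdd i (Pi.single j k) d = M d := by
      funext l; simp [Matrix.colAdd, hd i hi]
    rw [ih (by rw [this]; exact hd), this]

omit [Fintype ι] in
/-- Moving an entry of the row `r` from the column `p` to the column `a` where the row vanishes. -/
lemma exists_colOps_move {J : Finset ι} (M : Matrix ι ι ℤ) (r p a : ι) (hp : p ∈ J) (ha : a ∈ J)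
    (hpa : p ≠ a) (h0 : M r a = 0) :
    ∃ M', ColOps J M M' ∧ M' r a = M r p ∧ M' r p = 0 ∧ ∀ j, j ≠ a → j ≠ p → M' r j = M r j := by
  refine ⟨_, .step _ _ p a 1 hp ha hpa (.step _ _ a p (-1) ha hp hpa.symm (.refl _)), ?_, ?_, ?_⟩
  · simp [Matrix.colAdd, hpa.symm, h0]
  · simp [Matrix.colAdd, hpa, h0]
  · intro j hja hjp
    simp [Matrix.colAdd, hja, hjp]

omit [Fintype ι] in
/-- The Euclidean algorithm: column operations concentrate a row in a single column. -/
lemma exists_colOps_concentrate {J : Finset ι} (M : Matrix ι ι ℤ) (r a : ι) (ha : a ∈ J) :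
    ∃ M', ColOps J M M' ∧ ∀ j ∈ J, j ≠ a → M' r j = 0 := by
  induction hn : ∑ j ∈ J, (M r j).natAbs using Nat.strong_induction_on generalizing M with
  | _ n ih =>
  by_cases h2 : ∃ p ∈ J, ∃ q ∈ J, p ≠ q ∧ M r p ≠ 0 ∧ M r q ≠ 0
  · -- subtract the smaller of two nonzero entries from the larger, up to sign
    obtain ⟨p, hp, q, hq, hpq, hp0, hq0, hle⟩ : ∃ p ∈ J, ∃ q ∈ J, p ≠ q ∧ M r p ≠ 0 ∧
        M r q ≠ 0 ∧ (M r q).natAbs ≤ (M r p).natAbs := by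
      obtain ⟨p, hp, q, hq, hpq, hp0, hq0⟩ := h2
      rcases le_total (M r q).natAbs (M r p).natAbs with h | h
      · exact ⟨p, hp, q, hq, hpq, hp0, hq0, h⟩
      · exact ⟨q, hq, p, hp, hpq.symm, hq0, hp0, h⟩
    obtain ⟨k, hk⟩ : ∃ k : ℤ, (M r p + M r q * k).natAbs < (M r p).natAbs := by
      rcases le_total 0 (M r p) with h | h <;> rcases le_total 0 (M r q) with h' | h'
      · exact ⟨-1, by omega⟩
      · exact ⟨1, by omega⟩
      · exact ⟨1, by omega⟩
      · exact ⟨-1, by omega⟩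
    obtain ⟨M', hM', h0⟩ := ih _ (by
      rw [← hn]
      refine Finset.sum_lt_sum (f := fun j => (M.colAdd q (Pi.single p k) r j).natAbs)
        (fun j _ => ?_) ⟨p, hp, ?_⟩
      · by_cases hj : j = p
        · subst hj; simpa [Matrix.colAdd] using hk.le
        · simp [Matrix.colAdd, hj]
      · simpa [Matrix.colAdd] using hk) (M.colAdd q (Pi.single p k)) rfl
    exact ⟨M', .step _ _ q p k hq hp hpq.symm hM', h0⟩
  · by_cases h1 : ∃ p ∈ J, p ≠ a ∧ M r p ≠ 0
    · obtain ⟨p, hp, hpa, hp0⟩ := h1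
      have hz : ∀ j ∈ J, j ≠ p → M r j = 0 := by
        intro j hj hjp
        by_contra hne
        exact h2 ⟨j, hj, p, hp, hjp, hne, hp0⟩
      obtain ⟨M', hM', -, h4, h5⟩ := exists_colOps_move M r p a hp ha hpa (hz a ha hpa.symm)
      refine ⟨M', hM', fun j hj hja => ?_⟩
      by_cases hjp : j = p
      · rw [hjp, h4]
      · rw [h5 j hja hjp, hz j hj hjp]
    · push Not at h1
      exact ⟨M, .refl M, h1⟩

lemma row_entry_of_isUnit {M : Matrix ι ι ℤ} (hM : IsUnit M) {D : Finset ι} (r : ι)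
    (hr : r ∉ D) (hD : ∀ d ∈ D, M d = Pi.single d 1) (h0 : ∀ j, j ∉ D → j ≠ r → M r j = 0) :
    M r r = 1 ∨ M r r = -1 := by
  obtain ⟨⟨M, N, hMN, hNM⟩, rfl⟩ := hM
  simp only at hD h0 ⊢
  have hN : ∀ d ∈ D, N d r = 0 := by
    intro d hd
    have := congrFun (congrFun hMN d) r
    rw [Matrix.mul_apply, Matrix.one_apply_ne (ne_of_mem_of_not_mem hd hr), hD d hd] at this
    simpa [Pi.single_apply] using this
  have := congrFun (congrFun hMN r) r
  rw [Matrix.mul_apply, Matrix.one_apply_eq, Finset.sum_eq_single r] at this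
  · exact Int.isUnit_iff.mp (IsUnit.of_mul_eq_one _ this)
  · intro j _ hj
    by_cases hjD : j ∈ D
    · rw [hN j hjD, mul_zero]
    · rw [h0 j hjD hj, zero_mul]
  · simp

/-- A matrix whose row `i₀` is trivial is reduced to the identity row by row; a sign left over at
the end is removed at the column `i₁`. -/
lemma maps_of_rows (h : ElementaryClosed Ach Pos i₀ i₁) (M : Matrix ι ι ℤ) (hM : IsUnit M)
    (D : Finset ι) (h₀ : i₀ ∈ D) (h₁ : i₁ ∉ D) (hD : ∀ d ∈ D, M d = Pi.single d 1) :
    Maps Ach Pos i₀ M := by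
  induction hn : (Dᶜ).card using Nat.strong_induction_on generalizing M D with
  | _ n ih =>
  -- once a diagonal entry is `1` and the entries outside `D` vanish, the row can be cleared
  have clear : ∀ M : Matrix ι ι ℤ, IsUnit M → (∀ d ∈ D, M d = Pi.single d 1) → ∀ r, r ∉ D →
      (∀ j, j ∉ D → j ≠ r → M r j = 0) → M r r = 1 →
      ∃ M' : Matrix ι ι ℤ, IsUnit M' ∧ (∀ d ∈ insert r D, M' d = Pi.single d 1) ∧
        (Maps Ach Pos i₀ M' → Maps Ach Pos i₀ M) := by
    intro M hM hD r hr h0 h1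
    let c : ι → ℤ := fun j => if j = r then 0 else - M r j
    have hcr : c r = 0 := by simp [c]
    refine ⟨M.colAdd r c, isUnit_colAdd hM r c hcr, ?_,
      fun hm => h.maps_of_colAdd (ne_of_mem_of_not_mem h₀ hr).symm hcr hm⟩
    intro d hd
    rcases Finset.mem_insert.mp hd with rfl | hd
    · funext j
      by_cases hj : j = d
      · subst hj; simp [Matrix.colAdd, c, h1]
      · simp [Matrix.colAdd, c, h1, hj]
    · funext j
      have : M d r = 0 := by
        rw [hD d hd]; exact Pi.single_eq_of_ne (ne_of_mem_of_not_mem hd hr).symm _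
      simp [Matrix.colAdd, this, hD d hd]
  by_cases hJ : ∃ r, r ∉ D ∧ r ≠ i₁
  · obtain ⟨r, hr, hr1⟩ := hJ
    have hzero : ∀ M : Matrix ι ι ℤ, (∀ d ∈ D, M d = Pi.single d 1) →
        ∀ d ∈ D, ∀ j ∈ Dᶜ, M d j = 0 := by
      intro M hD d hd j hj
      rw [hD d hd]
      exact Pi.single_eq_of_ne (ne_of_mem_of_not_mem hd (Finset.mem_compl.mp hj)).symm _
    have h0J : i₀ ∉ Dᶜ := by simpa using h₀
    obtain ⟨M₁, hM₁, hz₁⟩ := exists_colOps_concentrate (J := Dᶜ) M r r (by simpa using hr)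
    have hD₁ : ∀ d ∈ D, M₁ d = Pi.single d 1 := fun d hd => by
      rw [hM₁.row_eq d (hzero M hD d hd), hD d hd]
    have hz₁' : ∀ j, j ∉ D → j ≠ r → M₁ r j = 0 := fun j hj hjr => hz₁ j (by simpa using hj) hjr
    -- make the diagonal entry positive with the help of the column `i₁`
    obtain ⟨M₂, hM₂, hr₂, hz₂⟩ : ∃ M₂, ColOps Dᶜ M₁ M₂ ∧ M₂ r r = 1 ∧
        ∀ j, j ∉ D → j ≠ r → M₂ r j = 0 := by
      rcases row_entry_of_isUnit (hM₁.isUnit hM) r hr hD₁ hz₁' with h1 | h1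
      · exact ⟨M₁, .refl _, h1, hz₁'⟩
      · have hrJ : r ∈ Dᶜ := by simpa using hr
        have hiJ : i₁ ∈ Dᶜ := by simpa using h₁
        have hz : M₁ r i₁ = 0 := hz₁' i₁ h₁ hr1.symm
        refine ⟨_, .step _ _ r i₁ 1 hrJ hiJ hr1 (.step _ _ i₁ r (-2) hiJ hrJ hr1.symm
          (.step _ _ r i₁ 1 hrJ hiJ hr1 (.refl _))), ?_, ?_⟩
        · simp [Matrix.colAdd, h1, hr1, hz]
        · intro j hj hjr
          by_cases hj1 : j = i₁
          · subst hj1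
            simp [Matrix.colAdd, h1, hr1, hz, hjr]
          · simp [Matrix.colAdd, hj1, hjr, hz₁' j hj hjr]
    have hD₂ : ∀ d ∈ D, M₂ d = Pi.single d 1 := fun d hd => by
      rw [hM₂.row_eq d (hzero M₁ hD₁ d hd), hD₁ d hd]
    have hU₂ : IsUnit M₂ := hM₂.isUnit (hM₁.isUnit hM)
    obtain ⟨M₃, hU₃, hD₃, hmaps⟩ := clear M₂ hU₂ hD₂ r hr hz₂ hr₂
    refine hM₁.maps h h0J (hM₂.maps h h0J (hmaps (ih _ ?_ M₃ hU₃ (insert r D)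
      (Finset.mem_insert_of_mem h₀) ?_ hD₃ rfl)))
    · rw [← hn]
      refine Finset.card_lt_card ?_
      rw [Finset.compl_ssubset_compl]
      exact Finset.ssubset_insert hr
    · simp [h₁, hr1.symm]
  · push Not at hJ
    have h0 : ∀ j, j ∉ D → j ≠ i₁ → M i₁ j = 0 := fun j hj hj1 => absurd (hJ j hj) hj1
    have hone : ∀ M : Matrix ι ι ℤ, IsUnit M → (∀ d ∈ D, M d = Pi.single d 1) →
        (∀ j, j ∉ D → j ≠ i₁ → M i₁ j = 0) → M i₁ i₁ = 1 → Maps Ach Pos i₀ M := by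
      intro M hM hD h0 h1
      obtain ⟨M', -, hD', hmaps⟩ := clear M hM hD i₁ h₁ h0 h1
      refine hmaps fun w hw _ => ?_
      have : (fun i => linComb w (M' i)) = w := by
        funext i
        have hi : i ∈ insert i₁ D := by
          by_cases hi : i ∈ D
          · exact Finset.mem_insert_of_mem hi
          · rw [hJ i hi]; exact Finset.mem_insert_self _ _
        rw [hD' i hi, linComb_single, one_smul]
      rwa [this]
    rcases row_entry_of_isUnit hM i₁ h₁ hD h0 with h1 | h1
    · exact hone M hM hD h0 h1
    · refine h.maps_of_negCol (hone _ (isUnit_negCol hM i₁) ?_ ?_ ?_)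
      · intro d hd
        funext j
        by_cases hj : j = i₁
        · have : d ≠ i₁ := fun e => h₁ (e ▸ hd)
          subst hj; simp [negCol, hD d hd, this]
        · simp [negCol, hj, hD d hd]
      · intro j hj hj1; simp [negCol, hj1, h0 j hj hj1]
      · simp [negCol, h1]

/-- The case where the row `i₀` is supported in the columns `i₀` and `i₁`, by the continued fraction
expansion of the quotient of its two entries `α` and `β`. Rounding the quotient up gives a remainder
in `(-β, 0]`; then `β • w i₁` is the sum of the new entry at `i₀` and a nonnegative multiple of
`w i₀`, hence `w i₁` is positive and the two may be swapped. -/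
lemma maps_of_two_columns (h : ElementaryClosed Ach Pos i₀ i₁) (M : Matrix ι ι ℤ) (hM : IsUnit M)
    (h0 : ∀ j, j ≠ i₀ → j ≠ i₁ → M i₀ j = 0) : Maps Ach Pos i₀ M := by
  induction hn : (M i₀ i₁).natAbs using Nat.strong_induction_on generalizing M with
  | _ n ih =>
  by_cases hβ : M i₀ i₁ = 0
  · intro w hw hp
    have hrow : ∀ j, j ≠ i₀ → M i₀ j = 0 := fun j hj => by
      by_cases hj1 : j = i₁
      · rw [hj1, hβ]
      · exact h0 j hj hj1
    have h00 : M i₀ = Pi.single i₀ (M i₀ i₀) := by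
      funext j
      by_cases hj : j = i₀
      · subst hj; simp
      · rw [hrow j hj, Pi.single_eq_of_ne hj]
    rcases row_entry_of_isUnit hM (D := ∅) i₀ (by simp) (by simp) (fun j _ => hrow j) with h1 | h1
    · refine h.maps_of_rows M hM {i₀} (by simp) (by simpa using h.ne.symm) ?_ w hw hp
      intro d hd
      rw [Finset.mem_singleton.mp hd, h00, h1]
    · rw [h00, h1, linComb_single, neg_one_smul] at hp
      exact absurd hp (h.not_neg _ (h.pos w hw))
  · have hpos : ∀ M : Matrix ι ι ℤ, IsUnit M → (∀ j, j ≠ i₀ → j ≠ i₁ → M i₀ j = 0) →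
        (M i₀ i₁).natAbs = n → 0 < M i₀ i₁ → Maps Ach Pos i₀ M := by
      intro M hM h0 hn hβ
      set β := M i₀ i₁ with hβdef
      set α := M i₀ i₀ with hαdef
      -- after this operation the entry `α` lies in the interval `(-β, 0]`
      set q : ℤ := -((-α) / β) with hq
      have hα : α - q * β = -((-α) % β) := by
        have := Int.mul_ediv_add_emod (-α) β
        rw [hq]; linarith [mul_comm β (-α / β)]
      have hmod0 := Int.emod_nonneg (-α) hβ.ne'
      have hmod1 := Int.emod_lt_of_pos (-α) hβ
      set M₁ := M.colAdd i₁ (Pi.single i₀ (-q)) with hM₁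
      have hU₁ : IsUnit M₁ := isUnit_colAdd hM i₁ _ (by simp [h.ne.symm])
      have e1 : M₁ i₀ i₁ = β := by simp [hM₁, Matrix.colAdd, h.ne.symm, ← hβdef]
      have e0 : M₁ i₀ i₀ = -((-α) % β) := by
        rw [← hα]; simp [hM₁, Matrix.colAdd, ← hβdef, ← hαdef]; ring
      have ez : ∀ j, j ≠ i₀ → j ≠ i₁ → M₁ i₀ j = 0 := fun j hj hj1 => by
        simp [hM₁, Matrix.colAdd, hj, h0 j hj hj1]
      refine h.maps_of_colAdd (i := i₁) (c := Pi.single i₀ (-q)) h.ne.symm (by simp [h.ne.symm]) ?_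
      intro w hw hp
      have hsum : linComb w (M₁ i₀) = -((-α) % β) • w i₀ + β • w i₁ := by
        unfold linComb
        rw [← Finset.add_sum_erase _ _ (Finset.mem_univ i₀),
          ← Finset.add_sum_erase _ _ (Finset.mem_erase.mpr ⟨h.ne.symm, Finset.mem_univ i₁⟩),
          Finset.sum_eq_zero, e0, e1, add_zero]
        intro j hj
        simp only [Finset.mem_erase] at hj
        rw [ez j hj.2.1 hj.1, zero_smul]
      have hp1 : Pos (w i₁) := by
        refine h.divide _ (w i₀) (w i₁) ((-α) % β).toNat β.toNat hp (h.pos w hw) (by omega) ?_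
        rw [← hM₁, hsum, ← natCast_zsmul, ← natCast_zsmul, Int.toNat_of_nonneg hmod0,
          Int.toNat_of_nonneg hβ.le]
        simp
      have key := fun r => linComb_swap w (Equiv.swap i₀ i₁) (M₁ r)
      have := ih _ (by
          show ((M₁.submatrix id (Equiv.swap i₀ i₁)) i₀ i₁).natAbs < n
          rw [Matrix.submatrix_apply, Equiv.swap_apply_right, id, e0, ← hn]
          omega) (M₁.submatrix id (Equiv.swap i₀ i₁)) (isUnit_perm hU₁ _) (by
          intro j hj hj1
          rw [Matrix.submatrix_apply, Equiv.swap_apply_of_ne_of_ne hj hj1]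
          exact ez j hj hj1) rfl (w ∘ Equiv.swap i₀ i₁) (h.swap w hw hp1)
        (by rw [show (M₁.submatrix id (Equiv.swap i₀ i₁)) i₀ = M₁ i₀ ∘ Equiv.swap i₀ i₁ from rfl,
              key]; exact hp)
      refine (congrArg Ach (funext fun r => ?_)).mp this
      exact key r
    rcases lt_or_gt_of_ne hβ with hneg | hpos'
    · refine h.maps_of_negCol (hpos _ (isUnit_negCol hM i₁) ?_ ?_ ?_)
      · intro j hj hj1; simp [negCol, hj1, h0 j hj hj1]
      · simpa [negCol] using hn
      · simpa [negCol] using hneg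
    · exact hpos M hM h0 hn hpos'

/-- Every invertible matrix is realised by permitted operations, as soon as the entry at `i₀` that it
produces is positive. Its row `i₀` is first concentrated in the columns `i₀` and `i₁`. -/
theorem maps (h : ElementaryClosed Ach Pos i₀ i₁) (M : Matrix ι ι ℤ) (hM : IsUnit M) :
    Maps Ach Pos i₀ M := by
  obtain ⟨M₁, hM₁, hz⟩ := exists_colOps_concentrate (J := Finset.univ.erase i₀) M i₀ i₁
    (by simp [h.ne.symm])
  exact hM₁.maps h (by simp) (h.maps_of_two_columns M₁ (hM₁.isUnit hM)
    fun j hj hj1 => hz j (by simp [hj]) hj1)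

end ElementaryClosed

/-! ### Generating tuples of a subgroup of `ℤ/2 ⊕ ℤⁿ` -/

/-- A nonzero homomorphism from a free abelian group onto `ℤ/2` is, in a suitable basis, the
reduction modulo `2` of a prescribed coordinate. -/
lemma exists_basis_zmod_two {K : Type*} [AddCommGroup K] {n : ℕ} (b : Module.Basis (Fin n) ℤ K)
    (χ : K →ₗ[ℤ] ZMod 2) (hχ : χ ≠ 0) (i₀ : Fin n) :
    ∃ b' : Module.Basis (Fin n) ℤ K, ∀ j, χ (b' j) = if j = i₀ then 1 else 0 := by
  obtain ⟨i, hi⟩ : ∃ i, χ (b i) ≠ 0 := by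
    by_contra hcon
    push Not at hcon
    exact hχ (b.ext (fun i => by simpa using hcon i))
  have h01 : ∀ z : ZMod 2, z ≠ 0 → z = 1 := by decide
  have hi1 : χ (b i) = 1 := h01 _ hi
  -- subtract `b i` from the basis elements with nonzero image
  let δ : K →ₗ[ℤ] ℤ := b.constr ℤ (fun j => if j = i then 0 else ((χ (b j)).val : ℤ))
  have hδ : ∀ j, δ (b j) = if j = i then 0 else ((χ (b j)).val : ℤ) :=
    fun j => Module.Basis.constr_basis b ℤ _ j
  have hδi : δ (- b i) = 0 := by rw [map_neg, hδ, if_pos rfl, neg_zero]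
  let b₁ := b.map (LinearEquiv.transvection hδi)
  have hb₁ : ∀ j, χ (b₁ j) = if j = i then 1 else 0 := by
    intro j
    have h1 : b₁ j = b j + δ (b j) • (- b i) := by
      rw [Module.Basis.map_apply, LinearEquiv.transvection.apply]
    rw [h1, hδ]
    by_cases hj : j = i
    · subst hj; simp [hi1]
    · simp [hj, hi1, CharTwo.add_self_eq_zero]
  refine ⟨b₁.reindex (Equiv.swap i i₀), fun j => ?_⟩
  rw [Module.Basis.reindex_apply, hb₁, Equiv.symm_swap]
  congr 1
  rw [eq_iff_iff, Equiv.swap_apply_eq_iff, Equiv.swap_apply_left]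

lemma exists_equiv_zmod_two {K K' : Type*} [AddCommGroup K] [AddCommGroup K']
    [Module.Free ℤ K] [Module.Finite ℤ K] [Module.Free ℤ K'] [Module.Finite ℤ K']
    (hr : Module.finrank ℤ K = Module.finrank ℤ K') (χ : K →ₗ[ℤ] ZMod 2) (χ' : K' →ₗ[ℤ] ZMod 2)
    (h : χ = 0 ↔ χ' = 0) : ∃ θ : K ≃ₗ[ℤ] K', ∀ x, χ' (θ x) = χ x := by
  by_cases h0 : χ = 0
  · refine ⟨LinearEquiv.ofFinrankEq _ _ hr, fun x => ?_⟩
    rw [h0, h.mp h0]; rfl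
  · have b := Module.finBasis ℤ K
    have b' := Module.finBasisOfFinrankEq ℤ K' hr.symm
    obtain ⟨i₀⟩ : Nonempty (Fin (Module.finrank ℤ K)) := by
      by_contra hcon
      rw [not_nonempty_iff] at hcon
      exact h0 (b.ext (fun i => isEmptyElim i))
    obtain ⟨c, hc⟩ := exists_basis_zmod_two b χ h0 i₀
    obtain ⟨c', hc'⟩ := exists_basis_zmod_two b' χ' (fun e => h0 (h.mpr e)) i₀
    refine ⟨c.equiv c' (Equiv.refl _), fun x => ?_⟩
    have : χ' ∘ₗ (c.equiv c' (Equiv.refl _)).toLinearMap = χ :=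
      c.ext (fun i => by simp [hc, hc'])
    exact LinearMap.congr_fun this x

/-- Two homomorphisms from a free abelian group of finite rank to `ℤ/2 ⊕ ℤⁿ` with the same range
differ by an automorphism of the free group. The kernels of the projections to `ℤⁿ` have the same
rank and are matched compatibly with the characters to `ℤ/2`; their complements are matched by means
of splittings. -/
lemma exists_equiv_of_range_eq {N κ : Type*} [Finite κ] [AddCommGroup N] [Module.Free ℤ N]
    [Module.Finite ℤ N] (f g : N →ₗ[ℤ] ZMod 2 × (κ → ℤ))
    (hfg : LinearMap.range f = LinearMap.range g) : ∃ θ : N ≃ₗ[ℤ] N, ∀ x, f (θ x) = g x := by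
  have hsub : ∀ x, ∃ y, g y = f x := fun x => by
    have : f x ∈ LinearMap.range g := hfg ▸ LinearMap.mem_range_self f x
    exact this
  have hsub' : ∀ x, ∃ y, f y = g x := fun x => by
    have : g x ∈ LinearMap.range f := hfg ▸ LinearMap.mem_range_self g x
    exact this
  set L := LinearMap.range (LinearMap.snd ℤ (ZMod 2) (κ → ℤ) ∘ₗ f) with hL
  have hgL : ∀ x, (LinearMap.snd ℤ (ZMod 2) (κ → ℤ) ∘ₗ g) x ∈ L := fun x => by
    obtain ⟨y, hy⟩ := hsub' x
    exact ⟨y, by simp [hy]⟩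
  let f₁ := LinearMap.fst ℤ (ZMod 2) (κ → ℤ) ∘ₗ f
  let g₁ := LinearMap.fst ℤ (ZMod 2) (κ → ℤ) ∘ₗ g
  let f₂ : N →ₗ[ℤ] L := (LinearMap.snd ℤ (ZMod 2) (κ → ℤ) ∘ₗ f).rangeRestrict
  let g₂ : N →ₗ[ℤ] L := (LinearMap.snd ℤ (ZMod 2) (κ → ℤ) ∘ₗ g).codRestrict L hgL
  have hf₂ : ∀ x, (f₂ x : κ → ℤ) = (f x).2 := fun x => rfl
  have hg₂ : ∀ x, (g₂ x : κ → ℤ) = (g x).2 := fun x => rfl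
  have hfs : Function.Surjective f₂ := LinearMap.surjective_rangeRestrict _
  have hgs : Function.Surjective g₂ := by
    intro l
    obtain ⟨x, hx⟩ := hfs l
    obtain ⟨y, hy⟩ := hsub x
    exact ⟨y, by rw [← hx]; apply Subtype.ext; rw [hg₂, hf₂, hy]⟩
  obtain ⟨sf, hsf⟩ := Module.projective_lifting_property f₂ LinearMap.id hfs
  obtain ⟨sg, hsg⟩ := Module.projective_lifting_property g₂ LinearMap.id hgs
  have hsf' : ∀ l, f₂ (sf l) = l := fun l => LinearMap.congr_fun hsf l
  have hsg' : ∀ l, g₂ (sg l) = l := fun l => LinearMap.congr_fun hsg l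
  let χf : LinearMap.ker f₂ →ₗ[ℤ] ZMod 2 := f₁ ∘ₗ (LinearMap.ker f₂).subtype
  let χg : LinearMap.ker g₂ →ₗ[ℤ] ZMod 2 := g₁ ∘ₗ (LinearMap.ker g₂).subtype
  have mem_f : ∀ x, (f x).2 = 0 → x ∈ LinearMap.ker f₂ := fun x hx => by
    rw [LinearMap.mem_ker]; exact Subtype.ext hx
  have mem_g : ∀ x, (g x).2 = 0 → x ∈ LinearMap.ker g₂ := fun x hx => by
    rw [LinearMap.mem_ker]; exact Subtype.ext hx
  have of_mem_f : ∀ x ∈ LinearMap.ker f₂, (f x).2 = 0 := fun x hx => by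
    rw [← hf₂, LinearMap.mem_ker.mp hx]; rfl
  have of_mem_g : ∀ x ∈ LinearMap.ker g₂, (g x).2 = 0 := fun x hx => by
    rw [← hg₂, LinearMap.mem_ker.mp hx]; rfl
  have hχ : χg = 0 ↔ χf = 0 := by
    constructor
    · intro h
      ext ⟨x, hx⟩
      obtain ⟨y, hy⟩ := hsub x
      have hy2 := mem_g y (by rw [hy]; exact of_mem_f x hx)
      have : (g y).1 = 0 := LinearMap.congr_fun h ⟨y, hy2⟩
      rw [hy] at this; exact this
    · intro h
      ext ⟨x, hx⟩
      obtain ⟨y, hy⟩ := hsub' x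
      have hy2 := mem_f y (by rw [hy]; exact of_mem_g x hx)
      have : (f y).1 = 0 := LinearMap.congr_fun h ⟨y, hy2⟩
      rw [hy] at this; exact this
  have hrank : Module.finrank ℤ (LinearMap.ker g₂) = Module.finrank ℤ (LinearMap.ker f₂) := by
    have e1 := Submodule.finrank_quotient_add_finrank (LinearMap.ker f₂)
    have e2 := Submodule.finrank_quotient_add_finrank (LinearMap.ker g₂)
    rw [(f₂.quotKerEquivOfSurjective hfs).finrank_eq] at e1
    rw [(g₂.quotKerEquivOfSurjective hgs).finrank_eq] at e2
    omega
  obtain ⟨θK, hθK⟩ := exists_equiv_zmod_two hrank χg χf hχ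
  -- correct the `ℤ/2` component on the complement of the kernel
  let lam : L →ₗ[ℤ] ZMod 2 := g₁ ∘ₗ sg - f₁ ∘ₗ sf
  have hlam : ∀ l, lam l ∈ LinearMap.range χf := by
    intro l
    obtain ⟨y, hy⟩ := hsub' (sg l)
    have h2 : (f (y - sf l)).2 = 0 := by
      rw [map_sub, Prod.snd_sub, hy, ← hg₂, ← hf₂, hsf', hsg', sub_self]
    refine ⟨⟨y - sf l, mem_f _ h2⟩, ?_⟩
    show (f (y - sf l)).1 = (g (sg l)).1 - (f (sf l)).1
    rw [map_sub, hy]; rfl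
  obtain ⟨h, hh⟩ := Module.projective_lifting_property χf.rangeRestrict
    (lam.codRestrict _ hlam) (LinearMap.surjective_rangeRestrict _)
  have hh' : ∀ l, χf (h l) = lam l := fun l => congrArg Subtype.val (LinearMap.congr_fun hh l)
  let π : N →ₗ[ℤ] LinearMap.ker g₂ := (LinearMap.id - sg ∘ₗ g₂).codRestrict _ (fun x => by
    simp [LinearMap.mem_ker, hsg'])
  have hπ : ∀ x, (π x : N) = x - sg (g₂ x) := fun x => rfl
  let θ : N →ₗ[ℤ] N := (LinearMap.ker f₂).subtype ∘ₗ θK.toLinearMap ∘ₗ π + sf ∘ₗ g₂ +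
    (LinearMap.ker f₂).subtype ∘ₗ h ∘ₗ g₂
  have hθ : ∀ x, θ x = (θK (π x) : N) + sf (g₂ x) + (h (g₂ x) : N) := fun x => rfl
  have hθs : Function.Surjective θ := by
    intro y
    set l := f₂ y with hl
    have hk : y - sf l - h l ∈ LinearMap.ker f₂ := by
      rw [LinearMap.mem_ker, map_sub, map_sub, hsf', LinearMap.mem_ker.mp (h l).2, hl]
      simp
    refine ⟨sg l + θK.symm ⟨_, hk⟩, ?_⟩
    have e1 : g₂ (sg l + θK.symm ⟨_, hk⟩) = l := by
      rw [map_add, hsg', LinearMap.mem_ker.mp (θK.symm ⟨_, hk⟩).2, add_zero]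
    have e2 : π (sg l + θK.symm ⟨_, hk⟩) = θK.symm ⟨_, hk⟩ := by
      apply Subtype.ext
      rw [hπ, e1]; abel
    rw [hθ, e1, e2, LinearEquiv.apply_symm_apply]
    show y - sf l - (h l : N) + sf l + (h l : N) = y
    abel
  refine ⟨LinearEquiv.ofBijective θ ⟨IsNoetherian.injective_of_surjective_endomorphism θ hθs, hθs⟩,
    fun x => ?_⟩
  show f (θ x) = g x
  rw [hθ]
  refine Prod.ext ?_ ?_
  · have e1 : (f (θK (π x))).1 = χg (π x) := hθK (π x)
    have e2 : (f (h (g₂ x))).1 = lam (g₂ x) := hh' (g₂ x)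
    have e3 : χg (π x) = (g x).1 - (g (sg (g₂ x))).1 := by
      show (g (π x)).1 = _
      rw [hπ, map_sub]; rfl
    rw [map_add, map_add, Prod.fst_add, Prod.fst_add, e1, e2, e3]
    show _ + _ + ((g (sg (g₂ x))).1 - (f (sf (g₂ x))).1) = _
    abel
  · rw [map_add, map_add, Prod.snd_add, Prod.snd_add, of_mem_f _ (θK (π x)).2,
      of_mem_f _ (h (g₂ x)).2, ← hf₂, hsf', hg₂]
    simp

/-- Two tuples of the same length generating the same subgroup of `ℤ/2 ⊕ ℤⁿ` differ by an
invertible integer matrix. -/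
theorem exists_matrix_of_span_eq {ι κ : Type*} [Finite κ] [Fintype ι] [DecidableEq ι]
    (w w' : ι → ZMod 2 × (κ → ℤ))
    (h : Submodule.span ℤ (Set.range w) = Submodule.span ℤ (Set.range w')) :
    ∃ M : Matrix ι ι ℤ, IsUnit M ∧ ∀ i, w' i = linComb w (M i) := by
  obtain ⟨θ, hθ⟩ := exists_equiv_of_range_eq (Fintype.linearCombination ℤ w)
    (Fintype.linearCombination ℤ w') (by
      rw [Fintype.range_linearCombination, Fintype.range_linearCombination, h])
  refine ⟨(LinearMap.toMatrix' θ.toLinearMap).transpose, ?_, fun i => ?_⟩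
  · rw [Matrix.isUnit_transpose]
    have h1 : LinearMap.toMatrix' θ.toLinearMap * LinearMap.toMatrix' θ.symm.toLinearMap = 1 := by
      rw [← LinearMap.toMatrix'_comp]; simp
    exact ⟨⟨_, _, h1, mul_eq_one_comm.mp h1⟩, rfl⟩
  · have := hθ (Pi.single i 1)
    rw [Fintype.linearCombination_apply_single, one_smul] at this
    rw [← this, Fintype.linearCombination_apply]
    unfold linComb
    refine Finset.sum_congr rfl fun j _ => ?_
    rw [Matrix.transpose_apply, LinearMap.toMatrix'_apply]
    rfl

/-! ### Points of the affine representation -/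

namespace AffCone

variable {P : Finset ℕ}

@[simp] lemma toGroup_zero : (0 : AffCone P).toGroup = 0 := by
  ext <;> simp [toGroup]

@[simp] lemma toGroup_add (u v : AffCone P) : (u + v).toGroup = u.toGroup + v.toGroup := by
  ext <;> simp [toGroup]

lemma toGroup_injective : Function.Injective (toGroup (P := P)) := by
  intro u v h
  have h2 : ∀ r, u.2 r = v.2 r := fun r => by
    have : ((u.2 r : ℕ) : ℤ) = v.2 r := congrFun (congrArg Prod.snd h) r
    exact_mod_cast this
  have h1 : u.toGroup.1 = v.toGroup.1 := by rw [h]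
  exact Prod.ext h1 (funext h2)

lemma supp_add (u v : AffCone P) : (u + v).supp = u.supp ∪ v.supp := by
  ext r; simp [supp]; tauto

@[simp] lemma supp_zero : (0 : AffCone P).supp = ∅ := by
  ext r; simp [supp]

lemma supp_nsmul_subset (n : ℕ) (u : AffCone P) : (n • u).supp ⊆ u.supp := by
  intro r
  simp only [supp, Set.mem_ofPred_eq, Prod.smul_snd, Pi.smul_apply, smul_eq_mul]
  intro h h'
  exact h (by rw [h', mul_zero])

lemma toGroup_nsmul (n : ℕ) (u : AffCone P) : (n • u).toGroup = n • u.toGroup := by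
  ext <;> simp [toGroup]

/-- A multiple of an element of full support `S` dominates every element supported in `S`. -/
lemma exists_nsmul_eq_add {S : Set P} {w u : AffCone P} (hw : w.supp = S) (hu : u.supp ⊆ S) :
    ∃ (n : ℕ) (z : AffCone P), n • w = u + z ∧ z.supp ⊆ S := by
  classical
  obtain ⟨n, hn⟩ : ∃ n : ℕ, n = ∑ r, u.2 r := ⟨_, rfl⟩
  refine ⟨n, (n • w.1 - u.1, fun r => n * w.2 r - u.2 r), ?_, ?_⟩
  · refine Prod.ext (by simp) (funext fun r => ?_)
    show n * w.2 r = u.2 r + (n * w.2 r - u.2 r)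
    have h1 : u.2 r ≤ n := hn ▸ Finset.single_le_sum (fun _ _ => Nat.zero_le _)
      (Finset.mem_univ r)
    by_cases hr : u.2 r = 0
    · omega
    · have h2 : w.2 r ≠ 0 := by
        have : r ∈ w.supp := hw ▸ hu hr
        exact this
      have : u.2 r ≤ n * w.2 r := h1.trans (Nat.le_mul_of_pos_right _ (by omega))
      omega
  · intro r hr
    by_contra hrS
    have : w.2 r = 0 := by
      by_contra h
      exact hrS (hw ▸ h)
    exact hr (by simp [this])

end AffCone

/-- The elements of `𝐀` supported in `S`. -/
def AffGroup.supported {P : Finset ℕ} (S : Set P) : Submodule ℤ (AffGroup P) where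
  carrier := {g | ∀ r, r ∉ S → g.2 r = 0}
  add_mem' := by
    intro a b ha hb r hr
    simp [ha r hr, hb r hr]
  zero_mem' := by intro r _; rfl
  smul_mem' := by
    intro c a ha r hr
    simp [ha r hr]

/-- The elements of `𝐀⁺` with support exactly `S`, as a predicate on `𝐀`. -/
def AffGroup.FullPos {P : Finset ℕ} (S : Set P) (g : AffGroup P) : Prop :=
  (∀ r ∈ S, 0 < g.2 r) ∧ ∀ r, r ∉ S → g.2 r = 0

lemma AffCone.toGroup_mem_supported {P : Finset ℕ} {S : Set P} {u : AffCone P}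
    (h : u.supp ⊆ S) : u.toGroup ∈ AffGroup.supported S := by
  intro r hr
  by_contra hne
  exact hr (h (by intro h0; exact hne (by simp [AffCone.toGroup, h0])))

lemma AffCone.fullPos_toGroup {P : Finset ℕ} {S : Set P} {u : AffCone P} (h : u.supp = S) :
    AffGroup.FullPos S u.toGroup := by
  refine ⟨fun r hr => ?_, AffCone.toGroup_mem_supported h.subset⟩
  have : r ∈ u.supp := h ▸ hr
  have h0 : u.2 r ≠ 0 := this
  simp only [AffCone.toGroup]
  omega

lemma AffGroup.FullPos.exists_cone {P : Finset ℕ} {S : Set P} {g : AffGroup P}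
    (h : AffGroup.FullPos S g) : ∃ w : AffCone P, w.supp = S ∧ w.toGroup = g := by
  refine ⟨(g.1, fun r => (g.2 r).toNat), ?_, ?_⟩
  · ext r
    simp only [AffCone.supp, Set.mem_ofPred_eq]
    by_cases hr : r ∈ S
    · have := h.1 r hr
      simp only [hr, iff_true]; omega
    · simp [hr, h.2 r hr]
  · refine Prod.ext rfl (funext fun r => ?_)
    show ((g.2 r).toNat : ℤ) = g.2 r
    by_cases hr : r ∈ S
    · exact Int.toNat_of_nonneg (h.1 r hr).le
    · simp [h.2 r hr]

namespace AffPoint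

variable {V : Type*} {P : Finset ℕ}

/-- The coordinates of a point, as an element of `𝐀`. -/
def val (a : AffPoint V P) : AffGroup P := a.2.toGroup

@[simp] lemma shift_zero (a : AffPoint V P) : a.shift 0 = a := by simp [shift]

lemma shift_shift (a : AffPoint V P) (u v : AffCone P) :
    (a.shift u).shift v = a.shift (u + v) := by simp [shift, add_assoc]

@[simp] lemma shift_fst (a : AffPoint V P) (u : AffCone P) : (a.shift u).1 = a.1 := rfl

@[simp] lemma val_shift (a : AffPoint V P) (u : AffCone P) :
    (a.shift u).val = a.val + u.toGroup := by simp [val, shift]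

lemma ext_val {a b : AffPoint V P} (h1 : a.1 = b.1) (h2 : a.val = b.val) : a = b :=
  Prod.ext h1 (AffCone.toGroup_injective h2)

lemma shift_injective (a : AffPoint V P) : Function.Injective a.shift := by
  intro u v h
  have := congrArg val h
  rw [val_shift, val_shift, add_right_inj] at this
  exact AffCone.toGroup_injective this

/-- `a` lies above `h`, with gap supported in `S`. -/
def Up (S : Set P) (h a : AffPoint V P) : Prop := ∃ u : AffCone P, u.supp ⊆ S ∧ a = h.shift u

variable {S : Set P} {h a b : AffPoint V P}

lemma Up.refl (h : AffPoint V P) : Up S h h := ⟨0, by simp, by simp⟩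

lemma Up.shift (ha : Up S h a) {u : AffCone P} (hu : u.supp ⊆ S) : Up S h (a.shift u) := by
  obtain ⟨v, hv, rfl⟩ := ha
  exact ⟨v + u, by rw [AffCone.supp_add]; exact Set.union_subset hv hu, shift_shift _ _ _⟩

lemma Up.trans (ha : Up S h a) (hb : Up S a b) : Up S h b := by
  obtain ⟨v, hv, rfl⟩ := hb
  exact ha.shift hv

lemma Up.fst (ha : Up S h a) : a.1 = h.1 := by
  obtain ⟨v, hv, rfl⟩ := ha; rfl

lemma Up.sub_mem (ha : Up S h a) : a.val - h.val ∈ AffGroup.supported S := by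
  obtain ⟨v, hv, rfl⟩ := ha
  rw [val_shift, add_sub_cancel_left]
  exact AffCone.toGroup_mem_supported hv

lemma Up.eq (ha : Up S h a) (hb : Up S h b) (hv : a.val = b.val) : a = b :=
  ext_val (ha.fst.trans hb.fst.symm) hv

lemma Up.sub_mem' (ha : Up S h a) (hb : Up S h b) : a.val - b.val ∈ AffGroup.supported S := by
  have := Submodule.sub_mem _ ha.sub_mem hb.sub_mem
  rwa [sub_sub_sub_cancel_right] at this

/-- A displacement supported in `S` becomes possible inside the region above `h` after adding a
multiple of an element with full support. -/
lemma Up.exists_displaced (ha : Up S h a) {g w : AffGroup P} (hg : g ∈ AffGroup.supported S)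
    (hw : AffGroup.FullPos S w) : ∃ (n : ℕ) (b : AffPoint V P), Up S h b ∧
      b.val = a.val + g + n • w := by
  classical
  obtain ⟨u, hu, rfl⟩ := ha
  set n : ℕ := ∑ r, (g.2 r).natAbs with hn
  have hle : ∀ r, r ∈ S → 0 ≤ g.2 r + n * w.2 r := by
    intro r hr
    have h1 : (g.2 r).natAbs ≤ n := Finset.single_le_sum (f := fun r => (g.2 r).natAbs)
      (fun _ _ => Nat.zero_le _) (Finset.mem_univ r)
    have h2 : (n : ℤ) ≤ n * w.2 r := le_mul_of_one_le_right (by omega) (hw.1 r hr)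
    omega
  refine ⟨n, h.shift (u + (g.1 + n • w.1, fun r => (g.2 r + n * w.2 r).toNat)), ⟨_, ?_, rfl⟩, ?_⟩
  · rw [AffCone.supp_add]
    refine Set.union_subset hu fun r hr => ?_
    by_contra hrS
    exact hr (by simp [hg r hrS, hw.2 r hrS])
  · rw [val_shift, val_shift, AffCone.toGroup_add]
    rw [add_assoc, add_assoc h.val, add_right_inj, add_right_inj]
    refine Prod.ext rfl (funext fun r => ?_)
    show ((g.2 r + n * w.2 r).toNat : ℤ) = g.2 r + (n • w.2) r
    by_cases hr : r ∈ S
    · rw [Int.toNat_of_nonneg (hle r hr)]; simp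
    · simp [hg r hr, hw.2 r hr]

end AffPoint

/-! ### Displacements realised by a translation-invariant equivalence relation -/

/-- An equivalence relation on the points that is compatible with translations. -/
structure ShiftEquivalence {V : Type*} {P : Finset ℕ} (R : AffPoint V P → AffPoint V P → Prop) :
    Prop where
  refl : ∀ a, R a a
  symm : ∀ {a b}, R a b → R b a
  trans : ∀ {a b c}, R a b → R b c → R a c
  shift : ∀ {a b} (u : AffCone P), R a b → R (a.shift u) (b.shift u)

namespace ShiftEquivalence

open AffPoint

variable {V : Type*} {P : Finset ℕ} {R : AffPoint V P → AffPoint V P → Prop}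

/-- The displacements between equivalent points above `h`. -/
def displacements (hR : ShiftEquivalence R) (S : Set P) (h : AffPoint V P) :
    Submodule ℤ (AffGroup P) where
  carrier := {g | ∃ u u' : AffCone P, u.supp ⊆ S ∧ u'.supp ⊆ S ∧ R (h.shift u) (h.shift u') ∧
    g = u'.toGroup - u.toGroup}
  zero_mem' := ⟨0, 0, by simp, by simp, hR.refl _, by simp⟩
  add_mem' := by
    rintro _ _ ⟨u, u', hu, hu', h1, rfl⟩ ⟨v, v', hv, hv', h2, rfl⟩
    refine ⟨u + v, u' + v', ?_, ?_, ?_, ?_⟩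
    · rw [AffCone.supp_add]; exact Set.union_subset hu hv
    · rw [AffCone.supp_add]; exact Set.union_subset hu' hv'
    · have e1 := hR.shift v h1
      have e2 := hR.shift u' h2
      rw [shift_shift, shift_shift] at e1 e2
      rw [add_comm v u', add_comm v' u'] at e2
      exact hR.trans e1 e2
    · simp only [AffCone.toGroup_add]; abel
  smul_mem' := by
    rintro c _ ⟨u, u', hu, hu', h1, rfl⟩
    have key : ∀ n : ℕ, ∀ u u' : AffCone P, R (h.shift u) (h.shift u') →
        R (h.shift (n • u)) (h.shift (n • u')) := by
      intro n u u' h1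
      induction n with
      | zero => simpa using hR.refl _
      | succ n ih =>
        have e1 := hR.shift u ih
        have e2 := hR.shift (n • u') h1
        rw [shift_shift, shift_shift] at e1 e2
        rw [add_comm u, add_comm u'] at e2
        rw [succ_nsmul, succ_nsmul]
        exact hR.trans e1 e2
    obtain ⟨n, rfl | rfl⟩ := c.eq_nat_or_neg
    · refine ⟨n • u, n • u', (AffCone.supp_nsmul_subset _ _).trans hu,
        (AffCone.supp_nsmul_subset _ _).trans hu', key n u u' h1, ?_⟩
      rw [AffCone.toGroup_nsmul, AffCone.toGroup_nsmul, natCast_zsmul, smul_sub]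
    · refine ⟨n • u', n • u, (AffCone.supp_nsmul_subset _ _).trans hu',
        (AffCone.supp_nsmul_subset _ _).trans hu, hR.symm (key n u u' h1), ?_⟩
      rw [AffCone.toGroup_nsmul, AffCone.toGroup_nsmul, neg_smul, natCast_zsmul, smul_sub, neg_sub]

/-- If `h` can be moved up by an element of full support, all points above `h` that differ by a
displacement are equivalent: both can be moved far up, where there is room for the displacement. -/
lemma rel_of_sub_mem (hR : ShiftEquivalence R) {S : Set P} {h a b : AffPoint V P} {w : AffCone P}
    (hw : w.supp = S) (hhw : R h (h.shift w)) (ha : Up S h a) (hb : Up S h b)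
    (hab : b.val - a.val ∈ hR.displacements S h) : R a b := by
  have hup : ∀ (n : ℕ) (c : AffCone P), R (h.shift c) (h.shift (c + n • w)) := by
    intro n c
    induction n with
    | zero => simpa using hR.refl _
    | succ n ih =>
      have := hR.shift (c + n • w) hhw
      rw [shift_shift] at this
      refine hR.trans ih ?_
      rw [succ_nsmul, ← add_assoc, add_comm (c + n • w) w]
      exact this
  obtain ⟨c, hc, rfl⟩ := ha
  obtain ⟨d, hd, rfl⟩ := hb
  obtain ⟨u, u', hu, hu', h1, hg⟩ := hab
  obtain ⟨n, z, hz, -⟩ := AffCone.exists_nsmul_eq_add hw hu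
  have hcd : d + u = c + u' := by
    apply AffCone.toGroup_injective
    rw [val_shift, val_shift, add_sub_add_left_eq_sub] at hg
    rw [AffCone.toGroup_add, AffCone.toGroup_add]
    rw [sub_eq_sub_iff_add_eq_add] at hg
    rw [hg, add_comm]
  have e1 := hup n c
  have e2 := hR.shift (c + z) h1
  have e3 := hup n d
  rw [shift_shift, shift_shift] at e2
  rw [hz] at e1 e3
  have f1 : u + (c + z) = c + (u + z) := by abel
  have f2 : u' + (c + z) = d + (u + z) := by
    rw [← add_assoc, ← add_assoc, add_comm u' c, hcd]
  rw [f1, f2] at e2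
  exact hR.trans e1 (hR.trans e2 (hR.symm e3))

end ShiftEquivalence

/-! ### Affine graphs and their moves -/

/-- An affine graph with edges `k : K`, each with an orientation: the edge `k` goes from the point
`(s k).1` to the point `(s k).2`. -/
abbrev AffGraph (V : Type*) (P : Finset ℕ) (K : Type*) : Type _ :=
  K → AffPoint V P × AffPoint V P

namespace AffGraph

open AffPoint

variable {V : Type*} {P : Finset ℕ} {K : Type*} [DecidableEq K]

/-- The moves in terms of affine graphs: reversal of the orientation of an edge, edge sign-change,
slide of the end of an edge, swap. The edges involved in a swap also exchange their names. -/
inductive AffMove : AffGraph V P K → AffGraph V P K → Prop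
  | flip (s : AffGraph V P K) (k : K) : AffMove s (Function.update s k (s k).swap)
  | sign (s : AffGraph V P K) (k : K) :
      AffMove s (Function.update s k ((s k).1.shift (1, 0), (s k).2.shift (1, 0)))
  | slide (s : AffGraph V P K) (k l : K) (u : AffCone P) (a : AffPoint V P) (hkl : k ≠ l)
      (hk : s k = (a, (s l).1.shift u)) :
      AffMove s (Function.update s k (a, (s l).2.shift u))
  | swap (s : AffGraph V P K) (k l : K) (q : AffPoint V P) (u w₁ w₂ : AffCone P) (hkl : k ≠ l)
      (hk : s k = (q, q.shift w₁)) (hl : s l = (q.shift u, q.shift (u + w₂)))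
      (h₁ : u.supp ⊆ w₁.supp) (h₂ : u.supp ⊆ w₂.supp) :
      AffMove s (Function.update (Function.update s k (q, q.shift w₂)) l
        (q.shift u, q.shift (u + w₁)))

/-- Reachability by moves. -/
abbrev Reach : AffGraph V P K → AffGraph V P K → Prop := Relation.ReflTransGen AffMove

lemma reach_flip (s : AffGraph V P K) (k : K) : Reach s (Function.update s k (s k).swap) :=
  .single (.flip s k)

/-- One step of an affine path along translates of the edges other than `k`. -/
def AvoidStep (s : AffGraph V P K) (k : K) (p q : AffPoint V P) : Prop :=
  ∃ l u, l ≠ k ∧ ((p = (s l).1.shift u ∧ q = (s l).2.shift u) ∨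
    (p = (s l).2.shift u ∧ q = (s l).1.shift u))

/-- Conjugacy by affine paths that do not use the edge `k`. -/
def AvoidConj (s : AffGraph V P K) (k : K) : AffPoint V P → AffPoint V P → Prop :=
  Relation.ReflTransGen (AvoidStep s k)

omit [DecidableEq K] in
lemma avoidConj_shiftEquivalence (s : AffGraph V P K) (k : K) :
    ShiftEquivalence (AvoidConj s k) where
  refl _ := .refl
  symm {a b} h := by
    have : Std.Symm (AvoidStep s k) := ⟨fun p q ⟨l, u, hl, h⟩ => ⟨l, u, hl, h.symm.imp
      (fun h => ⟨h.2, h.1⟩) (fun h => ⟨h.2, h.1⟩)⟩⟩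
    exact Relation.ReflTransGen.stdSymm.symm _ _ h
  trans h h' := Relation.ReflTransGen.trans h h'
  shift u h := by
    refine Relation.ReflTransGen.lift (fun a : AffPoint V P => a.shift u) ?_ _ _ h
    rintro p q ⟨l, v, hl, ⟨rfl, rfl⟩ | ⟨rfl, rfl⟩⟩
    · exact ⟨l, v + u, hl, .inl ⟨shift_shift _ _ _, shift_shift _ _ _⟩⟩
    · exact ⟨l, v + u, hl, .inr ⟨shift_shift _ _ _, shift_shift _ _ _⟩⟩

omit [DecidableEq K] in
lemma avoidConj_edge (s : AffGraph V P K) {k l : K} (hl : l ≠ k) :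
    AvoidConj s k (s l).1 (s l).2 :=
  .single ⟨l, 0, hl, .inl ⟨by simp, by simp⟩⟩

/-- The end of an edge slides along affine paths that do not use the edge. -/
lemma reach_slide_snd (s : AffGraph V P K) (k : K) {p q : AffPoint V P} (h : AvoidConj s k p q)
    (hp : (s k).2 = p) : Reach s (Function.update s k ((s k).1, q)) := by
  induction h with
  | refl =>
    rw [← hp, Prod.mk.eta, Function.update_eq_self]
  | tail h hstep ih =>
    obtain ⟨l, u, hl, ⟨rfl, rfl⟩ | ⟨rfl, rfl⟩⟩ := hstep
    · refine ih.tail ?_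
      have := AffMove.slide (Function.update s k ((s k).1, (s l).1.shift u)) k l u (s k).1 hl.symm
        (by simp [hl])
      simpa [hl] using this
    · refine ih.trans ?_
      -- reverse the edge `l`, slide, and reverse it again
      set s₁ := Function.update s k ((s k).1, (s l).2.shift u) with hs₁
      have hl₁ : s₁ l = s l := by simp [hs₁, hl]
      have hk₁ : s₁ k = ((s k).1, (s l).2.shift u) := by simp [hs₁]
      set s₂ := Function.update s₁ l (s₁ l).swap with hs₂
      have hk₂ : s₂ k = s₁ k := by simp [hs₂, hl.symm]
      have hl₂ : s₂ l = (s l).swap := by simp [hs₂, hl₁]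
      have m1 : AffMove s₁ s₂ := .flip s₁ l
      have m2 := AffMove.slide s₂ k l u (s k).1 hl.symm (by rw [hk₂, hk₁, hl₂]; simp)
      have m3 := AffMove.flip (Function.update s₂ k ((s k).1, (s₂ l).2.shift u)) l
      have e : Function.update (Function.update s₂ k ((s k).1, (s₂ l).2.shift u)) l
          (Function.update s₂ k ((s k).1, (s₂ l).2.shift u) l).swap =
          Function.update s k ((s k).1, (s l).1.shift u) := by
        funext j
        by_cases hj : j = l
        · subst hj; simp [hl, hl₂]
        · by_cases hjk : j = k
          · subst hjk; simp [hl.symm, hl₂]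
          · simp [hj, hjk, hs₂, hs₁]
      rw [e] at m3
      exact ((Relation.ReflTransGen.single m1).tail m2).tail m3

lemma reach_slide_fst (s : AffGraph V P K) (k : K) {q : AffPoint V P}
    (h : AvoidConj s k (s k).1 q) : Reach s (Function.update s k (q, (s k).2)) := by
  have h1 := reach_flip s k
  have hav : AvoidConj (Function.update s k (s k).swap) k (s k).1 q := by
    refine Relation.ReflTransGen.mono ?_ _ _ h
    rintro p q ⟨l, u, hl, h⟩
    exact ⟨l, u, hl, by simpa [hl] using h⟩
  have h2 := reach_slide_snd _ k hav (by simp)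
  have h3 := reach_flip (Function.update (Function.update s k (s k).swap) k
    ((Function.update s k (s k).swap k).1, q)) k
  simp only [Function.update_idem, Function.update_self] at h2 h3
  exact (h1.trans h2).trans h3

end AffGraph

/-! ### Affine graphs in standard position -/

/-- The data shared by the affine graphs to be compared. The edges are indexed by `ι ⊕ τ`. The edges
in `τ` start at the chosen minimal points `hub c`. The edge `root` starts at the minimal point `m₀`
of the distinguished family; the other edges `i : ι` outside `floats` start at minimal points
`base i`. Every edge in `ι` stays in one family, recorded by `home i`: the distinguished family for
`none`, that of the chosen minimal point `hub c` for `some c`. -/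
structure Frame (V : Type*) (P : Finset ℕ) (ι τ : Type*) where
  S : Set P
  m₀ : AffPoint V P
  hub : τ → AffPoint V P
  home : ι → Option τ
  base : ι → AffPoint V P
  root : ι
  floats : Set ι
  base_root : base root = m₀
  root_notMem : root ∉ floats
  home_root : home root = none
  home_float : ∀ i ∈ floats, home i = none
  joint : ∀ i, i ∉ floats → ∃ z, AffPoint.Up S (base i) z ∧
    AffPoint.Up S ((home i).elim m₀ hub) z

namespace Frame

open AffPoint AffGraph

variable {V : Type*} {P : Finset ℕ} {ι τ : Type*} (f : Frame V P ι τ)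

/-- The reference point of the family of the edge `i`. -/
def ref (i : ι) : AffPoint V P := (f.home i).elim f.m₀ f.hub

lemma ref_of_none {i : ι} (h : f.home i = none) : f.ref i = f.m₀ := by simp [ref, h]

lemma ref_of_some {i : ι} {c : τ} (h : f.home i = some c) : f.ref i = f.hub c := by simp [ref, h]

lemma ref_root : f.ref f.root = f.m₀ := f.ref_of_none f.home_root

/-- The displacement along the edge `i`. -/
def vec (s : AffGraph V P (ι ⊕ τ)) (i : ι) : AffGroup P :=
  (s (.inl i)).2.val - (s (.inl i)).1.val

/-- The affine graph `s` is in standard position: its edges start at the points prescribed by the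
frame and end above the reference points. -/
structure Good (s : AffGraph V P (ι ⊕ τ)) : Prop where
  root_edge : ∃ w : AffCone P, w.supp = f.S ∧ s (.inl f.root) = (f.m₀, f.m₀.shift w)
  hub_fst : ∀ c, (s (.inr c)).1 = f.hub c
  hub_snd : ∀ c, Up f.S f.m₀ (s (.inr c)).2
  base_eq : ∀ i, i ∉ f.floats → (s (.inl i)).1 = f.base i
  snd_up : ∀ i, Up f.S (f.ref i) (s (.inl i)).2
  float_up : ∀ i ∈ f.floats, Up f.S f.m₀ (s (.inl i)).1

variable {f} {s : AffGraph V P (ι ⊕ τ)}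

namespace Good

lemma exists_joint (hs : f.Good s) (i : ι) :
    ∃ z, Up f.S (s (.inl i)).1 z ∧ Up f.S (f.ref i) z := by
  by_cases hi : i ∈ f.floats
  · exact ⟨_, .refl _, by rw [f.ref_of_none (f.home_float i hi)]; exact hs.float_up i hi⟩
  · rw [hs.base_eq i hi]; exact f.joint i hi

lemma vec_mem_supported (hs : f.Good s) (i : ι) : vec s i ∈ AffGroup.supported f.S := by
  obtain ⟨z, hz, hz'⟩ := hs.exists_joint i
  have h1 := (hs.snd_up i).sub_mem' hz'
  have h2 := hz.sub_mem
  have := Submodule.add_mem _ h1 h2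
  rwa [sub_add_sub_cancel] at this

lemma vec_root (hs : f.Good s) : AffGroup.FullPos f.S (vec s f.root) := by
  obtain ⟨w, hw, he⟩ := hs.root_edge
  rw [vec, he, val_shift, add_sub_cancel_left]
  exact AffCone.fullPos_toGroup hw

/-- The displacements of all edges in sight are realised by paths that do not use the edge `k`. -/
lemma vec_mem_displacements (hs : f.Good s) {k : ι ⊕ τ} {j : ι} (hj : .inl j ≠ k)
    (hh : ∀ c, f.home j = some c → .inr c ≠ k) :
    vec s j ∈ (avoidConj_shiftEquivalence s k).displacements f.S f.m₀ := by
  have R := avoidConj_shiftEquivalence s k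
  obtain ⟨z, ⟨u₁, hu₁, hz₁⟩, u₂, hu₂, hz₂⟩ := hs.exists_joint j
  obtain ⟨u₃, hu₃, hy⟩ := hs.snd_up j
  have e1 := R.shift u₁ (avoidConj_edge s hj)
  rw [← hz₁, hz₂, hy, shift_shift] at e1
  have hv : vec s j = (u₃ + u₁).toGroup - u₂.toGroup := by
    have : (s (.inl j)).1.val = (f.ref j).val + u₂.toGroup - u₁.toGroup := by
      rw [← val_shift, ← hz₂, hz₁, val_shift, add_sub_cancel_right]
    rw [vec, this, hy, val_shift, AffCone.toGroup_add]
    abel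
  have h31 : (u₃ + u₁).supp ⊆ f.S := by rw [AffCone.supp_add]; exact Set.union_subset hu₃ hu₁
  cases hc : f.home j with
  | none =>
    rw [f.ref_of_none hc] at e1
    exact ⟨u₂, u₃ + u₁, hu₂, h31, e1, hv⟩
  | some c =>
    rw [f.ref_of_some hc] at e1
    obtain ⟨v, hv', ht⟩ := hs.hub_snd c
    have e2 := avoidConj_edge s (hh c hc)
    rw [hs.hub_fst c, ht] at e2
    have e3 := R.shift u₂ e2
    have e4 := R.shift (u₃ + u₁) e2
    rw [shift_shift] at e3 e4
    refine ⟨v + u₂, v + (u₃ + u₁), ?_, ?_, R.trans (R.symm e3) (R.trans e1 e4), ?_⟩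
    · rw [AffCone.supp_add]; exact Set.union_subset hv' hu₂
    · rw [AffCone.supp_add]; exact Set.union_subset hv' h31
    · rw [hv, AffCone.toGroup_add v, AffCone.toGroup_add v]; abel

lemma avoidConj_of_mem_span (hs : f.Good s) {k : ι ⊕ τ} (hk : .inl f.root ≠ k) {J : Set ι}
    (hJ : ∀ j ∈ J, .inl j ≠ k ∧ ∀ c, f.home j = some c → .inr c ≠ k) {a b : AffPoint V P}
    (ha : Up f.S f.m₀ a) (hb : Up f.S f.m₀ b)
    (hab : b.val - a.val ∈ Submodule.span ℤ (vec s '' J)) : AvoidConj s k a b := by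
  obtain ⟨w, hw, he⟩ := hs.root_edge
  refine (avoidConj_shiftEquivalence s k).rel_of_sub_mem hw ?_ ha hb ?_
  · have := avoidConj_edge s hk
    rwa [he] at this
  · refine (Submodule.span_le.mpr ?_) hab
    rintro _ ⟨j, hj, rfl⟩
    exact hs.vec_mem_displacements (hJ j hj).1 (hJ j hj).2

variable [DecidableEq ι] [DecidableEq τ]

/-- The end of an edge slides by the displacements of the other edges. -/
lemma slide_snd (hs : f.Good s) {i : ι} (hi : i ≠ f.root) {b : AffPoint V P}
    (hb : Up f.S (f.ref i) b)
    (hab : b.val - (s (.inl i)).2.val ∈ Submodule.span ℤ (vec s '' {j | j ≠ i})) :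
    Reach s (Function.update s (.inl i) ((s (.inl i)).1, b)) ∧
      f.Good (Function.update s (.inl i) ((s (.inl i)).1, b)) := by
  constructor
  · refine reach_slide_snd s _ ?_ rfl
    have hk : (Sum.inl f.root : ι ⊕ τ) ≠ .inl i := fun e => hi (Sum.inl.inj e).symm
    have hJ : ∀ j ∈ {j | j ≠ i}, (Sum.inl j : ι ⊕ τ) ≠ .inl i ∧
        ∀ c, f.home j = some c → (Sum.inr c : ι ⊕ τ) ≠ .inl i :=
      fun j hj => ⟨fun e => hj (Sum.inl.inj e), fun _ _ => Sum.inr_ne_inl⟩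
    have ha := hs.snd_up i
    cases hc : f.home i with
    | none =>
      rw [f.ref_of_none hc] at ha hb
      exact hs.avoidConj_of_mem_span hk hJ ha hb hab
    | some c =>
      rw [f.ref_of_some hc] at ha hb
      obtain ⟨u, hu, ha⟩ := ha
      obtain ⟨v, hv, rfl⟩ := hb
      rw [ha] at hab ⊢
      have R := avoidConj_shiftEquivalence s (Sum.inl i : ι ⊕ τ)
      have e := avoidConj_edge s (Sum.inr_ne_inl : (Sum.inr c : ι ⊕ τ) ≠ .inl i)
      rw [hs.hub_fst c] at e
      refine R.trans (R.shift u e) (R.trans ?_ (R.symm (R.shift v e)))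
      refine hs.avoidConj_of_mem_span hk hJ ((hs.hub_snd c).shift hu) ((hs.hub_snd c).shift hv) ?_
      simpa using hab
  · refine ⟨?_, ?_, ?_, ?_, ?_, ?_⟩
    · obtain ⟨w, hw, he⟩ := hs.root_edge
      exact ⟨w, hw, by simpa [hi.symm] using he⟩
    · simpa using hs.hub_fst
    · simpa using hs.hub_snd
    · intro j hj
      rw [← hs.base_eq j hj]
      by_cases hji : j = i
      · subst hji; simp
      · simp [hji]
    · intro j
      by_cases hji : j = i
      · subst hji; simpa using hb
      · simpa [hji] using hs.snd_up j
    · intro j hj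
      by_cases hji : j = i
      · subst hji; simpa using hs.float_up j hj
      · simpa [hji] using hs.float_up j hj

omit [DecidableEq ι] [DecidableEq τ] in
lemma ne_root (f : Frame V P ι τ) {i : ι} (hi : i ∈ f.floats) : i ≠ f.root :=
  fun e => f.root_notMem (e ▸ hi)

/-- Both ends of a floating edge may be placed anywhere above `m₀`. -/
lemma good_update_float (hs : f.Good s) {i : ι} (hi : i ∈ f.floats) {a b : AffPoint V P}
    (ha : Up f.S f.m₀ a) (hb : Up f.S f.m₀ b) : f.Good (Function.update s (.inl i) (a, b)) := by
  have hi0 := ne_root f hi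
  refine ⟨?_, ?_, ?_, ?_, ?_, ?_⟩
  · obtain ⟨w, hw, he⟩ := hs.root_edge
    exact ⟨w, hw, by simpa [hi0.symm] using he⟩
  · simpa using hs.hub_fst
  · simpa using hs.hub_snd
  · intro j hj
    have hji : j ≠ i := fun e => hj (e ▸ hi)
    simpa [hji] using hs.base_eq j hj
  · intro j
    by_cases hji : j = i
    · subst hji; simpa [f.ref_of_none (f.home_float j hi)] using hb
    · simpa [hji] using hs.snd_up j
  · intro j hj
    by_cases hji : j = i
    · subst hji; simpa using ha
    · simpa [hji] using hs.float_up j hj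

lemma slide_fst (hs : f.Good s) {i : ι} (hi : i ∈ f.floats) {b : AffPoint V P}
    (hb : Up f.S f.m₀ b)
    (hab : b.val - (s (.inl i)).1.val ∈ Submodule.span ℤ (vec s '' {j | j ≠ i})) :
    Reach s (Function.update s (.inl i) (b, (s (.inl i)).2)) ∧
      f.Good (Function.update s (.inl i) (b, (s (.inl i)).2)) := by
  constructor
  · refine reach_slide_fst s _ ?_
    refine hs.avoidConj_of_mem_span ?_ (J := {j | j ≠ i}) ?_ (hs.float_up i hi) hb hab
    · exact fun e => ne_root f hi (Sum.inl.inj e).symm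
    · exact fun j hj => ⟨fun e => hj (Sum.inl.inj e), fun _ _ => Sum.inr_ne_inl⟩
  · refine hs.good_update_float hi hb ?_
    have := hs.snd_up i
    rwa [f.ref_of_none (f.home_float i hi)] at this

lemma slide_hub_of_home_ne (hs : f.Good s) {c : τ} {b : AffPoint V P} (hb : Up f.S f.m₀ b)
    (hab : b.val - (s (.inr c)).2.val ∈
      Submodule.span ℤ (vec s '' {j | f.home j ≠ some c})) :
    Reach s (Function.update s (.inr c) ((s (.inr c)).1, b)) ∧
      f.Good (Function.update s (.inr c) ((s (.inr c)).1, b)) := by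
  constructor
  · refine reach_slide_snd s _ ?_ rfl
    refine hs.avoidConj_of_mem_span Sum.inl_ne_inr (J := {j | f.home j ≠ some c}) ?_
      (hs.hub_snd c) hb hab
    refine fun j hj => ⟨Sum.inl_ne_inr, fun d hd e => hj ?_⟩
    rw [hd, Sum.inr.inj e]
  · refine ⟨?_, ?_, ?_, ?_, ?_, ?_⟩
    · simpa using hs.root_edge
    · intro d
      by_cases hd : d = c
      · subst hd; simpa using hs.hub_fst d
      · simpa [hd] using hs.hub_fst d
    · intro d
      by_cases hd : d = c
      · subst hd; simpa using hb
      · simpa [hd] using hs.hub_snd d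
    · simpa using hs.base_eq
    · simpa using hs.snd_up
    · simpa using hs.float_up

end Good

end Frame

/-! ### Changing the displacement vectors -/

namespace Frame

open AffPoint AffGraph

variable {V : Type*} {P : Finset ℕ} {ι τ : Type*} {f : Frame V P ι τ}
  {s s₀ : AffGraph V P (ι ⊕ τ)} [DecidableEq ι] [DecidableEq τ]

lemma vec_update_of_ne (s : AffGraph V P (ι ⊕ τ)) {i j : ι} (h : j ≠ i)
    (p : AffPoint V P × AffPoint V P) : vec (Function.update s (.inl i) p) j = vec s j := by
  simp [vec, h]

lemma vec_update_self (s : AffGraph V P (ι ⊕ τ)) (i : ι) (p : AffPoint V P × AffPoint V P) :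
    vec (Function.update s (.inl i) p) i = p.2.val - p.1.val := by
  simp [vec]

namespace Good

/-- The ends of the edges in `D` slide by the displacements of the edges outside `D`. -/
lemma adjust (hs : f.Good s) (D : Finset ι) (hD : f.root ∉ D) (b : ι → AffPoint V P)
    (hb : ∀ i ∈ D, Up f.S (f.ref i) (b i))
    (hab : ∀ i ∈ D, (b i).val - (s (.inl i)).2.val ∈ Submodule.span ℤ (vec s '' {j | j ∉ D})) :
    ∃ s', Reach s s' ∧ f.Good s' ∧ (∀ i ∈ D, s' (.inl i) = ((s (.inl i)).1, b i)) ∧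
      (∀ i, i ∉ D → s' (.inl i) = s (.inl i)) ∧ ∀ c, s' (.inr c) = s (.inr c) := by
  induction D using Finset.induction_on with
  | empty => exact ⟨s, .refl, hs, by simp, by simp, by simp⟩
  | insert i D hi ih =>
    have hsub : vec s '' {j | j ∉ insert i D} ⊆ vec s '' {j | j ∉ D} :=
      Set.image_mono fun j hj hjD => hj (Finset.mem_insert_of_mem hjD)
    obtain ⟨s₁, hr, hg, h1, h2, h3⟩ := ih (fun h => hD (Finset.mem_insert_of_mem h))
      (fun j hj => hb j (Finset.mem_insert_of_mem hj))
      (fun j hj => Submodule.span_mono hsub (hab j (Finset.mem_insert_of_mem hj)))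
    have hir : i ≠ f.root := fun e => hD (e ▸ Finset.mem_insert_self i D)
    have himg : vec s '' {j | j ∉ insert i D} ⊆ vec s₁ '' {j | j ≠ i} := by
      rintro _ ⟨j, hj, rfl⟩
      have hj' : j ≠ i ∧ j ∉ D := by simpa using hj
      exact ⟨j, hj'.1, by rw [vec, vec, h2 j hj'.2]⟩
    obtain ⟨hr2, hg2⟩ := hg.slide_snd hir (hb i (Finset.mem_insert_self i D)) (by
      rw [h2 i hi]
      exact Submodule.span_mono himg (hab i (Finset.mem_insert_self i D)))
    refine ⟨_, hr.trans hr2, hg2, ?_, ?_, ?_⟩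
    · intro j hj
      by_cases hji : j = i
      · subst hji; simp [h2 j hi]
      · simp only [ne_eq, Sum.inl.injEq, hji, not_false_eq_true, Function.update_of_ne]
        exact h1 j (Finset.mem_of_mem_insert_of_ne hj hji)
    · intro j hj
      have hj' : j ≠ i ∧ j ∉ D := by simpa using hj
      simpa [hj'.1] using h2 j hj'.2
    · intro c; simpa using h3 c

/-- Changing displacement vectors, up to multiples of a vector of full support. -/
lemma adjust_vec (hs : f.Good s) (D : Finset ι) (hD : f.root ∉ D) (g : ι → AffGroup P)
    {ρ : AffGroup P} (hρ : AffGroup.FullPos f.S ρ)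
    (hρs : ρ ∈ Submodule.span ℤ (vec s '' {j | j ∉ D}))
    (hg : ∀ i ∈ D, g i ∈ Submodule.span ℤ (vec s '' {j | j ∉ D})) :
    ∃ s', Reach s s' ∧ f.Good s' ∧ (∀ i ∈ D, (s' (.inl i)).1 = (s (.inl i)).1 ∧
        ∃ n : ℕ, vec s' i = vec s i + g i + n • ρ) ∧
      (∀ i, i ∉ D → s' (.inl i) = s (.inl i)) ∧ ∀ c, s' (.inr c) = s (.inr c) := by
  have hle : Submodule.span ℤ (vec s '' {j | j ∉ D}) ≤ AffGroup.supported f.S := by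
    rw [Submodule.span_le]
    rintro _ ⟨j, -, rfl⟩
    exact hs.vec_mem_supported j
  have hex : ∀ i, ∃ b : AffPoint V P, i ∈ D → Up f.S (f.ref i) b ∧
      ∃ n : ℕ, b.val = (s (.inl i)).2.val + g i + n • ρ := by
    intro i
    by_cases hi : i ∈ D
    · obtain ⟨n, b, hb, hv⟩ := (hs.snd_up i).exists_displaced (hle (hg i hi)) hρ
      exact ⟨b, fun _ => ⟨hb, n, hv⟩⟩
    · exact ⟨f.m₀, fun h => absurd h hi⟩
  choose b hb using hex
  obtain ⟨s', hr, hg', h1, h2, h3⟩ := hs.adjust D hD b (fun i hi => (hb i hi).1) (by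
    intro i hi
    obtain ⟨n, hn⟩ := (hb i hi).2
    rw [hn]
    have : (s (.inl i)).2.val + g i + n • ρ - (s (.inl i)).2.val = g i + n • ρ := by abel
    rw [this]
    exact Submodule.add_mem _ (hg i hi) (Submodule.smul_of_tower_mem _ n hρs))
  refine ⟨s', hr, hg', fun i hi => ⟨by rw [h1 i hi], ?_⟩, h2, h3⟩
  obtain ⟨n, hn⟩ := (hb i hi).2
  refine ⟨n, ?_⟩
  rw [vec, h1 i hi, hn, vec]
  abel

/-- A swap exchanges the displacements of the root edge and of a floating edge. -/
lemma swap_root (hs : f.Good s) {i : ι} (hi : i ∈ f.floats) {w w₁ : AffCone P}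
    (hw : w.supp = f.S) (hw₁ : w₁.supp = f.S) (h₀ : s (.inl f.root) = (f.m₀, f.m₀.shift w))
    {a : AffPoint V P} (h₁ : s (.inl i) = (a, a.shift w₁)) :
    let s' := Function.update (Function.update s (.inl f.root) (f.m₀, f.m₀.shift w₁)) (.inl i)
      (a, a.shift w)
    Reach s s' ∧ f.Good s' := by
  intro s'
  have ha := hs.float_up i hi
  rw [h₁] at ha
  obtain ⟨u, hu, rfl⟩ : Up f.S f.m₀ a := ha
  have hir := ne_root f hi
  constructor
  · have := AffMove.swap s (.inl f.root) (.inl i) f.m₀ u w w₁ (fun e => hir (Sum.inl.inj e).symm) h₀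
      (by rw [h₁, shift_shift]) (hu.trans hw.symm.subset) (hu.trans hw₁.symm.subset)
    rw [← shift_shift] at this
    exact .single this
  · have hg : f.Good (Function.update s (.inl f.root) (f.m₀, f.m₀.shift w₁)) := by
      refine ⟨⟨w₁, hw₁, by simp⟩, by simpa using hs.hub_fst, by simpa using hs.hub_snd, ?_, ?_, ?_⟩
      · intro j hj
        by_cases hj0 : j = f.root
        · subst hj0; simp [f.base_root]
        · simpa [hj0] using hs.base_eq j hj
      · intro j
        by_cases hj0 : j = f.root
        · subst hj0
          rw [f.ref_root]
          simpa using (Up.refl f.m₀).shift hw₁.subset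
        · simpa [hj0] using hs.snd_up j
      · intro j hj
        simpa [ne_root f hj] using hs.float_up j hj
    exact hg.good_update_float hi ⟨u, hu, rfl⟩ ((Up.shift ⟨u, hu, rfl⟩) hw.subset)

lemma flip_float (hs : f.Good s) {i : ι} (hi : i ∈ f.floats) :
    f.Good (Function.update s (.inl i) (s (.inl i)).swap) := by
  refine hs.good_update_float hi ?_ (hs.float_up i hi)
  have := hs.snd_up i
  rwa [f.ref_of_none (f.home_float i hi)] at this

end Good

/-- The tuple `w` is, up to multiples of `w root`, the tuple of displacement vectors of an affine
graph in standard position reachable from `s₀`. The last conditions keep track of the remaining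
data of this graph. -/
def Ach (f : Frame V P ι τ) (s₀ : AffGraph V P (ι ⊕ τ)) (w : ι → AffGroup P) : Prop :=
  (∀ i, w i ∈ Submodule.span ℤ (Set.range (vec s₀))) ∧ ∃ s, f.Good s ∧ Reach s₀ s ∧
    vec s f.root = w f.root ∧ (∀ i, ∃ n : ℤ, vec s i = w i + n • w f.root) ∧
    (∀ c, s (.inr c) = s₀ (.inr c)) ∧
    ∀ i, (s (.inl i)).1.val - (s₀ (.inl i)).1.val ∈ Submodule.span ℤ (Set.range (vec s₀))

namespace Ach

variable {w : ι → AffGroup P}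

lemma pos (h : f.Ach s₀ w) : AffGroup.FullPos f.S (w f.root) := by
  obtain ⟨-, s, hs, -, hv, -⟩ := h
  rw [← hv]; exact hs.vec_root

lemma add [Fintype ι] (h : f.Ach s₀ w) {i : ι} {c : ι → ℤ} (hi : i ≠ f.root) (hc : c i = 0) :
    f.Ach s₀ (Function.update w i (w i + linComb w c)) := by
  obtain ⟨hL, s, hs, hr, hv, hn, hh, hb⟩ := h
  choose n hn using hn
  obtain ⟨s', hr', hs', h1, h2, h3⟩ := hs.adjust_vec {i} (by simpa using hi.symm)
    (fun _ => linComb (vec s) c) (ρ := vec s f.root) hs.vec_root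
    (Submodule.subset_span ⟨f.root, by simpa using hi.symm, rfl⟩) (by
      intro _ _
      refine Submodule.sum_mem _ fun j _ => ?_
      by_cases hj : j = i
      · subst hj; simp [hc]
      · exact Submodule.smul_mem _ _ (Submodule.subset_span ⟨j, by simpa using hj, rfl⟩))
  have hroot : vec s' f.root = w f.root := by
    rw [vec, h2 _ (by simpa using hi.symm), ← hv, vec]
  refine ⟨?_, s', hs', hr.trans hr', ?_, ?_, fun c => (h3 c).trans (hh c), ?_⟩
  · intro j
    by_cases hj : j = i
    · subst hj
      rw [Function.update_self]
      exact Submodule.add_mem _ (hL j)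
        (Submodule.sum_mem _ fun k _ => Submodule.smul_mem _ _ (hL k))
    · rw [Function.update_of_ne hj]; exact hL j
  · rw [hroot, Function.update_of_ne hi.symm]
  · intro j
    rw [Function.update_of_ne hi.symm]
    by_cases hj : j = i
    · subst hj
      obtain ⟨m, hm⟩ := (h1 j (by simp)).2
      have hlin : linComb (vec s) c = linComb w c + (∑ k, c k * n k) • w f.root := by
        unfold linComb
        rw [Finset.sum_smul, ← Finset.sum_add_distrib]
        refine Finset.sum_congr rfl fun k _ => ?_
        rw [hn k, smul_add, mul_smul]
      refine ⟨n j + (∑ k, c k * n k) + m, ?_⟩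
      rw [hm, hn j, hlin, Function.update_self, hv]
      simp only [add_smul, natCast_zsmul]
      abel
    · rw [Function.update_of_ne hj]
      refine ⟨n j, ?_⟩
      rw [vec, h2 j (by simpa using hj), ← hn j, vec]
  · intro j
    by_cases hj : j = i
    · subst hj
      rw [(h1 j (by simp)).1]; exact hb j
    · rw [h2 j (by simpa using hj)]; exact hb j

/-- Slides that make the displacement of the edge `i` equal to `w i`. -/
lemma exists_vec_eq (h : f.Ach s₀ w) {i : ι} (hi : i ∈ f.floats)
    (hp : AffGroup.FullPos f.S (w i)) :
    ∃ s, f.Good s ∧ Reach s₀ s ∧ vec s f.root = w f.root ∧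
      (∀ i, ∃ n : ℤ, vec s i = w i + n • w f.root) ∧ (∀ c, s (.inr c) = s₀ (.inr c)) ∧
      (∀ i, (s (.inl i)).1.val - (s₀ (.inl i)).1.val ∈ Submodule.span ℤ (Set.range (vec s₀))) ∧
      vec s i = w i := by
  obtain ⟨hL, s, hs, hr, hv, hn, hh, hb⟩ := h
  have hir := Good.ne_root f hi
  obtain ⟨w₁, hw₁, hw₁'⟩ := hp.exists_cone
  obtain ⟨s', hr', hs', h1, h2, h3⟩ := hs.adjust {i} (by simpa using hir.symm)
    (fun _ => (s (.inl i)).1.shift w₁) (by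
      intro j hj
      rw [Finset.mem_singleton.mp hj, f.ref_of_none (f.home_float i hi)]
      exact (hs.float_up i hi).shift hw₁.subset) (by
      intro j hj
      rw [Finset.mem_singleton.mp hj]
      obtain ⟨n, hn⟩ := hn i
      have : ((s (.inl i)).1.shift w₁).val - (s (.inl i)).2.val = (-n) • vec s f.root := by
        rw [val_shift, hw₁', hv]
        rw [vec, sub_eq_iff_eq_add] at hn
        rw [hn, neg_smul]; abel
      rw [this]
      exact Submodule.smul_mem _ _ (Submodule.subset_span ⟨f.root, by simpa using hir.symm, rfl⟩))
  have hvi : vec s' i = w i := by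
    rw [vec, h1 i (by simp), val_shift, hw₁', add_sub_cancel_left]
  refine ⟨s', hs', hr.trans hr', ?_, ?_, fun c => (h3 c).trans (hh c), ?_, hvi⟩
  · rw [vec, h2 _ (by simpa using hir.symm), ← hv, vec]
  · intro j
    by_cases hj : j = i
    · subst hj; exact ⟨0, by simp [hvi]⟩
    · obtain ⟨n, hn⟩ := hn j
      exact ⟨n, by rw [vec, h2 j (by simpa using hj), ← hn, vec]⟩
  · intro j
    by_cases hj : j = i
    · subst hj; rw [h1 j (by simp)]; exact hb j
    · rw [h2 j (by simpa using hj)]; exact hb j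

lemma swap [Fintype ι] (h : f.Ach s₀ w) {i : ι} (hi : i ∈ f.floats)
    (hp : AffGroup.FullPos f.S (w i)) : f.Ach s₀ (w ∘ Equiv.swap f.root i) := by
  have hL := h.1
  obtain ⟨s, hs, hr, hv, hn, hh, hb, hvi⟩ := h.exists_vec_eq hi hp
  choose n hn using hn
  have hir := Good.ne_root f hi
  -- prepare the other edges: their displacements have to be controlled up to multiples of `w i`
  set D : Finset ι := (Finset.univ.erase f.root).erase i with hDdef
  have hD : ∀ j, j ∈ D ↔ j ≠ i ∧ j ≠ f.root := by intro j; simp [hDdef]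
  have hrD : f.root ∉ D := by simp [hDdef]
  have hiD : i ∉ D := by simp [hDdef]
  obtain ⟨s₁, hr₁, hs₁, h1, h2, h3⟩ := hs.adjust_vec D hrD (fun j => -(n j • w f.root)) hp
    (by rw [← hvi]; exact Submodule.subset_span ⟨i, hiD, rfl⟩) (by
      intro j _
      rw [← hv]
      exact Submodule.neg_mem _ (Submodule.smul_mem _ _ (Submodule.subset_span ⟨_, hrD, rfl⟩)))
  obtain ⟨w₀, hw₀, he₀⟩ := hs₁.root_edge
  obtain ⟨w₁, hw₁, hw₁'⟩ := hp.exists_cone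
  have hw₀' : w₀.toGroup = w f.root := by
    rw [← hv, vec, ← h2 _ hrD, he₀, val_shift, add_sub_cancel_left]
  have he₁ : s₁ (.inl i) = ((s₁ (.inl i)).1, (s₁ (.inl i)).1.shift w₁) := by
    refine Prod.ext rfl ?_
    have hx := hs₁.snd_up i
    rw [f.ref_of_none (f.home_float i hi)] at hx
    refine hx.eq ((hs₁.float_up i hi).shift hw₁.subset) ?_
    rw [val_shift, hw₁', ← hvi, vec, h2 i hiD]
    abel
  obtain ⟨hr₂, hs₂⟩ := hs₁.swap_root hi hw₀ hw₁ he₀ he₁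
  refine ⟨fun j => hL _, _, hs₂, (hr.trans hr₁).trans hr₂, ?_, ?_, ?_, ?_⟩
  · rw [vec_update_of_ne _ hir.symm, vec_update_self, val_shift, hw₁', add_sub_cancel_left]
    simp
  · intro j
    have e0 : (w ∘ Equiv.swap f.root i) f.root = w i := by simp
    rw [e0]
    by_cases hji : j = i
    · subst hji
      refine ⟨0, ?_⟩
      rw [vec_update_self, val_shift, hw₀', add_sub_cancel_left]
      simp
    · rw [vec_update_of_ne _ hji]
      by_cases hj0 : j = f.root
      · subst hj0
        refine ⟨0, ?_⟩
        rw [vec_update_self, val_shift, hw₁', add_sub_cancel_left]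
        simp
      · rw [vec_update_of_ne _ hj0]
        obtain ⟨m, hm⟩ := (h1 j ((hD j).mpr ⟨hji, hj0⟩)).2
        refine ⟨m, ?_⟩
        rw [hm, hn j, Function.comp_apply, Equiv.swap_apply_of_ne_of_ne hj0 hji, natCast_zsmul]
        abel
  · intro c
    simp only [ne_eq, reduceCtorEq, not_false_eq_true, Function.update_of_ne]
    rw [h3, hh]
  · intro j
    have hbase : (s₁ (.inl j)).1 = (s (.inl j)).1 := by
      by_cases hj : j ∈ D
      · exact (h1 j hj).1
      · rw [h2 j hj]
    by_cases hji : j = i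
    · subst hji
      rw [Function.update_self, hbase]; exact hb j
    · rw [Function.update_of_ne (by simpa using hji)]
      by_cases hj0 : j = f.root
      · subst hj0
        have : f.m₀ = (s₁ (.inl f.root)).1 := by rw [he₀]
        rw [Function.update_self, this, hbase]; exact hb _
      · rw [Function.update_of_ne (by simpa using hj0), hbase]; exact hb j

lemma neg (h : f.Ach s₀ w) {i : ι} (hi : i ∈ f.floats) :
    f.Ach s₀ (Function.update w i (- w i)) := by
  obtain ⟨hL, s, hs, hr, hv, hn, hh, hb⟩ := h
  have hir := Good.ne_root f hi
  refine ⟨?_, _, hs.flip_float hi, hr.trans (reach_flip s _), ?_, ?_, ?_, ?_⟩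
  · intro j
    by_cases hj : j = i
    · subst hj; rw [Function.update_self]; exact Submodule.neg_mem _ (hL j)
    · rw [Function.update_of_ne hj]; exact hL j
  · rw [vec_update_of_ne _ hir.symm, Function.update_of_ne hir.symm, hv]
  · intro j
    rw [Function.update_of_ne hir.symm]
    obtain ⟨n, hn⟩ := hn j
    by_cases hj : j = i
    · subst hj
      refine ⟨-n, ?_⟩
      rw [vec_update_self, Function.update_self, Prod.fst_swap, Prod.snd_swap, neg_smul, ← neg_add,
        ← hn, vec, neg_sub]
    · rw [vec_update_of_ne _ hj, Function.update_of_ne hj]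
      exact ⟨n, hn⟩
  · intro c; simpa using hh c
  · intro j
    by_cases hj : j = i
    · subst hj
      obtain ⟨n, hn⟩ := hn j
      rw [Function.update_self, Prod.fst_swap]
      have : (s (.inl j)).2.val - (s₀ (.inl j)).1.val =
          vec s j + ((s (.inl j)).1.val - (s₀ (.inl j)).1.val) := by rw [vec]; abel
      rw [this, hn]
      exact Submodule.add_mem _ (Submodule.add_mem _ (hL j) (Submodule.smul_mem _ _ (hL _))) (hb j)
    · rw [Function.update_of_ne (by simpa using hj)]; exact hb j

end Ach

lemma elementaryClosed_ach [Fintype ι] (hS : f.S.Nonempty) {i : ι} (hi : i ∈ f.floats) :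
    ElementaryClosed (f.Ach s₀) (AffGroup.FullPos f.S) f.root i where
  ne := (Good.ne_root f hi).symm
  pos _ h := h.pos
  add _ _ _ h := h.add
  swap _ h := h.swap hi
  neg _ h := h.neg hi
  not_neg a ha hna := by
    obtain ⟨r, hr⟩ := hS
    have h1 := ha.1 r hr
    have h2 := hna.1 r hr
    simp only [Prod.snd_neg, Pi.neg_apply] at h2
    omega
  divide a b c n k ha hb hk hc := by
    have hc2 : ∀ r, (k : ℤ) * c.2 r = a.2 r + n * b.2 r := fun r => by
      have := congrFun (congrArg Prod.snd hc) r
      simpa using this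
    constructor
    · intro r hr
      have h1 := ha.1 r hr
      have h2 := hb.1 r hr
      have h3 : 0 < (k : ℤ) * c.2 r := by rw [hc2]; positivity
      exact pos_of_mul_pos_right h3 (by omega)
    · intro r hr
      have h3 := hc2 r
      rw [ha.2 r hr, hb.2 r hr] at h3
      simp at h3
      omega

/-- From an affine graph in standard position, every generating tuple of the same length of the
group generated by the displacement vectors is achieved. -/
theorem ach_of_span_eq [Fintype ι] (hs₀ : f.Good s₀) (hS : f.S.Nonempty) {i : ι}
    (hi : i ∈ f.floats) (w : ι → AffGroup P) (hw : AffGroup.FullPos f.S (w f.root))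
    (hspan : Submodule.span ℤ (Set.range (vec s₀)) = Submodule.span ℤ (Set.range w)) :
    f.Ach s₀ w := by
  obtain ⟨M, hM, hMw⟩ := exists_matrix_of_span_eq (vec s₀) w hspan
  have h0 : f.Ach s₀ (vec s₀) := ⟨fun i => Submodule.subset_span ⟨i, rfl⟩, s₀, hs₀, .refl, rfl,
    fun i => ⟨0, by simp⟩, fun _ => rfl, fun i => by simp⟩
  have := (elementaryClosed_ach hS hi).maps M hM (vec s₀) h0 (by rw [← hMw]; exact hw)
  rwa [← funext hMw] at this

end Frame

/-! ### Bringing the endpoints into place -/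

namespace Frame

open AffPoint AffGraph

variable {V : Type*} {P : Finset ℕ} {ι τ : Type*} {f : Frame V P ι τ}
  {s s' : AffGraph V P (ι ⊕ τ)} [DecidableEq ι] [DecidableEq τ]

/-- By moves that affect only the root edge and the edge `i`, these edges can be brought to
`(m₀, m₀ + u)` and to `p`. -/
def PairReach (f : Frame V P ι τ) (s : AffGraph V P (ι ⊕ τ)) (i : ι) (u : AffCone P)
    (p : AffPoint V P × AffPoint V P) : Prop :=
  ∃ s', Reach s s' ∧ f.Good s' ∧ s' (.inl f.root) = (f.m₀, f.m₀.shift u) ∧ s' (.inl i) = p ∧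
    ∀ k, k ≠ .inl f.root → k ≠ .inl i → s' k = s k

namespace PairReach

variable {i : ι} {u v : AffCone P} {a b c : AffPoint V P}

lemma swap (h : f.PairReach s i u (a, a.shift v)) (hi : i ∈ f.floats) (hu : u.supp = f.S)
    (hv : v.supp = f.S) : f.PairReach s i v (a, a.shift u) := by
  obtain ⟨s', hr, hs', h0, h1, h2⟩ := h
  obtain ⟨hr', hg'⟩ := hs'.swap_root hi hu hv h0 h1
  have hir := Good.ne_root f hi
  refine ⟨_, hr.trans hr', hg', by simp [hir.symm], by simp, fun k hk hk' => ?_⟩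
  rw [Function.update_of_ne hk', Function.update_of_ne hk, h2 k hk hk']

lemma flip (h : f.PairReach s i u (a, b)) (hi : i ∈ f.floats) : f.PairReach s i u (b, a) := by
  obtain ⟨s', hr, hs', h0, h1, h2⟩ := h
  have hir := Good.ne_root f hi
  refine ⟨_, hr.trans (reach_flip s' (.inl i)), hs'.flip_float hi, by simp [hir.symm, h0],
    by simp [h1], fun k hk hk' => ?_⟩
  rw [Function.update_of_ne hk', h2 k hk hk']

lemma slide (h : f.PairReach s i u (a, b)) (hi : i ∈ f.floats) (hc : Up f.S f.m₀ c) (n : ℤ)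
    (hbc : c.val - b.val = n • u.toGroup) : f.PairReach s i u (a, c) := by
  obtain ⟨s', hr, hs', h0, h1, h2⟩ := h
  have hir := Good.ne_root f hi
  obtain ⟨hr', hg'⟩ := hs'.slide_snd hir (b := c)
    (by rwa [f.ref_of_none (f.home_float i hi)]) (by
      rw [h1, hbc]
      refine Submodule.smul_mem _ _ (Submodule.subset_span ⟨f.root, hir.symm, ?_⟩)
      rw [vec, h0, val_shift, add_sub_cancel_left])
  refine ⟨_, hr.trans hr', hg', by simp [hir.symm, h0], by simp [h1], fun k hk hk' => ?_⟩
  rw [Function.update_of_ne hk', h2 k hk hk']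

end PairReach

namespace Good

/-- A floating edge moves by its own displacement: three swaps lead around the triangle with the
vertices `u`, `v`, `u + v`, where `u` and `v` are the displacements of the root edge and of the
floating edge. -/
lemma reach_advance (hs : f.Good s) {i : ι} (hi : i ∈ f.floats) {v : AffCone P} (hv : v.supp = f.S)
    {a : AffPoint V P} (h₁ : s (.inl i) = (a, a.shift v)) :
    Reach s (Function.update s (.inl i) (a.shift v, (a.shift v).shift v)) := by
  obtain ⟨u, hu, h₀⟩ := hs.root_edge
  have ha : Up f.S f.m₀ a := by have := hs.float_up i hi; rwa [h₁] at this
  have huv : (u + v).supp = f.S := by rw [AffCone.supp_add, hu, hv, Set.union_self]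
  have hav := ha.shift hv.subset
  have t0 : f.PairReach s i u (a, a.shift v) := ⟨s, .refl, hs, h₀, h₁, fun _ _ _ => rfl⟩
  have t1 := t0.swap hi hu hv
  have t2 := t1.slide hi (ha.shift huv.subset) 1 (by simp)
  have t3 := t2.swap hi hv huv
  have t4 := t3.flip hi
  have t5 := t4.slide hi (hav.shift hu.subset) 1 (by simp; abel)
  have t6 := t5.swap hi huv hu
  have t7 := t6.slide hi (hav.shift hv.subset) (-1) (by simp)
  obtain ⟨s', hr, -, h0, h1, h2⟩ := t7
  have : s' = Function.update s (.inl i) (a.shift v, (a.shift v).shift v) := by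
    funext k
    by_cases hk : k = .inl i
    · subst hk; simp [h1]
    · rw [Function.update_of_ne hk]
      by_cases hk0 : k = .inl f.root
      · subst hk0; rw [h0, h₀]
      · exact h2 k hk0 hk
  rwa [← this]

omit [DecidableEq τ] in
lemma _root_.AffGroup.FullPos.exists_add_nsmul {S : Set P} {g w : AffGroup P}
    (hg : g ∈ AffGroup.supported S) (hw : AffGroup.FullPos S w) :
    ∃ n : ℕ, AffGroup.FullPos S (g + n • w) := by
  classical
  set n : ℕ := ∑ r, (g.2 r).natAbs with hn
  refine ⟨n + 1, fun r hr => ?_, fun r hr => ?_⟩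
  · have h1 : (g.2 r).natAbs ≤ n := Finset.single_le_sum (f := fun r => (g.2 r).natAbs)
      (fun _ _ => Nat.zero_le _) (Finset.mem_univ r)
    have h2 : ((n + 1 : ℕ) : ℤ) ≤ (n + 1 : ℕ) * w.2 r :=
      le_mul_of_one_le_right (by omega) (hw.1 r hr)
    have h3 : (g + (n + 1) • w).2 r = g.2 r + (n + 1 : ℕ) * w.2 r := by simp
    rw [h3]
    omega
  · simp [hg r hr, hw.2 r hr]

/-- The case of `reach_float` in which the floating edge moves by a nonnegative multiple `m` of its
own displacement, and by a combination `g` of the other displacements. -/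
lemma reach_float_nat {i : ι} (hi : i ∈ f.floats) {a b : AffPoint V P} (ha : Up f.S f.m₀ a)
    (hb : Up f.S f.m₀ b) (m : ℕ) : ∀ (s : AffGraph V P (ι ⊕ τ)) (g : AffGroup P), f.Good s →
    g ∈ Submodule.span ℤ (vec s '' {j | j ≠ i}) →
    a.val - (s (.inl i)).1.val = m • vec s i + g →
    (∃ n : ℤ, b.val - a.val = vec s i + n • vec s f.root) →
    Reach s (Function.update s (.inl i) (a, b)) := by
  have hir := ne_root f hi
  have himg : ∀ (s : AffGraph V P (ι ⊕ τ)) p,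
      vec (Function.update s (.inl i) p) '' {j | j ≠ i} = vec s '' {j | j ≠ i} := fun s p =>
    Set.image_congr fun j hj => vec_update_of_ne s hj p
  have hroot : ∀ s : AffGraph V P (ι ⊕ τ),
      vec s f.root ∈ Submodule.span ℤ (vec s '' {j | j ≠ i}) :=
    fun s => Submodule.subset_span ⟨_, hir.symm, rfl⟩
  induction m with
  | zero =>
    intro s g hs hg hag ⟨n, hn⟩
    rw [zero_smul, zero_add] at hag
    obtain ⟨hr, hs'⟩ := hs.slide_fst hi ha (by rw [hag]; exact hg)
    obtain ⟨hr', -⟩ := hs'.slide_snd hir (b := b)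
      (by rwa [f.ref_of_none (f.home_float i hi)]) (by
        rw [himg, Function.update_self]
        have : b.val - (s (.inl i)).2.val = g + n • vec s f.root := by
          have h1 : b.val - (s (.inl i)).2.val = (b.val - a.val) +
            (a.val - (s (.inl i)).1.val) - vec s i := by rw [vec]; abel
          rw [h1, hn, hag]; abel
        rw [this]
        exact Submodule.add_mem _ hg (Submodule.smul_mem _ _ (hroot s)))
    have := hr.trans hr'
    simpa only [Function.update_self, Function.update_idem] using this
  | succ m ih =>
    intro s g hs hg hag ⟨n, hn⟩
    -- make the displacement of the edge positive, so that the edge can advance by it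
    obtain ⟨N, hN⟩ := AffGroup.FullPos.exists_add_nsmul (hs.vec_mem_supported i) hs.vec_root
    obtain ⟨v, hv, hv'⟩ := hN.exists_cone
    have hx := hs.float_up i hi
    obtain ⟨hr, hs₁⟩ := hs.slide_snd hir (b := (s (.inl i)).1.shift v)
      (by rw [f.ref_of_none (f.home_float i hi)]; exact hx.shift hv.subset) (by
        have : ((s (.inl i)).1.shift v).val - (s (.inl i)).2.val = N • vec s f.root := by
          rw [val_shift, hv', vec]; abel
        rw [this]
        exact Submodule.smul_of_tower_mem _ N (hroot s))
    have hr₁ := hs₁.reach_advance hi hv (by rw [Function.update_self])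
    rw [Function.update_idem] at hr₁
    set s₂ := Function.update s (.inl i)
      ((s (.inl i)).1.shift v, ((s (.inl i)).1.shift v).shift v) with hs₂
    have hg₂ : f.Good s₂ := hs.good_update_float hi (hx.shift hv.subset)
      ((hx.shift hv.subset).shift hv.subset)
    have hvec : vec s₂ i = vec s i + N • vec s f.root := by
      rw [hs₂, vec_update_self, val_shift, val_shift, hv']; abel
    have hvr : vec s₂ f.root = vec s f.root := vec_update_of_ne s hir.symm _
    have hfin := ih s₂ (g - ((m + 1) * N) • vec s f.root) hg₂ (by
        rw [hs₂, himg]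
        exact Submodule.sub_mem _ hg (Submodule.smul_of_tower_mem _ _ (hroot s))) (by
        have h1 : (s₂ (.inl i)).1.val = (s (.inl i)).1.val + (vec s i + N • vec s f.root) := by
          rw [hs₂, Function.update_self, val_shift, hv']
        have h2 : a.val = (s (.inl i)).1.val + ((m + 1) • vec s i + g) := by rw [← hag]; abel
        rw [h1, hvec, h2, smul_add, add_mul, one_mul, add_smul, add_smul, one_smul, mul_smul]
        abel) ⟨n - N, by
          rw [hn, hvec, hvr, sub_smul, natCast_zsmul]; abel⟩
    rw [hs₂, Function.update_idem] at hfin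
    exact (hr.trans hr₁).trans hfin

lemma _root_.Submodule.mem_span_range_iff_exists_add {ι A : Type*} [AddCommGroup A] (v : ι → A)
    (i : ι) (x : A) (hx : x ∈ Submodule.span ℤ (Set.range v)) :
    ∃ (c : ℤ) (g : A), g ∈ Submodule.span ℤ (v '' {j | j ≠ i}) ∧ x = c • v i + g := by
  have : Set.range v = insert (v i) (v '' {j | j ≠ i}) := by
    ext y
    constructor
    · rintro ⟨j, rfl⟩
      by_cases hj : j = i
      · exact .inl (by rw [hj])
      · exact .inr ⟨j, hj, rfl⟩
    · rintro (rfl | ⟨j, -, rfl⟩) <;> exact ⟨_, rfl⟩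
  rw [this, Submodule.mem_span_insert] at hx
  obtain ⟨c, g, hg, h⟩ := hx
  exact ⟨c, g, hg, h⟩

/-- A floating edge moves to any position that is compatible with its displacement vector and with
the group of all displacements. -/
lemma reach_float (hs : f.Good s) {i : ι} (hi : i ∈ f.floats) {a b : AffPoint V P}
    (ha : Up f.S f.m₀ a) (hb : Up f.S f.m₀ b)
    (hab : a.val - (s (.inl i)).1.val ∈ Submodule.span ℤ (Set.range (vec s)))
    (hv : ∃ n : ℤ, b.val - a.val = vec s i + n • vec s f.root) :
    Reach s (Function.update s (.inl i) (a, b)) := by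
  have hir := ne_root f hi
  obtain ⟨c, g, hg, hc⟩ := Submodule.mem_span_range_iff_exists_add (vec s) i _ hab
  obtain ⟨m, rfl | rfl⟩ := c.eq_nat_or_neg
  · exact reach_float_nat hi ha hb m s g hs hg (by rw [hc, natCast_zsmul]) hv
  · -- reverse the edge, so that it has to move in the direction of its displacement
    obtain ⟨n, hn⟩ := hv
    set s₁ := Function.update s (.inl i) (s (.inl i)).swap with hs₁
    have himg : vec s₁ '' {j | j ≠ i} = vec s '' {j | j ≠ i} :=
      Set.image_congr fun j hj => vec_update_of_ne s hj _
    have hvi : vec s₁ i = - vec s i := by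
      rw [hs₁, vec_update_self, vec, neg_sub]; rfl
    have hvr : vec s₁ f.root = vec s f.root := vec_update_of_ne s hir.symm _
    have h := reach_float_nat hi hb ha m s₁ (g + n • vec s f.root) (hs.flip_float hi) (by
        rw [himg]
        exact Submodule.add_mem _ hg
          (Submodule.smul_mem _ _ (Submodule.subset_span ⟨_, hir.symm, rfl⟩))) (by
        have h1 : (s₁ (.inl i)).1.val = (s (.inl i)).1.val + vec s i := by
          rw [hs₁, Function.update_self, vec]; simp
        have h2 : b.val - (s₁ (.inl i)).1.val =
            (b.val - a.val) + (a.val - (s (.inl i)).1.val) - vec s i := by rw [h1]; abel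
        rw [h2, hn, hc, hvi, neg_smul, natCast_zsmul, smul_neg]
        abel) ⟨-n, by
          rw [hvi, hvr, neg_smul, ← neg_add, ← hn, neg_sub]⟩
    rw [hs₁, Function.update_idem] at h
    have h2 := reach_flip (Function.update s (.inl i) (b, a)) (.inl i)
    rw [Function.update_self, Function.update_idem] at h2
    exact ((reach_flip s _).trans h).trans h2

/-- The end of the edge at a chosen minimal point slides by all displacements. Displacements of
edges in its own family are first transferred to a floating edge. -/
lemma slide_hub (hs : f.Good s) {i : ι} (hi : i ∈ f.floats) {c : τ} {b : AffPoint V P}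
    (hb : Up f.S f.m₀ b)
    (hab : b.val - (s (.inr c)).2.val ∈ Submodule.span ℤ (Set.range (vec s))) :
    Reach s (Function.update s (.inr c) ((s (.inr c)).1, b)) ∧
      f.Good (Function.update s (.inr c) ((s (.inr c)).1, b)) := by
  have hir := ne_root f hi
  have hih := f.home_float i hi
  have hrange : Set.range (vec s) = vec s '' {j | f.home j = some c} ∪
      vec s '' {j | f.home j ≠ some c} := by
    rw [← Set.image_union, ← Set.image_univ]
    congr 1
    ext j
    simp [em]
  rw [hrange, Submodule.span_union, Submodule.mem_sup] at hab
  obtain ⟨g₁, hg₁, g₂, hg₂, hg⟩ := hab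
  have hg₁s : g₁ ∈ AffGroup.supported f.S := by
    refine (Submodule.span_le.mpr ?_) hg₁
    rintro _ ⟨j, -, rfl⟩
    exact hs.vec_mem_supported j
  have hg₁i : g₁ ∈ Submodule.span ℤ (vec s '' {j | j ≠ i}) := by
    refine Submodule.span_mono (Set.image_mono fun j hj e => ?_) hg₁
    have hj : f.home j = some c := hj
    rw [e, hih] at hj
    cases hj
  have hroot : vec s f.root ∈ Submodule.span ℤ (vec s '' {j | j ≠ i}) :=
    Submodule.subset_span ⟨_, hir.symm, rfl⟩
  have hroot' : vec s f.root ∈ Submodule.span ℤ (vec s '' {j | f.home j ≠ some c}) :=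
    Submodule.subset_span ⟨_, by simp [f.home_root], rfl⟩
  -- the floating edge takes up the part `g₁` of the displacement, modulo the root edge
  obtain ⟨N, y, hy, hyv⟩ := (hs.snd_up i).exists_displaced hg₁s hs.vec_root
  obtain ⟨hr₁, hs₁⟩ := hs.slide_snd hir hy (by
    have : y.val - (s (.inl i)).2.val = g₁ + N • vec s f.root := by rw [hyv]; abel
    rw [this]
    exact Submodule.add_mem _ hg₁i (Submodule.smul_of_tower_mem _ N hroot))
  set s₁ := Function.update s (.inl i) ((s (.inl i)).1, y) with hs₁def
  have hv₁ : vec s₁ i = vec s i + g₁ + N • vec s f.root := by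
    have h1 : vec s i = (s (.inl i)).2.val - (s (.inl i)).1.val := rfl
    rw [hs₁def, vec_update_self, hyv, h1]; abel
  have hv₁' : ∀ j, j ≠ i → vec s₁ j = vec s j := fun j hj => vec_update_of_ne s hj _
  have hc₁ : s₁ (.inr c) = s (.inr c) := by simp [hs₁def]
  have hsub : Submodule.span ℤ (vec s '' {j | f.home j ≠ some c ∧ j ≠ i}) ≤
      Submodule.span ℤ (vec s₁ '' {j | f.home j ≠ some c}) := by
    refine Submodule.span_mono ?_
    rintro _ ⟨j, hj, rfl⟩
    exact ⟨j, hj.1, hv₁' j hj.2⟩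
  have hroot₁ : vec s f.root ∈ Submodule.span ℤ (vec s₁ '' {j | f.home j ≠ some c}) :=
    hsub (Submodule.subset_span ⟨_, ⟨by simp [f.home_root], hir.symm⟩, rfl⟩)
  -- the end slides along the floating edge
  obtain ⟨N', t, ht, htv⟩ := (hs₁.hub_snd c).exists_displaced (hs₁.vec_mem_supported i) hs.vec_root
  obtain ⟨hr₂, hs₂⟩ := hs₁.slide_hub_of_home_ne ht (by
    have : t.val - (s₁ (.inr c)).2.val = vec s₁ i + N' • vec s f.root := by rw [htv]; abel
    rw [this]
    refine Submodule.add_mem _ (Submodule.subset_span ⟨i, ?_, rfl⟩)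
      (Submodule.smul_of_tower_mem _ N' hroot₁)
    simp [hih])
  set s₂ := Function.update s₁ (.inr c) ((s₁ (.inr c)).1, t) with hs₂def
  have hvec₂ : ∀ j, vec s₂ j = vec s₁ j := fun j => by simp [vec, hs₂def]
  have hi₂ : s₂ (.inl i) = ((s (.inl i)).1, y) := by simp [hs₂def, hs₁def]
  -- the floating edge returns to its original place
  obtain ⟨hr₃, hs₃⟩ := hs₂.slide_snd hir (hs.snd_up i) (by
    have h1 : (s (.inl i)).2.val - (s₂ (.inl i)).2.val = -(g₁ + N • vec s f.root) := by
      rw [hi₂, hyv]; abel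
    have h2 : vec s₂ '' {j | j ≠ i} = vec s '' {j | j ≠ i} :=
      Set.image_congr fun j hj => by rw [hvec₂, hv₁' j hj]
    rw [h1, h2]
    exact Submodule.neg_mem _ (Submodule.add_mem _ hg₁i (Submodule.smul_of_tower_mem _ N hroot)))
  set s₃ := Function.update s₂ (.inl i) ((s₂ (.inl i)).1, (s (.inl i)).2) with hs₃def
  have hvec₃ : ∀ j, vec s₃ j = vec s j := by
    intro j
    by_cases hj : j = i
    · subst hj; rw [hs₃def, vec_update_self, hi₂, vec]
    · rw [hs₃def, vec_update_of_ne _ hj, hvec₂, hv₁' j hj]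
  have hc₃ : s₃ (.inr c) = ((s (.inr c)).1, t) := by simp [hs₃def, hs₂def, hs₁def]
  -- the difference that is left no longer involves edges in the family of `c`
  obtain ⟨hr₄, hs₄⟩ := hs₃.slide_hub_of_home_ne hb (by
    have h1 : b.val - (s₃ (.inr c)).2.val =
        g₂ - vec s i - (N + N') • vec s f.root := by
      have h2 : b.val = (s (.inr c)).2.val + (g₁ + g₂) := by rw [hg]; abel
      rw [hc₃, htv, h2, hv₁, hc₁, add_smul]; abel
    have h2 : vec s₃ '' {j | f.home j ≠ some c} = vec s '' {j | f.home j ≠ some c} :=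
      Set.image_congr fun j _ => hvec₃ j
    rw [h1, h2]
    refine Submodule.sub_mem _ (Submodule.sub_mem _ hg₂ (Submodule.subset_span ⟨i, ?_, rfl⟩))
      (Submodule.smul_of_tower_mem _ _ hroot')
    simp [hih])
  have hfin : Function.update s₃ (.inr c) ((s₃ (.inr c)).1, b) =
      Function.update s (.inr c) ((s (.inr c)).1, b) := by
    funext k
    by_cases hk : k = .inr c
    · subst hk; simp [hc₃]
    · rw [Function.update_of_ne hk, Function.update_of_ne hk]
      by_cases hki : k = .inl i
      · subst hki; rw [hs₃def, Function.update_self, hi₂]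
      · rw [hs₃def, Function.update_of_ne hki, hs₂def, Function.update_of_ne hk, hs₁def,
          Function.update_of_ne hki]
  rw [hfin] at hr₄ hs₄
  exact ⟨((hr₁.trans hr₂).trans hr₃).trans hr₄, hs₄⟩

end Good

/-- The edges in `ι` of `s` have the same displacements as those of `s'` up to multiples of the
displacement of the root edge, which is the same in both; their initial points differ by
displacements of `s'`. -/
structure Close (f : Frame V P ι τ) (s s' : AffGraph V P (ι ⊕ τ)) : Prop where
  root_eq : vec s f.root = vec s' f.root
  vec_eq : ∀ i, ∃ n : ℤ, vec s i = vec s' i + n • vec s' f.root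
  fst_sub : ∀ i, (s' (.inl i)).1.val - (s (.inl i)).1.val ∈ Submodule.span ℤ (Set.range (vec s'))

omit [DecidableEq ι] [DecidableEq τ] in
lemma Close.span_le (h : f.Close s s') :
    Submodule.span ℤ (Set.range (vec s')) ≤ Submodule.span ℤ (Set.range (vec s)) := by
  rw [Submodule.span_le]
  rintro _ ⟨i, rfl⟩
  obtain ⟨n, hn⟩ := h.vec_eq i
  rw [← h.root_eq, ← sub_eq_iff_eq_add] at hn
  rw [← hn]
  exact Submodule.sub_mem _ (Submodule.subset_span ⟨i, rfl⟩)
    (Submodule.smul_mem _ _ (Submodule.subset_span ⟨_, rfl⟩))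

/-- One edge in `ι` is brought into place. -/
lemma Close.place (h : f.Close s s') (hs : f.Good s) (hs' : f.Good s') (i : ι) :
    Reach s (Function.update s (.inl i) (s' (.inl i))) ∧
      f.Good (Function.update s (.inl i) (s' (.inl i))) ∧
      f.Close (Function.update s (.inl i) (s' (.inl i))) s' := by
  obtain ⟨n, hn⟩ := h.vec_eq i
  have hmain : Reach s (Function.update s (.inl i) (s' (.inl i))) ∧
      f.Good (Function.update s (.inl i) (s' (.inl i))) := by
    by_cases hi : i ∈ f.floats
    · have h1 := hs'.float_up i hi
      have h2 := hs'.snd_up i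
      rw [f.ref_of_none (f.home_float i hi)] at h2
      refine ⟨hs.reach_float hi h1 h2 (h.span_le (h.fst_sub i)) ⟨-n, ?_⟩,
        hs.good_update_float hi h1 h2⟩
      rw [hn, h.root_eq, vec, neg_smul]; abel
    · have hb : (s (.inl i)).1 = (s' (.inl i)).1 := (hs.base_eq i hi).trans (hs'.base_eq i hi).symm
      by_cases hir : i = f.root
      · subst hir
        have : s' (.inl f.root) = s (.inl f.root) := by
          refine Prod.ext hb.symm ((hs'.snd_up _).eq (hs.snd_up _) ?_)
          have := h.root_eq
          rw [vec, vec, hb, sub_left_inj] at this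
          exact this.symm
        rw [this, Function.update_eq_self]
        exact ⟨.refl, hs⟩
      · have := hs.slide_snd hir (hs'.snd_up i) (by
          have h1 : (s' (.inl i)).2.val - (s (.inl i)).2.val = (-n) • vec s f.root := by
            have : (s (.inl i)).2.val = (s' (.inl i)).1.val + vec s i := by rw [vec, hb]; abel
            rw [this, hn, h.root_eq, vec, neg_smul]; abel
          rw [h1]
          exact Submodule.smul_mem _ _ (Submodule.subset_span ⟨_, Ne.symm hir, rfl⟩))
        rwa [hb] at this
  refine ⟨hmain.1, hmain.2, ?_, fun j => ?_, fun j => ?_⟩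
  · by_cases hir : f.root = i
    · subst hir; rw [vec_update_self]; rfl
    · rw [vec_update_of_ne _ hir]; exact h.root_eq
  · by_cases hj : j = i
    · subst hj; exact ⟨0, by rw [vec_update_self, zero_smul, add_zero]; rfl⟩
    · rw [vec_update_of_ne _ hj]; exact h.vec_eq j
  · by_cases hj : j = i
    · subst hj; simp
    · rw [Function.update_of_ne (by simpa using hj)]; exact h.fst_sub j

/-- Two affine graphs in standard position with respect to the same frame, with the same group of
displacements and with endpoints that are congruent modulo this group, are connected by moves. -/
theorem reach_of_good [Finite ι] [Finite τ] (hs : f.Good s) (hs' : f.Good s') (hS : f.S.Nonempty)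
    (hfl : f.floats.Nonempty)
    (hspan : Submodule.span ℤ (Set.range (vec s)) = Submodule.span ℤ (Set.range (vec s')))
    (hfst : ∀ i ∈ f.floats, (s' (.inl i)).1.val - (s (.inl i)).1.val ∈
      Submodule.span ℤ (Set.range (vec s')))
    (hhub : ∀ c, (s' (.inr c)).2.val - (s (.inr c)).2.val ∈
      Submodule.span ℤ (Set.range (vec s'))) : Reach s s' := by
  have := Fintype.ofFinite ι
  have := Fintype.ofFinite τ
  obtain ⟨i, hi⟩ := hfl
  obtain ⟨-, s₁, hs₁, hr₁, hv, hn, hh, hb⟩ := ach_of_span_eq hs hS hi (vec s') hs'.vec_root hspan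
  have hclose : f.Close s₁ s' := by
    refine ⟨hv, hn, fun j => ?_⟩
    by_cases hj : j ∈ f.floats
    · have h1 := hb j
      rw [hspan] at h1
      have := Submodule.sub_mem _ (hfst j hj) h1
      rwa [sub_sub_sub_cancel_right] at this
    · rw [hs₁.base_eq j hj, hs'.base_eq j hj, sub_self]
      exact Submodule.zero_mem _
  have key : ∀ D : Finset ι, ∃ s₂, Reach s₁ s₂ ∧ f.Good s₂ ∧ f.Close s₂ s' ∧
      (∀ j ∈ D, s₂ (.inl j) = s' (.inl j)) ∧ ∀ c, s₂ (.inr c) = s₁ (.inr c) := by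
    intro D
    induction D using Finset.induction_on with
    | empty => exact ⟨s₁, .refl, hs₁, hclose, by simp, fun _ => rfl⟩
    | insert j D hj ih =>
      obtain ⟨s₂, hr₂, hs₂, hc₂, h1, h2⟩ := ih
      obtain ⟨hr₃, hs₃, hc₃⟩ := hc₂.place hs₂ hs' j
      refine ⟨_, hr₂.trans hr₃, hs₃, hc₃, fun k hk => ?_, fun c => by simpa using h2 c⟩
      by_cases hkj : k = j
      · subst hkj; simp
      · rw [Function.update_of_ne (by simpa using hkj)]
        exact h1 k (Finset.mem_of_mem_insert_of_ne hk hkj)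
  obtain ⟨s₂, hr₂, hs₂, hc₂, h1, h2⟩ := key Finset.univ
  have hvec : ∀ j, vec s₂ j = vec s' j := fun j => by rw [vec, vec, h1 j (Finset.mem_univ j)]
  have key' : ∀ D : Finset τ, ∃ s₃, Reach s₂ s₃ ∧ f.Good s₃ ∧
      (∀ j, s₃ (.inl j) = s' (.inl j)) ∧ (∀ c ∈ D, s₃ (.inr c) = s' (.inr c)) ∧
      ∀ c, c ∉ D → s₃ (.inr c) = s (.inr c) := by
    intro D
    induction D using Finset.induction_on with
    | empty => exact ⟨s₂, .refl, hs₂, fun j => h1 j (Finset.mem_univ j), by simp,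
        fun c _ => (h2 c).trans (hh c)⟩
    | insert c D hc ih =>
      obtain ⟨s₃, hr₃, hs₃, e1, e2, e3⟩ := ih
      obtain ⟨hr₄, hs₄⟩ := hs₃.slide_hub hi (hs'.hub_snd c) (by
        rw [e3 c hc]
        have : vec s₃ = vec s' := funext fun j => by rw [vec, vec, e1 j]
        rw [this]; exact hhub c)
      refine ⟨_, hr₃.trans hr₄, hs₄, fun j => by simpa using e1 j, fun d hd => ?_, fun d hd => ?_⟩
      · by_cases hdc : d = c
        · subst hdc
          rw [Function.update_self, hs₃.hub_fst, ← hs'.hub_fst]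
        · rw [Function.update_of_ne (by simpa using hdc)]
          exact e2 d (Finset.mem_of_mem_insert_of_ne hd hdc)
      · have hd' : d ≠ c ∧ d ∉ D := by simpa using hd
        rw [Function.update_of_ne (by simpa using hd'.1)]
        exact e3 d hd'.2
  obtain ⟨s₃, hr₃, -, e1, e2, -⟩ := key' Finset.univ
  have : s₃ = s' := by
    funext k
    cases k with
    | inl j => exact e1 j
    | inr c => exact e2 c (Finset.mem_univ c)
  rw [← this]
  exact (hr₁.trans hr₂).trans hr₃

end Frame

/-! ### Graphs of groups from affine graphs -/

/-- The integer with a given signed factorization; inverse to `GBSGraph.factor`. -/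
def AffCone.unfactor {P : Finset ℕ} (u : AffCone P) : ℤ :=
  (if u.1 = 0 then 1 else -1) * ∏ r : P, ((r : ℕ) : ℤ) ^ u.2 r

namespace AffCone

variable {P : Finset ℕ}

lemma unfactor_add (u v : AffCone P) : (u + v).unfactor = u.unfactor * v.unfactor := by
  have hs : ∀ a b : ZMod 2, (if a + b = 0 then (1 : ℤ) else -1) =
      (if a = 0 then 1 else -1) * (if b = 0 then 1 else -1) := by decide
  unfold unfactor
  simp only [Prod.fst_add, Prod.snd_add, Pi.add_apply, hs, pow_add, Finset.prod_mul_distrib]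
  ring

lemma unfactor_nsmul (n : ℕ) (u : AffCone P) : (n • u).unfactor = u.unfactor ^ n := by
  induction n with
  | zero => simp [unfactor]
  | succ n ih => rw [succ_nsmul, unfactor_add, ih, pow_succ]

lemma unfactor_sign : unfactor ((1, 0) : AffCone P) = -1 := by
  simp [unfactor]

lemma natAbs_unfactor (u : AffCone P) : u.unfactor.natAbs = ∏ r : P, (r : ℕ) ^ u.2 r := by
  have h : ((∏ r : P, ((r : ℕ) : ℤ) ^ u.2 r)).natAbs = ∏ r : P, (r : ℕ) ^ u.2 r := by
    have : (∏ r : P, ((r : ℕ) : ℤ) ^ u.2 r) = ((∏ r : P, (r : ℕ) ^ u.2 r : ℕ) : ℤ) := by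
      push_cast; rfl
    rw [this, Int.natAbs_natCast]
  unfold unfactor
  rw [Int.natAbs_mul, h]
  split_ifs <;> simp

/-- If `supp u ⊆ supp w`, then `u` divides a power of `w`. -/
lemma unfactor_dvd {q u w : AffCone P} (h : u.supp ⊆ w.supp) :
    ∃ k : ℕ, (q + u).unfactor ∣ w.unfactor ^ k * q.unfactor := by
  obtain ⟨n, z, hz, -⟩ := exists_nsmul_eq_add (S := w.supp) rfl h
  refine ⟨n, z.unfactor, ?_⟩
  rw [← unfactor_nsmul, hz, unfactor_add, unfactor_add]
  ring

lemma unfactor_factor {n : ℤ} (hn : n ≠ 0) (h : ∀ r : ℕ, r.Prime → (r : ℤ) ∣ n → r ∈ P) :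
    (GBSGraph.factor P n).unfactor = n := by
  have h1 : ∏ r : P, (r : ℕ) ^ n.natAbs.factorization r = n.natAbs := by
    rw [Finset.prod_coe_sort P (fun r => r ^ n.natAbs.factorization r)]
    conv_rhs => rw [← Nat.prod_factorization_pow_eq_self (Int.natAbs_ne_zero.mpr hn)]
    rw [Finsupp.prod]
    symm
    refine Finset.prod_subset (fun r hr => ?_) (fun r _ hr => ?_)
    · rw [Nat.support_factorization, Nat.mem_primeFactors] at hr
      exact h r hr.1 (Int.natCast_dvd.mpr hr.2.1)
    · rw [Finsupp.notMem_support_iff.mp hr, pow_zero]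
  have h2 : ∏ r : P, ((r : ℕ) : ℤ) ^ n.natAbs.factorization r = n.natAbs := by
    exact_mod_cast congrArg (Nat.cast (R := ℤ)) h1
  unfold unfactor GBSGraph.factor
  simp only
  rw [h2]
  split_ifs with h3 h4 h4
  · exact absurd h4 (by decide)
  · omega
  · omega
  · exact absurd rfl h4

variable (hP : ∀ r ∈ P, r.Prime)
include hP

lemma natAbs_unfactor_pos (u : AffCone P) : 0 < ∏ r : P, (r : ℕ) ^ u.2 r :=
  Finset.prod_pos fun r _ => pow_pos (hP r r.2).pos _

lemma unfactor_ne_zero (u : AffCone P) : u.unfactor ≠ 0 := by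
  rw [← Int.natAbs_pos, natAbs_unfactor]
  exact natAbs_unfactor_pos hP u

end AffCone

namespace GBSGraph

lemma factor_neg {P : Finset ℕ} {n : ℤ} (hn : n ≠ 0) :
    factor P (-n) = factor P n + (1, 0) := by
  refine Prod.ext ?_ ?_
  · rcases lt_or_gt_of_ne hn with h | h
    · simp [factor, h, not_lt.mpr h.le]; decide
    · simp [factor, h, h.le]
  · simp [factor]

variable {V E K : Type*} {P : Finset ℕ} (hP : ∀ r ∈ P, r.Prime)

lemma ext_of_eq {G G' : GBSGraph V E} (h1 : G.rev = G'.rev) (h2 : G.init = G'.init)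
    (h3 : G.label = G'.label) : G = G' := by
  cases G; cases G'; simp_all

/-- The initial points of the oriented edges of an affine graph: `(k, true)` is the edge `k` with
its orientation, `(k, false)` is its reverse. -/
def endpoint (s : AffGraph V P K) (x : K × Bool) : AffPoint V P :=
  if x.2 then (s x.1).1 else (s x.1).2

/-- The reverse of an oriented edge. -/
def opp (x : K × Bool) : K × Bool := (x.1, !x.2)

@[simp] lemma opp_opp (x : K × Bool) : opp (opp x) = x := by simp [opp]

/-- The GBS graph with a given affine graph, its oriented edges being named by `φ`. -/
def ofAff (φ : E ≃ K × Bool) (s : AffGraph V P K) : GBSGraph V E where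
  rev e := φ.symm (opp (φ e))
  rev_ne e h := by
    have := congrArg (fun e => (φ e).2) h
    simp [opp] at this
  rev_rev e := by simp
  init e := (endpoint s (φ e)).1
  label e := (endpoint s (opp (φ e))).2.unfactor
  label_ne_zero e := AffCone.unfactor_ne_zero hP _

/-- The GBS graph is determined by its affine representation. -/
lemma eq_ofAff {G : GBSGraph V E} (hG : G.primes ⊆ P) (φ : E ≃ K × Bool) (s : AffGraph V P K)
    (hφ : ∀ e, φ (G.rev e) = opp (φ e)) (hs : ∀ e, G.affInit P e = endpoint s (φ e)) :
    G = ofAff hP φ s := by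
  refine ext_of_eq ?_ ?_ ?_
  · funext e; simp [ofAff, ← hφ]
  · funext e
    show G.init e = (endpoint s (φ e)).1
    rw [← hs]; simp [affInit, affTer, ter, G.rev_rev]
  · funext e
    show G.label e = (endpoint s (opp (φ e))).2.unfactor
    rw [← hφ, ← hs]
    simp only [affInit, affTer, G.rev_rev]
    rw [AffCone.unfactor_factor (G.label_ne_zero e)]
    exact fun r hr hd => hG ⟨hr, e, hd⟩

/-- Renaming the oriented edges. -/
lemma ofAff_rename (φ : E ≃ K × Bool) (σ : Equiv.Perm (K × Bool)) (s s' : AffGraph V P K)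
    (hσ : ∀ x, σ (opp x) = opp (σ x)) (h : ∀ x, endpoint s' (σ x) = endpoint s x) :
    ofAff hP (φ.trans σ) s' = ofAff hP φ s := by
  refine ext_of_eq ?_ ?_ ?_
  · funext e; simp [ofAff, ← hσ]
  · funext e; simp [ofAff, h]
  · funext e; simp [ofAff, ← hσ, h]

section

variable [DecidableEq K] (φ : E ≃ K × Bool) (s : AffGraph V P K)

lemma endpoint_update_of_ne {k : K} {x : K × Bool} (h : x.1 ≠ k)
    (p : AffPoint V P × AffPoint V P) : endpoint (Function.update s k p) x = endpoint s x := by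
  simp [endpoint, h]

lemma exists_ofAff_flip (k : K) :
    ∃ φ' : E ≃ K × Bool, ofAff hP φ' (Function.update s k (s k).swap) = ofAff hP φ s := by
  let σ : Equiv.Perm (K × Bool) := Function.Involutive.toPerm
    (fun x => (x.1, if x.1 = k then !x.2 else x.2)) (by
      rintro ⟨j, b⟩
      by_cases hj : j = k <;> simp [hj])
  have hσ : ∀ x, σ x = (x.1, if x.1 = k then !x.2 else x.2) := fun _ => rfl
  refine ⟨φ.trans σ, ofAff_rename hP φ σ s _ ?_ ?_⟩
  · rintro ⟨j, b⟩
    by_cases hj : j = k <;> simp [hσ, opp, hj]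
  · rintro ⟨j, b⟩
    by_cases hj : j = k
    · subst hj; cases b <;> simp [hσ, endpoint]
    · simp [hσ, endpoint, hj]

omit [DecidableEq K] in
lemma ofAff_ne (k : K) {g : E} (h1 : g ≠ φ.symm (k, true))
    (h2 : g ≠ (ofAff hP φ s).rev (φ.symm (k, true))) : (φ g).1 ≠ k := by
  intro h
  rcases hb : (φ g).2 with _ | _
  · exact h2 (by simp [ofAff, opp, ← h, ← hb])
  · exact h1 (by simp [← h, ← hb])

lemma ofAff_sign (k : K) : (ofAff hP φ s).EdgeSignChange (ofAff hP φ
    (Function.update s k ((s k).1.shift (1, 0), (s k).2.shift (1, 0)))) := by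
  refine ⟨rfl, ?_, φ.symm (k, true), ?_, ?_, ?_⟩
  · funext e
    show (endpoint _ (φ e)).1 = (endpoint _ (φ e)).1
    by_cases h : (φ e).1 = k
    · unfold endpoint; rw [h]; split_ifs <;> simp
    · rw [endpoint_update_of_ne s h]
  · simp [ofAff, endpoint, opp, AffPoint.shift, AffCone.unfactor_add, AffCone.unfactor_sign]
  · simp [ofAff, endpoint, opp, AffPoint.shift, AffCone.unfactor_add, AffCone.unfactor_sign]
  · intro g h1 h2
    have := ofAff_ne hP φ s k h1 h2
    show (endpoint _ (opp (φ g))).2.unfactor = (endpoint _ (opp (φ g))).2.unfactor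
    rw [endpoint_update_of_ne s (x := opp (φ g)) this]

omit [DecidableEq K] in
lemma ofAff_agreeAt {s' : AffGraph V P K} (g : E) (h : s' (φ g).1 = s (φ g).1) :
    (ofAff hP φ s).AgreeAt (ofAff hP φ s') g := by
  constructor
  · simp [ofAff, endpoint, h]
  · simp [ofAff, endpoint, opp, h]

lemma ofAff_slide (k l : K) (u : AffCone P) (a : AffPoint V P) (hkl : k ≠ l)
    (hk : s k = (a, (s l).1.shift u)) :
    (ofAff hP φ s).Slide (ofAff hP φ (Function.update s k (a, (s l).2.shift u))) := by
  refine ⟨rfl, φ.symm (k, true), φ.symm (l, true), u.unfactor, ?_, ?_, ?_, ?_, ?_, ?_, ?_, ?_, ?_⟩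
  · simpa using hkl
  · simp [ofAff, opp]
  · simp [ofAff, ter, opp, endpoint, hk]
  · simp [ofAff, opp, endpoint, hk, AffPoint.shift, AffCone.unfactor_add, mul_comm]
  · simp [ofAff, endpoint, hk]
  · simp [ofAff, ter, opp, endpoint]
  · simp [ofAff, opp, endpoint, hk]
  · simp [ofAff, opp, endpoint, AffPoint.shift, AffCone.unfactor_add, mul_comm]
  · intro g h1 h2
    refine ofAff_agreeAt hP φ s g ?_
    rw [Function.update_of_ne (ofAff_ne hP φ s k h1 h2)]

lemma exists_ofAff_swap (k l : K) (q : AffPoint V P) (u w₁ w₂ : AffCone P) (hkl : k ≠ l)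
    (hk : s k = (q, q.shift w₁)) (hl : s l = (q.shift u, q.shift (u + w₂)))
    (h₁ : u.supp ⊆ w₁.supp) (h₂ : u.supp ⊆ w₂.supp) :
    ∃ φ' : E ≃ K × Bool, (ofAff hP φ s).Swap (ofAff hP φ' (Function.update (Function.update s k
      (q, q.shift w₂)) l (q.shift u, q.shift (u + w₁)))) := by
  -- the swap itself, followed by an exchange of the names of the two edges
  set s₁ := Function.update (Function.update s k (q.shift u, q.shift (u + w₁))) l
    (q, q.shift w₂) with hs₁
  have hk₁ : s₁ k = (q.shift u, q.shift (u + w₁)) := by simp [hs₁, hkl]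
  have hl₁ : s₁ l = (q, q.shift w₂) := by simp [hs₁]
  let σ : Equiv.Perm (K × Bool) := (Equiv.swap k l).prodCongr (Equiv.refl Bool)
  refine ⟨φ.trans σ, ?_⟩
  rw [ofAff_rename hP φ σ s₁ _ (fun _ => rfl) ?_]
  · obtain ⟨k₁, hk₁'⟩ := AffCone.unfactor_dvd (q := q.2) h₁
    obtain ⟨k₂, hk₂'⟩ := AffCone.unfactor_dvd (q := q.2) h₂
    refine ⟨rfl, ?_, φ.symm (k, true), φ.symm (l, true), q.1, q.2.unfactor, (q.2 + u).unfactor,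
      w₁.unfactor, w₂.unfactor, k₁, k₂, ?_, ?_, ?_, ?_, ?_, ?_, ?_, ?_, ?_, ?_, ?_, hk₁', hk₂',
      ?_, ?_, ?_, ?_, ?_⟩
    · funext e
      show (endpoint _ (φ e)).1 = (endpoint _ (φ e)).1
      by_cases hek : (φ e).1 = k
      · unfold endpoint; rw [hek, hk, hk₁]; split_ifs <;> simp
      · by_cases hel : (φ e).1 = l
        · unfold endpoint; rw [hel, hl, hl₁]; split_ifs <;> simp
        · rw [hs₁, endpoint_update_of_ne _ hel, endpoint_update_of_ne _ hek]
    · simpa using hkl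
    · simp [ofAff, opp]
    · simp [ofAff, endpoint, hk]
    · simp [ofAff, ter, opp, endpoint, hk]
    · simp [ofAff, endpoint, hl]
    · simp [ofAff, ter, opp, endpoint, hl]
    · simp [ofAff, opp, endpoint, hk]
    · simp [ofAff, opp, endpoint, hk, AffPoint.shift, AffCone.unfactor_add, mul_comm]
    · simp [ofAff, opp, endpoint, hl, AffPoint.shift]
    · simp [ofAff, opp, endpoint, hl, AffPoint.shift, AffCone.unfactor_add]; ring
    · rw [AffCone.unfactor_add]; exact Dvd.intro _ rfl
    · simp [ofAff, opp, endpoint, hk₁, AffPoint.shift]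
    · simp [ofAff, opp, endpoint, hk₁, AffPoint.shift, AffCone.unfactor_add]; ring
    · simp [ofAff, opp, endpoint, hl₁]
    · simp [ofAff, opp, endpoint, hl₁, AffPoint.shift, AffCone.unfactor_add, mul_comm]
    · intro g h1 h2 h3 h4
      have e1 := ofAff_ne hP φ s k h1 h2
      have e2 := ofAff_ne hP φ s l h3 h4
      refine (ofAff_agreeAt hP φ s g ?_).2
      rw [hs₁, Function.update_of_ne e2, Function.update_of_ne e1]
  · rintro ⟨j, b⟩
    by_cases hjk : j = k
    · subst hjk; simp [σ, endpoint, hk₁]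
    · by_cases hjl : j = l
      · subst hjl; simp [σ, endpoint, hl₁, hkl]
      · simp [σ, endpoint, hs₁, hjk, hjl, Equiv.swap_apply_of_ne_of_ne]

/-- Moves of affine graphs come from moves of GBS graphs, up to the names of the edges. -/
theorem exists_moves_of_reach {s s' : AffGraph V P K} (h : s.Reach s') (φ : E ≃ K × Bool) :
    ∃ φ' : E ≃ K × Bool, Relation.ReflTransGen Move (ofAff hP φ s) (ofAff hP φ' s') := by
  induction h with
  | refl => exact ⟨φ, .refl⟩
  | tail _ hm ih =>
    obtain ⟨φ₁, h₁⟩ := ih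
    cases hm with
    | flip k =>
      obtain ⟨φ₂, h₂⟩ := exists_ofAff_flip hP φ₁ _ k
      exact ⟨φ₂, h₂ ▸ h₁⟩
    | sign k => exact ⟨φ₁, h₁.tail (.inl (ofAff_sign hP φ₁ _ k))⟩
    | slide k l u a hkl hk =>
      exact ⟨φ₁, h₁.tail (.inr (.inl (ofAff_slide hP φ₁ _ k l u a hkl hk)))⟩
    | swap k l q u w₁ w₂ hkl hk hl hu₁ hu₂ =>
      obtain ⟨φ₂, h₂⟩ := exists_ofAff_swap hP φ₁ _ k l q u w₁ w₂ hkl hk hl hu₁ hu₂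
      exact ⟨φ₂, h₁.tail (.inr (.inr (.inl h₂)))⟩

end

end GBSGraph

/-! ### Conjugacy and quasi-conjugacy -/

namespace AffPoint

variable {V : Type*} {P : Finset ℕ} {a b : AffPoint V P}

lemma shift_sign_sign (a : AffPoint V P) (δ : ZMod 2) : (a.shift (δ, 0)).shift (δ, 0) = a := by
  rw [shift_shift]
  have : ((δ, 0) + (δ, 0) : AffCone P) = 0 := Prod.ext (CharTwo.add_self_eq_zero δ) (by simp)
  rw [this, shift_zero]

lemma near_iff : a.Near b ↔ ∃ δ : ZMod 2, b = a.shift (δ, 0) := by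
  constructor
  · rintro ⟨⟨u, rfl⟩, v, hv⟩
    refine ⟨u.1, ?_⟩
    have h0 : (0 : AffCone P) = u + v :=
      a.shift_injective (by rw [shift_zero, ← shift_shift, ← hv])
    have : u.2 = 0 := by
      funext r
      have := congrFun (congrArg Prod.snd h0) r
      simp only [Prod.snd_zero, Pi.zero_apply, Prod.snd_add, Pi.add_apply] at this ⊢
      omega
    rw [← this]
  · rintro ⟨δ, rfl⟩
    exact ⟨⟨_, rfl⟩, (δ, 0), (shift_sign_sign a δ).symm⟩

lemma near_shift_sign (a : AffPoint V P) (δ : ZMod 2) : a.Near (a.shift (δ, 0)) :=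
  near_iff.mpr ⟨δ, rfl⟩

lemma Near.refl (a : AffPoint V P) : a.Near a := near_iff.mpr ⟨0, by
  rw [show ((0, 0) : AffCone P) = 0 from rfl, shift_zero]⟩

lemma Near.symm (h : a.Near b) : b.Near a := ⟨h.2, h.1⟩

lemma Below.trans {c : AffPoint V P} (h : a.Below b) (h' : b.Below c) : a.Below c := by
  obtain ⟨u, rfl⟩ := h
  obtain ⟨v, rfl⟩ := h'
  exact ⟨u + v, shift_shift _ _ _⟩

lemma Near.trans {c : AffPoint V P} (h : a.Near b) (h' : b.Near c) : a.Near c :=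
  ⟨h.1.trans h'.1, h'.2.trans h.2⟩

lemma Near.up (h : a.Near b) (S : Set P) : Up S a b := by
  obtain ⟨δ, rfl⟩ := near_iff.mp h
  exact ⟨(δ, 0), by intro r hr; exact absurd rfl hr, rfl⟩

lemma up_iff {S : Set P} : Up S a b ↔
    a.1 = b.1 ∧ (∀ r, a.2.2 r ≤ b.2.2 r) ∧ ∀ r, a.2.2 r ≠ b.2.2 r → r ∈ S := by
  constructor
  · rintro ⟨u, hu, rfl⟩
    refine ⟨rfl, fun r => Nat.le_add_right _ _, fun r hr => hu fun h0 => hr ?_⟩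
    show _ = a.2.2 r + u.2 r
    rw [h0, add_zero]
  · rintro ⟨h1, h2, h3⟩
    refine ⟨(b.2.1 - a.2.1, fun r => b.2.2 r - a.2.2 r), fun r hr => h3 r fun h => hr ?_, ?_⟩
    · simp [h]
    · refine Prod.ext h1.symm (Prod.ext ?_ (funext fun r => ?_))
      · show b.2.1 = a.2.1 + (b.2.1 - a.2.1); abel
      · show b.2.2 r = a.2.2 r + (b.2.2 r - a.2.2 r)
        have := h2 r; omega

end AffPoint

namespace GBSGraph

open AffPoint

variable {V E : Type*} {P : Finset ℕ} {G : GBSGraph V E} {a b c p : AffPoint V P}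

lemma affInit_rev (G : GBSGraph V E) (e : E) : G.affInit P (G.rev e) = G.affTer P e := by
  rw [affInit, G.rev_rev]

lemma affTer_rev (G : GBSGraph V E) (e : E) : G.affTer P (G.rev e) = G.affInit P e := rfl

lemma conj_shiftEquivalence (G : GBSGraph V E) : ShiftEquivalence (G.Conj P) where
  refl _ := .refl
  symm {a b} h := by
    have : Std.Symm (G.AffStep P) := ⟨fun p q ⟨e, u, h1, h2⟩ => ⟨G.rev e, u,
      by rw [affInit_rev]; exact h2, h1⟩⟩
    exact Relation.ReflTransGen.stdSymm.symm _ _ h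
  trans h h' := Relation.ReflTransGen.trans h h'
  shift u h := by
    refine Relation.ReflTransGen.lift (fun a : AffPoint V P => a.shift u) ?_ _ _ h
    rintro p q ⟨e, v, rfl, rfl⟩
    exact ⟨e, v + u, shift_shift _ _ _, shift_shift _ _ _⟩

lemma Conj.symm (h : G.Conj P a b) : G.Conj P b a := (conj_shiftEquivalence G).symm h

lemma Conj.trans (h : G.Conj P a b) (h' : G.Conj P b c) : G.Conj P a c :=
  Relation.ReflTransGen.trans h h'

lemma Conj.shift (h : G.Conj P a b) (u : AffCone P) : G.Conj P (a.shift u) (b.shift u) :=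
  (conj_shiftEquivalence G).shift u h

lemma conj_edge (G : GBSGraph V E) (e : E) : G.Conj P (G.affInit P e) (G.affTer P e) :=
  .single ⟨e, 0, by simp, by simp⟩

lemma conjLE_iff : G.ConjLE P a b ↔ ∃ u, G.Conj P (a.shift u) b := by
  constructor
  · rintro ⟨_, h, u, rfl⟩; exact ⟨u, h⟩
  · rintro ⟨u, h⟩; exact ⟨_, h, u, rfl⟩

lemma ConjLE.trans (h : G.ConjLE P a b) (h' : G.ConjLE P b c) : G.ConjLE P a c := by
  rw [conjLE_iff] at *
  obtain ⟨u, hu⟩ := h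
  obtain ⟨v, hv⟩ := h'
  exact ⟨u + v, by rw [← shift_shift]; exact (hu.shift v).trans hv⟩

lemma Conj.conjLE (h : G.Conj P a b) : G.ConjLE P a b := conjLE_iff.mpr ⟨0, by simpa using h⟩

lemma Conj.qconj (h : G.Conj P a b) : G.QConj P a b := ⟨h.conjLE, h.symm.conjLE⟩

lemma conjLE_shift (G : GBSGraph V E) (a : AffPoint V P) (u : AffCone P) :
    G.ConjLE P a (a.shift u) := conjLE_iff.mpr ⟨u, .refl⟩

lemma QConj.symm (h : G.QConj P a b) : G.QConj P b a := ⟨h.2, h.1⟩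

lemma QConj.trans (h : G.QConj P a b) (h' : G.QConj P b c) : G.QConj P a c :=
  ⟨h.1.trans h'.1, h'.2.trans h.2⟩

lemma QConj.refl (G : GBSGraph V E) (a : AffPoint V P) : G.QConj P a a :=
  Conj.qconj .refl

lemma exists_conj_of_qconj_shift {u : AffCone P} (h : G.QConj P (p.shift u) p) :
    ∃ w : AffCone P, G.Conj P (p.shift w) p ∧ u.supp ⊆ w.supp := by
  obtain ⟨v, hv⟩ := conjLE_iff.mp h.1
  rw [shift_shift] at hv
  exact ⟨u + v, hv, by rw [AffCone.supp_add]; exact Set.subset_union_left⟩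

/-- Some translation by an element whose support is the whole quasi-conjugacy support preserves the
conjugacy class. -/
lemma exists_conj_full (G : GBSGraph V E) (p : AffPoint V P) :
    ∃ w : AffCone P, G.Conj P (p.shift w) p ∧ w.supp = G.qcSupp P p := by
  classical
  have key : ∀ T : Finset P, (∀ r ∈ T, r ∈ G.qcSupp P p) →
      ∃ w : AffCone P, G.Conj P (p.shift w) p ∧ ∀ r ∈ T, r ∈ w.supp := by
    intro T
    induction T using Finset.induction_on with
    | empty => exact fun _ => ⟨0, by rw [shift_zero]; exact .refl, by simp⟩
    | insert r T _ ih =>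
      intro h
      obtain ⟨w, hw, hT⟩ := ih fun r hr => h r (Finset.mem_insert_of_mem hr)
      obtain ⟨u, hu, hr⟩ := h r (Finset.mem_insert_self r T)
      obtain ⟨w', hw', huw⟩ := exists_conj_of_qconj_shift hu
      refine ⟨w' + w, ?_, fun r' hr' => ?_⟩
      · rw [← shift_shift]; exact (hw'.shift w).trans hw
      · rw [AffCone.supp_add]
        rcases Finset.mem_insert.mp hr' with rfl | hr'
        · exact .inl (huw hr)
        · exact .inr (hT r' hr')
  obtain ⟨w, hw, hT⟩ := key (Finset.univ.filter (· ∈ G.qcSupp P p)) (by simp)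
  exact ⟨w, hw, Set.Subset.antisymm (fun r hr => ⟨w, hw.qconj, hr⟩) fun r hr => hT r (by simpa)⟩

lemma qconj_shift {u : AffCone P} (hu : u.supp ⊆ G.qcSupp P p) : G.QConj P (p.shift u) p := by
  obtain ⟨w, hw, hws⟩ := exists_conj_full G p
  obtain ⟨n, z, hz, -⟩ := AffCone.exists_nsmul_eq_add hws hu
  have hn : ∀ n : ℕ, G.Conj P (p.shift (n • w)) p := by
    intro n
    induction n with
    | zero => rw [zero_smul, shift_zero]; exact .refl
    | succ n ih =>
      rw [succ_nsmul, ← shift_shift]; exact (ih.shift w).trans hw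
  refine ⟨conjLE_iff.mpr ⟨z, ?_⟩, conjLE_shift G p u⟩
  rw [shift_shift, ← hz]; exact hn n

lemma qcSupp_subset (h : G.QConj P a b) : G.qcSupp P a ⊆ G.qcSupp P b := by
  intro r hr
  obtain ⟨w, hw, hws⟩ := exists_conj_full G a
  obtain ⟨v, hv⟩ := conjLE_iff.mp h.2
  refine ⟨v + w, ⟨?_, conjLE_shift _ _ _⟩, ?_⟩
  · have : G.Conj P (b.shift (v + w)) a := by
      rw [← shift_shift]; exact (hv.shift w).trans hw
    exact this.conjLE.trans h.1
  · rw [AffCone.supp_add, hws]; exact .inr hr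

lemma qcSupp_eq (h : G.QConj P a b) : G.qcSupp P a = G.qcSupp P b :=
  Set.Subset.antisymm (qcSupp_subset h) (qcSupp_subset h.symm)

lemma QConj.up (h : G.QConj P a p) (hb : Up (G.qcSupp P p) a b) : G.QConj P b p := by
  obtain ⟨u, hu, rfl⟩ := hb
  exact (qconj_shift (by rwa [qcSupp_eq h])).trans h

lemma QConj.supp_subset {u : AffCone P} (h : G.QConj P a p) (h' : G.QConj P (a.shift u) p) :
    u.supp ⊆ G.qcSupp P p := by
  rw [← qcSupp_eq h]
  exact fun r hr => ⟨u, h'.trans h.symm, hr⟩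

lemma QConj.near (h : G.QConj P a p) (hb : a.Near b) : G.QConj P b p := h.up (hb.up _)

lemma near_mem_qcMin (h : a ∈ G.qcMin P p) (hb : a.Near b) : b ∈ G.qcMin P p :=
  ⟨QConj.near h.1 hb, fun q' hq' hle => hb.2.trans (h.2 q' hq' (hle.trans hb.2))⟩

lemma exists_min_up (h : G.QConj P a p) : ∃ m ∈ G.qcMin P p, Up (G.qcSupp P p) m a := by
  induction hn : ∑ r, a.2.2 r using Nat.strong_induction_on generalizing a with
  | _ n ih =>
  by_cases hmin : a ∈ G.qcMin P p
  · exact ⟨a, hmin, .refl a⟩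
  · obtain ⟨q', hq', ⟨u, rfl⟩, hna⟩ : ∃ q', G.QConj P q' p ∧ q'.Below a ∧ ¬ a.Below q' := by
      by_contra hcon
      push Not at hcon
      exact hmin ⟨h, hcon⟩
    have hu : u.2 ≠ 0 := by
      intro h0
      refine hna ⟨(u.1, 0), ?_⟩
      have : u = (u.1, 0) := Prod.ext rfl h0
      conv_rhs => rw [this]
      exact (shift_sign_sign _ _).symm
    obtain ⟨r, hr⟩ := Function.ne_iff.mp hu
    have hr : 0 < u.2 r := Nat.pos_of_ne_zero hr
    obtain ⟨m, hm, hup⟩ := ih (∑ r, q'.2.2 r) (by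
      rw [← hn]
      refine Finset.sum_lt_sum (fun r _ => Nat.le_add_right _ _) ⟨r, Finset.mem_univ r, ?_⟩
      show q'.2.2 r < q'.2.2 r + u.2 r
      omega) hq' rfl
    exact ⟨m, hm, hup.shift (hq'.supp_subset h)⟩

lemma qconj_iff : G.QConj P a p ↔ ∃ m ∈ G.qcMin P p, Up (G.qcSupp P p) m a :=
  ⟨exists_min_up, fun ⟨_, hm, hup⟩ => QConj.up hm.1 hup⟩

/-- The family of `a` in a set `Q` of points, with respect to the support `S`. -/
def family (Q : Set (AffPoint V P)) (S : Set P) (a : AffPoint V P) : Set (AffPoint V P) :=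
  {b | b ∈ Q ∧ a.1 = b.1 ∧ ∀ r, a.2.2 r ≠ b.2.2 r → r ∈ S}

section family

variable {Q : Set (AffPoint V P)} {S : Set P}

lemma self_mem_family (ha : a ∈ Q) : a ∈ family Q S a := ⟨ha, rfl, fun _ h => absurd rfl h⟩

lemma family_eq_of_mem (h : b ∈ family Q S a) : family Q S b = family Q S a := by
  ext c
  refine ⟨fun hc => ⟨hc.1, h.2.1.trans hc.2.1, fun r hr => ?_⟩,
    fun hc => ⟨hc.1, h.2.1.symm.trans hc.2.1, fun r hr => ?_⟩⟩
  · by_cases h1 : a.2.2 r = b.2.2 r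
    · exact hc.2.2 r (h1 ▸ hr)
    · exact h.2.2 r h1
  · by_cases h1 : a.2.2 r = b.2.2 r
    · exact hc.2.2 r (h1 ▸ hr)
    · exact h.2.2 r h1

lemma family_eq_of_up (hb : b ∈ Q) (h : Up S a b) : family Q S b = family Q S a :=
  family_eq_of_mem ⟨hb, (up_iff.mp h).1, (up_iff.mp h).2.2⟩

lemma mem_family_of_eq (hb : b ∈ Q) (h : family Q S b = family Q S a) : b ∈ family Q S a :=
  h ▸ self_mem_family hb

/-- Two points of a family have a common upper bound. -/
lemma exists_up_up (h : b ∈ family Q S a) : ∃ u v : AffCone P, u.supp ⊆ S ∧ v.supp ⊆ S ∧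
    a.shift u = b.shift v := by
  refine ⟨(b.2.1, fun r => b.2.2 r - a.2.2 r), (a.2.1, fun r => a.2.2 r - b.2.2 r), ?_, ?_, ?_⟩
  · intro r hr
    refine h.2.2 r fun h0 => hr ?_
    simp [h0]
  · intro r hr
    refine h.2.2 r fun h0 => hr ?_
    simp [h0]
  · refine Prod.ext h.2.1 (Prod.ext (add_comm _ _) (funext fun r => ?_))
    show a.2.2 r + (b.2.2 r - a.2.2 r) = b.2.2 r + (a.2.2 r - b.2.2 r)
    omega

end family

lemma isFamily_iff {F : Set (AffPoint V P)} : G.IsFamily P p F ↔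
    ∃ a, G.QConj P a p ∧ F = family {b | G.QConj P b p} (G.qcSupp P p) a := by
  refine exists_congr fun a => and_congr_right fun ha => ?_
  have : {b | G.SameFamily P a b} = family {b | G.QConj P b p} (G.qcSupp P p) a := by
    ext b
    unfold SameFamily
    rw [qcSupp_eq ha]
    exact ⟨fun h => ⟨h.1.symm.trans ha, h.2.1, h.2.2⟩,
      fun h => ⟨ha.trans (QConj.symm h.1), h.2.1, h.2.2⟩⟩
  rw [this]

/-- Conjugate points of a family differ by an element of the linear algebra. -/
lemma sub_mem_linAlg (ha : G.QConj P a p) (hab : G.Conj P a b)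
    (hf : b ∈ family {b | G.QConj P b p} (G.qcSupp P p) a) : b.val - a.val ∈ G.linAlg P p := by
  obtain ⟨u, v, hu, hv, huv⟩ := exists_up_up hf
  obtain ⟨w, hw⟩ := conjLE_iff.mp ha.2
  have h1 : G.QConj P ((p.shift w).shift v) p := by
    refine QConj.up (hw.qconj.trans ha) ⟨v, hv, rfl⟩
  obtain ⟨z, hz⟩ := conjLE_iff.mp h1.1
  rw [shift_shift, shift_shift, ← add_assoc] at hz
  refine ⟨w + u + z, w + v + z, ?_, ?_, hz⟩
  · have := congrArg val huv
    rw [val_shift, val_shift] at this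
    have h2 : b.val = a.val + u.toGroup - v.toGroup := by rw [this]; abel
    simp only [AffCone.toGroup_add]
    rw [h2]
    abel
  · have e1 := hw.shift u
    have e2 := hab.shift v
    have e3 := hw.shift v
    rw [huv] at e1
    have e4 := (e1.trans (e2.symm.trans e3.symm)).shift z
    simpa only [shift_shift] using e4

end GBSGraph

/-! ### Graphs in normal form -/

namespace GBSGraph

open AffPoint

variable {V E : Type*} {P : Finset ℕ}

/-- A clean graph with one qc-class in normal form. -/
structure IsNormal (P : Finset ℕ) (G : GBSGraph V E) (p : AffPoint V P)
    (F₀ : Set (AffPoint V P)) (mF : Set (AffPoint V P) → AffPoint V P) : Prop where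
  one : G.OneQCClass P p
  clean : G.Clean P p
  form : G.NormalForm P p F₀ mF

/-- The family of a point in the quasi-conjugacy class of `p`. -/
def fam (P : Finset ℕ) (G : GBSGraph V E) (p a : AffPoint V P) : Set (AffPoint V P) :=
  family {b | G.QConj P b p} (G.qcSupp P p) a

/-- The oriented edge `e` starts at a chosen minimal point. -/
def Chosen (P : Finset ℕ) (G : GBSGraph V E) (p : AffPoint V P)
    (F₀ : Set (AffPoint V P)) (mF : Set (AffPoint V P) → AffPoint V P) (e : E) : Prop :=
  ∃ F, G.IsFamily P p F ∧ F ≠ F₀ ∧ (G.affInit P e).Near (mF F)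

/-- An orientation of the edges for which the edges at minimal points start there. -/
structure IsOrientation (P : Finset ℕ) (G : GBSGraph V E) (p : AffPoint V P) (O : Set E) :
    Prop where
  min_mem : ∀ e, G.affInit P e ∈ G.qcMin P p → e ∈ O
  rev_mem : ∀ e, G.rev e ∈ O ↔ e ∉ O

variable {G : GBSGraph V E} {p : AffPoint V P} {F₀ : Set (AffPoint V P)}
  {mF : Set (AffPoint V P) → AffPoint V P} {O : Set E} {a b : AffPoint V P} {e e' : E}

lemma mem_fam_self (ha : G.QConj P a p) : a ∈ G.fam P p a := self_mem_family ha

lemma fam_eq_of_mem (h : b ∈ G.fam P p a) : G.fam P p b = G.fam P p a := family_eq_of_mem h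

lemma fam_eq_of_up (ha : G.QConj P a p) (h : Up (G.qcSupp P p) a b) :
    G.fam P p b = G.fam P p a := family_eq_of_up (ha.up h) h

lemma isFamily_fam (ha : G.QConj P a p) : G.IsFamily P p (G.fam P p a) :=
  isFamily_iff.mpr ⟨a, ha, rfl⟩

lemma IsFamily.eq_fam {F : Set (AffPoint V P)} (hF : G.IsFamily P p F) (ha : a ∈ F) :
    F = G.fam P p a := by
  obtain ⟨b, -, rfl⟩ := isFamily_iff.mp hF
  exact (family_eq_of_mem ha).symm

/-- A deep point lies above the minimal points of the family, with gap exactly the support. -/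
lemma DeepIn.exists_shift {F : Set (AffPoint V P)} {m : AffPoint V P} (h : G.DeepIn P p F a)
    (hm : m ∈ G.qcMin P p) (hmF : m ∈ F) :
    ∃ w : AffCone P, a = m.shift w ∧ w.supp = G.qcSupp P p := by
  obtain ⟨w, hw, hs⟩ := h.2 m hm hmF
  exact ⟨w, hw, by rw [hs, qcSupp_eq hm.1]⟩

lemma DeepIn.up {F : Set (AffPoint V P)} {m : AffPoint V P} (h : G.DeepIn P p F a)
    (hm : m ∈ G.qcMin P p) (hmF : m ∈ F) : Up (G.qcSupp P p) m a := by
  obtain ⟨w, hw, hs⟩ := h.exists_shift hm hmF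
  exact ⟨w, hs.subset, hw⟩

namespace IsNormal

variable (h : G.IsNormal P p F₀ mF)
include h

lemma qconj_init (e : E) : G.QConj P (G.affInit P e) p := h.one e

lemma qconj_ter (e : E) : G.QConj P (G.affTer P e) p := by
  have := h.one (G.rev e)
  rwa [affInit_rev] at this

lemma eq_of_near_min {m : AffPoint V P} (hm : m ∈ G.qcMin P p) (he : (G.affInit P e).Near m)
    (he' : (G.affInit P e').Near m) : e = e' := (h.clean.1 m hm).unique he he'

lemma chosen_spec (he : G.Chosen P p F₀ mF e) : G.affInit P e ∈ G.qcMin P p ∧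
    G.fam P p (G.affInit P e) ≠ F₀ ∧
    (G.affInit P e).Near (mF (G.fam P p (G.affInit P e))) := by
  obtain ⟨F, hF, hne, hn⟩ := he
  obtain ⟨h1, h2⟩ := h.form.chosen F hF hne
  have h3 : F = G.fam P p (G.affInit P e) := by
    rw [hF.eq_fam h2]
    exact fam_eq_of_up (h.qconj_init e) (hn.up _)
  rw [← h3]
  exact ⟨near_mem_qcMin h1 hn.symm, hne, hn⟩

lemma chosen_unique (he : G.Chosen P p F₀ mF e) (he' : G.Chosen P p F₀ mF e')
    (hf : G.fam P p (G.affInit P e) = G.fam P p (G.affInit P e')) : e = e' := by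
  obtain ⟨h1, h2, h3⟩ := h.chosen_spec he
  obtain ⟨-, -, h3'⟩ := h.chosen_spec he'
  rw [← hf] at h3'
  exact h.eq_of_near_min (near_mem_qcMin h1 h3) h3 h3'

lemma exists_chosen (ha : G.QConj P a p) (hne : G.fam P p a ≠ F₀) :
    ∃ e, G.Chosen P p F₀ mF e ∧ G.fam P p (G.affInit P e) = G.fam P p a := by
  obtain ⟨h1, h2⟩ := h.form.chosen _ (isFamily_fam ha) hne
  obtain ⟨e, he, -⟩ := h.clean.1 _ h1
  refine ⟨e, ⟨_, isFamily_fam ha, hne, he⟩, ?_⟩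
  rw [← fam_eq_of_up (h.qconj_init e) (he.up _)]
  exact fam_eq_of_mem h2

lemma chosen_deep (he : G.Chosen P p F₀ mF e) : G.DeepIn P p F₀ (G.affTer P e) := by
  obtain ⟨F, hF, hne, hn⟩ := he
  exact h.form.connecting F hF hne e hn

lemma staying (he : G.affInit P e ∈ G.qcMin P p) (hc : ¬ G.Chosen P p F₀ mF e) :
    G.DeepIn P p (G.fam P p (G.affInit P e)) (G.affTer P e) :=
  h.form.staying _ (isFamily_fam he.1) _ he (mem_fam_self he.1)
    (fun hne hn => hc ⟨_, isFamily_fam he.1, hne, hn⟩) e (Near.refl _)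

lemma floating_of_mem (hO : G.IsOrientation P p O) (he : e ∈ O)
    (hm : G.affInit P e ∉ G.qcMin P p) :
    G.DeepIn P p F₀ (G.affInit P e) ∧ G.DeepIn P p F₀ (G.affTer P e) := by
  refine h.form.floating e hm fun hm' => ?_
  rw [← affInit_rev] at hm'
  exact (hO.rev_mem e).mp (hO.min_mem _ hm') he

lemma fam_eq_of_mem_base (ha : a ∈ F₀) : G.fam P p a = F₀ := (h.form.isFamily.eq_fam ha).symm

lemma fam_ter_of_chosen (he : G.Chosen P p F₀ mF e) : G.fam P p (G.affTer P e) = F₀ :=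
  h.fam_eq_of_mem_base (h.chosen_deep he).1

lemma fam_ter (hO : G.IsOrientation P p O) (he : e ∈ O) (hc : ¬ G.Chosen P p F₀ mF e) :
    G.fam P p (G.affTer P e) = G.fam P p (G.affInit P e) := by
  by_cases hm : G.affInit P e ∈ G.qcMin P p
  · exact fam_eq_of_mem (h.staying hm hc).1
  · obtain ⟨h1, h2⟩ := h.floating_of_mem hO he hm
    rw [h.fam_eq_of_mem_base h1.1, h.fam_eq_of_mem_base h2.1]

/-- The coordinates of a point, transported to the distinguished family along the edge at the chosen
minimal point, change along affine paths by displacements of edges that stay in their family. -/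
lemma sub_mem_of_conj (hO : G.IsOrientation P p O) (W : Submodule ℤ (AffGroup P))
    (hW : ∀ e ∈ O, ¬ G.Chosen P p F₀ mF e → (G.affTer P e).val - (G.affInit P e).val ∈ W)
    (ha : G.QConj P a p) (hab : G.Conj P a b) (hf : G.fam P p a = G.fam P p b) :
    b.val - a.val ∈ W := by
  have hex : ∀ F : Set (AffPoint V P), ∃ g : AffGroup P, (F = F₀ → g = 0) ∧
      ∀ e, G.Chosen P p F₀ mF e → F = G.fam P p (G.affInit P e) →
        g = (G.affTer P e).val - (G.affInit P e).val := by
    intro F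
    by_cases hF : F = F₀
    · exact ⟨0, fun _ => rfl, fun e he hFe => absurd (hFe.symm.trans hF) (h.chosen_spec he).2.1⟩
    · by_cases hc : ∃ e, G.Chosen P p F₀ mF e ∧ F = G.fam P p (G.affInit P e)
      · obtain ⟨e, he, hFe⟩ := hc
        refine ⟨(G.affTer P e).val - (G.affInit P e).val, fun h0 => absurd h0 hF,
          fun e' he' hFe' => ?_⟩
        rw [h.chosen_unique he he' (hFe.symm.trans hFe')]
      · exact ⟨0, fun _ => rfl, fun e he hFe => absurd ⟨e, he, hFe⟩ hc⟩
  choose ν hν₀ hν using hex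
  let Φ : AffPoint V P → AffGroup P := fun a => a.val + ν (G.fam P p a)
  have hedgeO : ∀ e ∈ O, Φ (G.affTer P e) - Φ (G.affInit P e) ∈ W := by
    intro e he
    by_cases hc : G.Chosen P p F₀ mF e
    · have : Φ (G.affTer P e) - Φ (G.affInit P e) = 0 := by
        simp only [Φ]
        rw [hν₀ _ (h.fam_ter_of_chosen hc), hν _ e hc rfl]
        abel
      rw [this]; exact W.zero_mem
    · have : Φ (G.affTer P e) - Φ (G.affInit P e) = (G.affTer P e).val - (G.affInit P e).val := by
        simp only [Φ]
        rw [h.fam_ter hO he hc]; abel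
      rw [this]; exact hW e he hc
  have hedge : ∀ e, Φ (G.affTer P e) - Φ (G.affInit P e) ∈ W := by
    intro e
    by_cases he : e ∈ O
    · exact hedgeO e he
    · have := hedgeO _ ((hO.rev_mem e).mpr he)
      rw [affTer_rev, affInit_rev] at this
      rw [← neg_sub]
      exact W.neg_mem this
  have hshift : ∀ a u, G.QConj P a p → G.QConj P (a.shift u) p → Φ (a.shift u) =
      Φ a + u.toGroup := by
    intro a u ha hau
    simp only [Φ]
    rw [fam_eq_of_up ha ⟨u, ha.supp_subset hau, rfl⟩, val_shift]
    abel
  have key : Φ b - Φ a ∈ W := by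
    clear hf
    induction hab with
    | refl => rw [sub_self]; exact W.zero_mem
    | @tail c d hc hd ih =>
      have hcQ : G.QConj P c p := (Conj.qconj hc).symm.trans ha
      have hdQ : G.QConj P d p :=
        (Conj.qconj (Relation.ReflTransGen.single hd : G.Conj P c d)).symm.trans hcQ
      obtain ⟨e, u, rfl, rfl⟩ := hd
      rw [hshift _ _ (h.qconj_init e) hcQ] at ih
      rw [hshift _ _ (h.qconj_ter e) hdQ]
      have := W.add_mem (hedge e) ih
      convert this using 1
      abel
  simp only [Φ] at key
  rw [hf] at key
  convert key using 1
  abel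

/-- The linear algebra is generated by the displacements of the edges that stay in their family. -/
lemma coe_span_eq_linAlg (hO : G.IsOrientation P p O) :
    (Submodule.span ℤ {x | ∃ e ∈ O, ¬ G.Chosen P p F₀ mF e ∧
      x = (G.affTer P e).val - (G.affInit P e).val} : Set (AffGroup P)) = G.linAlg P p := by
  set W := Submodule.span ℤ {x | ∃ e ∈ O, ¬ G.Chosen P p F₀ mF e ∧
      x = (G.affTer P e).val - (G.affInit P e).val} with hW
  have hle : ∀ x ∈ G.linAlg P p, x ∈ W := by
    rintro x ⟨w, w', rfl, h1, h2⟩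
    have q2 : G.QConj P (p.shift w') p := h2.qconj
    have q1 : G.QConj P (p.shift w) p := (h1.trans h2).qconj
    have f1 := fam_eq_of_up (QConj.refl G p) ⟨w, (QConj.refl G p).supp_subset q1, rfl⟩
    have f2 := fam_eq_of_up (QConj.refl G p) ⟨w', (QConj.refl G p).supp_subset q2, rfl⟩
    have := h.sub_mem_of_conj hO W
      (fun e he hc => Submodule.subset_span ⟨e, he, hc, rfl⟩) q2 h1.symm (f2.trans f1.symm)
    rwa [val_shift, val_shift, add_sub_add_left_eq_sub] at this
  have hadd : ∀ x ∈ G.linAlg P p, ∀ y ∈ G.linAlg P p, x + y ∈ G.linAlg P p := by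
    rintro _ ⟨w, w', rfl, h1, h2⟩ _ ⟨z, z', rfl, h3, h4⟩
    have e1 : ∀ w z : AffCone P, G.Conj P (p.shift w) p → G.Conj P (p.shift z) p →
        G.Conj P (p.shift (w + z)) p := fun w z hw hz => by
      rw [← shift_shift]; exact (hw.shift z).trans hz
    have h5 := e1 _ _ (h1.trans h2) (h3.trans h4)
    have h6 := e1 _ _ h2 h4
    refine ⟨w + z, w' + z', ?_, h5.trans h6.symm, h6⟩
    simp only [AffCone.toGroup_add]; abel
  have hneg : ∀ x ∈ G.linAlg P p, -x ∈ G.linAlg P p := by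
    rintro _ ⟨w, w', rfl, h1, h2⟩
    exact ⟨w', w, by rw [neg_sub], h1.symm, h1.trans h2⟩
  have hzero : (0 : AffGroup P) ∈ G.linAlg P p := ⟨0, 0, by simp, .refl, by
    rw [shift_zero]; exact .refl⟩
  refine Set.Subset.antisymm (fun x hx => ?_) hle
  let L : AddSubgroup (AffGroup P) :=
    { carrier := G.linAlg P p
      add_mem' := fun {x y} hx hy => hadd x hx y hy
      zero_mem' := hzero
      neg_mem' := fun {x} hx => hneg x hx }
  have : W ≤ AddSubgroup.toIntSubmodule L := by
    rw [hW, Submodule.span_le]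
    rintro _ ⟨e, he, hc, rfl⟩
    have hf := h.fam_ter hO he hc
    exact sub_mem_linAlg (h.qconj_init e) (conj_edge G e)
      (mem_family_of_eq (h.qconj_ter e) hf)
  exact this hx

end IsNormal

end GBSGraph

/-! ### Matching the edges of two graphs -/

/-- A bijection between subsets that is compatible with two maps, all of whose fibres have equal
sizes, extends to a compatible bijection. -/
lemma exists_equiv_extending {A B κ : Type*} [Finite A] [Finite B] (f : A → κ) (g : B → κ)
    (hfg : ∀ c, {a | f a = c}.ncard = {b | g b = c}.ncard) (X : Set A) (Y : Set B) (β : X ≃ Y)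
    (hβ : ∀ x, g (β x) = f x) :
    ∃ ψ : A ≃ B, (∀ x : X, ψ x = β x) ∧ ∀ a, g (ψ a) = f a := by
  classical
  have h1 : ∀ c, {a | f a = c ∧ a ∈ X}.ncard = {b | g b = c ∧ b ∈ Y}.ncard := by
    intro c
    refine Set.ncard_congr (fun a ha => β ⟨a, ha.2⟩) ?_ ?_ ?_
    · exact fun a ha => ⟨(hβ _).trans ha.1, (β _).2⟩
    · exact fun a b ha hb h => congrArg Subtype.val (β.injective (Subtype.ext h))
    · rintro b ⟨hb, hbY⟩
      refine ⟨β.symm ⟨b, hbY⟩, ⟨?_, (β.symm _).2⟩, by simp⟩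
      rw [← hβ]; simpa using hb
  have h2 : ∀ c, {a | f a = c ∧ a ∉ X}.ncard = {b | g b = c ∧ b ∉ Y}.ncard := by
    intro c
    have e1 : {a | f a = c ∧ a ∈ X}.ncard + {a | f a = c ∧ a ∉ X}.ncard = {a | f a = c}.ncard :=
      Set.ncard_inter_add_ncard_sdiff_eq_ncard {a | f a = c} X
    have e2 : {b | g b = c ∧ b ∈ Y}.ncard + {b | g b = c ∧ b ∉ Y}.ncard = {b | g b = c}.ncard :=
      Set.ncard_inter_add_ncard_sdiff_eq_ncard {b | g b = c} Y
    have e3 := hfg c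
    have e4 := h1 c
    omega
  have h3 : ∀ c, Nonempty ({a : {a // a ∉ X} // f a = c} ≃ {b : {b // b ∉ Y} // g b = c}) := by
    intro c
    refine ⟨(Equiv.subtypeSubtypeEquivSubtypeInter (fun a => a ∉ X) (fun a => f a = c)).trans
      (Equiv.trans ?_
        (Equiv.subtypeSubtypeEquivSubtypeInter (fun b => b ∉ Y) (fun b => g b = c)).symm)⟩
    have := h2 c
    rw [← Nat.card_coe_set_eq, ← Nat.card_coe_set_eq] at this
    have e : Nat.card {a // a ∉ X ∧ f a = c} = Nat.card {b // b ∉ Y ∧ g b = c} := by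
      simpa only [Set.coe_ofPred, and_comm] using this
    exact (Finite.equivFinOfCardEq e).trans (Finite.equivFinOfCardEq rfl).symm
  let γ := fun c => (h3 c).some
  let γ' : {a // a ∉ X} ≃ {b // b ∉ Y} :=
    (Equiv.sigmaFiberEquiv fun a : {a // a ∉ X} => f a).symm.trans ((Equiv.sigmaCongrRight γ).trans (Equiv.sigmaFiberEquiv fun b : {b // b ∉ Y} => g b))
  have hγ : ∀ a, g (γ' a) = f a := fun a => (γ (f a) ⟨a, rfl⟩).2
  let ψ : A ≃ B := (Equiv.sumCompl (· ∈ X)).symm.trans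
    ((Equiv.sumCongr β γ').trans (Equiv.sumCompl (· ∈ Y)))
  have hψ₁ : ∀ (a : A) (ha : a ∈ X), ψ a = β ⟨a, ha⟩ := by
    intro a ha
    simp [ψ, Equiv.sumCompl_symm_apply_of_pos (p := (· ∈ X)) ha]
  have hψ₂ : ∀ (a : A) (ha : a ∉ X), ψ a = γ' ⟨a, ha⟩ := by
    intro a ha
    simp [ψ, Equiv.sumCompl_symm_apply_of_neg (p := (· ∈ X)) ha]
  refine ⟨ψ, fun x => hψ₁ x x.2, fun a => ?_⟩
  by_cases ha : a ∈ X
  · rw [hψ₁ a ha, hβ]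
  · rw [hψ₂ a ha, hγ]

namespace GBSGraph

open AffPoint

variable {V E E' : Type*} {P : Finset ℕ} {G G' : GBSGraph V E} {H : GBSGraph V E'}
  {p q : AffPoint V P}

/-- The affine representations differ by the `ℤ/2` component only, by the same amount at both
endpoints of an edge. -/
def SignEquiv (P : Finset ℕ) (G G' : GBSGraph V E) : Prop :=
  ∀ e, ∃ δ : ZMod 2, G'.affInit P e = (G.affInit P e).shift (δ, 0) ∧
    G'.affTer P e = (G.affTer P e).shift (δ, 0)

lemma EdgeSignChange.signEquiv (h : G.EdgeSignChange G') : SignEquiv P G G' := by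
  obtain ⟨hr, hi, d, h1, h2, h3⟩ := h
  have hter : ∀ e, (G'.label e = -G.label e → G'.affTer P e = (G.affTer P e).shift (1, 0)) ∧
      (G'.label e = G.label e → G'.affTer P e = (G.affTer P e).shift (0, 0)) := by
    intro e
    have : G'.ter e = G.ter e := by rw [ter, ter, hr, hi]
    constructor
    · intro h
      rw [affTer, affTer, this, h, factor_neg (G.label_ne_zero e)]; rfl
    · intro h
      rw [affTer, affTer, this, h]
      exact (shift_zero _).symm
  intro e
  rw [affInit, affInit, hr]
  by_cases he : e = d
  · subst he
    exact ⟨1, (hter _).1 h2, (hter _).1 h1⟩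
  · by_cases he' : e = G.rev d
    · subst he'
      rw [G.rev_rev]
      exact ⟨1, (hter _).1 h1, (hter _).1 h2⟩
    · refine ⟨0, (hter _).2 (h3 _ ?_ ?_), (hter _).2 (h3 _ he he')⟩
      · exact fun h => he' (by rw [← h, G.rev_rev])
      · exact fun h => he (by rw [← G.rev_rev e, h, G.rev_rev])

lemma signEquiv_of_reflTransGen (h : Relation.ReflTransGen EdgeSignChange G G') :
    SignEquiv P G G' := by
  induction h with
  | refl => exact fun e => ⟨0, (shift_zero _).symm, (shift_zero _).symm⟩
  | tail _ h ih =>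
    intro e
    obtain ⟨δ, h1, h2⟩ := ih e
    obtain ⟨δ', h1', h2'⟩ := h.signEquiv e
    have : ((δ, 0) + (δ', 0) : AffCone P) = (δ + δ', 0) := by simp
    exact ⟨δ + δ', by rw [h1', h1, shift_shift, this], by rw [h2', h2, shift_shift, this]⟩

lemma SignEquiv.conj_iff (h : SignEquiv P G G') {a b : AffPoint V P} :
    G'.Conj P a b ↔ G.Conj P a b := by
  have : G'.AffStep P = G.AffStep P := by
    funext a b
    refine propext ⟨?_, ?_⟩
    · rintro ⟨e, u, rfl, rfl⟩
      obtain ⟨δ, h1, h2⟩ := h e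
      exact ⟨e, (δ, 0) + u, by rw [h1, shift_shift], by rw [h2, shift_shift]⟩
    · rintro ⟨e, u, rfl, rfl⟩
      obtain ⟨δ, h1, h2⟩ := h e
      refine ⟨e, (δ, 0) + u, ?_, ?_⟩
      · rw [h1, ← shift_shift, shift_sign_sign]
      · rw [h2, ← shift_shift, shift_sign_sign]
  rw [Conj, Conj, this]

lemma conj_shift_sign_iff {a b : AffPoint V P} {δ : ZMod 2} :
    G.Conj P (a.shift (δ, 0)) b ↔ G.Conj P a (b.shift (δ, 0)) := by
  constructor <;> intro h
  · have := h.shift (δ, 0); rwa [shift_sign_sign] at this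
  · have := h.shift (δ, 0); rwa [shift_sign_sign] at this

/-- Conjugacy up to the `ℤ/2` component. -/
def NearConj (P : Finset ℕ) (G : GBSGraph V E) (a b : AffPoint V P) : Prop :=
  ∃ δ : ZMod 2, G.Conj P (a.shift (δ, 0)) b

section NearConj

variable {a b c : AffPoint V P}

lemma NearConj.symm (h : G.NearConj P a b) : G.NearConj P b a := by
  obtain ⟨δ, h⟩ := h
  refine ⟨δ, ?_⟩
  have := h.shift (δ, 0)
  rw [shift_sign_sign] at this
  exact this.symm

lemma NearConj.trans (h : G.NearConj P a b) (h' : G.NearConj P b c) : G.NearConj P a c := by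
  obtain ⟨δ, h⟩ := h
  obtain ⟨δ', h'⟩ := h'
  refine ⟨δ + δ', ?_⟩
  have := (h.shift (δ', 0)).trans h'
  rw [shift_shift] at this
  simpa using this

lemma Conj.nearConj (h : G.Conj P a b) : G.NearConj P a b :=
  ⟨0, by rw [show ((0, 0) : AffCone P) = 0 from rfl, shift_zero]; exact h⟩

lemma setOf_nearConj (f : E → AffPoint V P) : {e | G.NearConj P a (f e)} =
    {e | G.Conj P (a.shift (0, 0)) (f e)} ∪ {e | G.Conj P (a.shift (1, 0)) (f e)} := by
  have hz : ∀ δ : ZMod 2, δ = 0 ∨ δ = 1 := by decide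
  ext e
  refine ⟨fun ⟨δ, hδ⟩ => ?_, fun h => h.elim (fun h => ⟨_, h⟩) fun h => ⟨_, h⟩⟩
  rcases hz δ with rfl | rfl
  · exact .inl hδ
  · exact .inr hδ

lemma nearConj_of_near (h : a.Near b) : G.NearConj P a b := by
  obtain ⟨δ, rfl⟩ := near_iff.mp h
  exact ⟨δ, .refl⟩

/-- The class of the edge `e` for conjugacy up to the `ℤ/2` component. -/
def edgeClass (P : Finset ℕ) (G : GBSGraph V E) (e : E) : Set (AffPoint V P) :=
  {b | G.NearConj P b (G.affInit P e)}

lemma edgeClass_rev (e : E) : G.edgeClass P (G.rev e) = G.edgeClass P e := by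
  ext b
  have h := (conj_edge (P := P) G e).nearConj
  rw [edgeClass, edgeClass, Set.mem_ofPred_eq, Set.mem_ofPred_eq, affInit_rev]
  exact ⟨fun hb => hb.trans h.symm, fun hb => hb.trans h⟩

lemma edgeClass_eq_iff {e : E} :
    G.edgeClass P e = {b | G.NearConj P b a} ↔ G.NearConj P a (G.affInit P e) := by
  constructor
  · intro h
    have : a ∈ {b | G.NearConj P b a} := Conj.nearConj .refl
    rwa [← h] at this
  · intro h
    ext b
    exact ⟨fun hb => NearConj.trans hb h.symm, fun hb => NearConj.trans hb h⟩

end NearConj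

/-- If the conjugacy classes containing edges agree, then so do conjugacies with endpoints of
edges. -/
lemma conj_iff_of_sameConjEdgeNumbers (h : G.SameConjEdgeNumbers P H) {a : AffPoint V P}
    (ha : (∃ e, a = G.affInit P e) ∨ ∃ e, a = H.affInit P e) (b : AffPoint V P) :
    G.Conj P a b ↔ H.Conj P a b := by
  rcases ha with ⟨e, rfl⟩ | ⟨e, rfl⟩
  · obtain ⟨⟨c, hc⟩, -⟩ := (h {b | G.Conj P (G.affInit P e) b}).1.mp ⟨⟨_, rfl⟩, e, .refl⟩
    have h1 : G.affInit P e ∈ {b | H.Conj P c b} := hc ▸ Relation.ReflTransGen.refl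
    have h2 : b ∈ {b | G.Conj P (G.affInit P e) b} ↔ b ∈ {b | H.Conj P c b} := by rw [hc]
    exact h2.trans ⟨fun h => (Conj.symm h1).trans h, fun h => Conj.trans h1 h⟩
  · obtain ⟨⟨c, hc⟩, -⟩ := (h {b | H.Conj P (H.affInit P e) b}).1.mpr ⟨⟨_, rfl⟩, e, .refl⟩
    have h1 : H.affInit P e ∈ {b | G.Conj P c b} := hc ▸ Relation.ReflTransGen.refl
    have h2 : b ∈ {b | H.Conj P (H.affInit P e) b} ↔ b ∈ {b | G.Conj P c b} := by rw [hc]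
    exact Iff.symm (h2.trans ⟨fun h => (Conj.symm h1).trans h, fun h => Conj.trans h1 h⟩)

lemma ncard_nearConj_eq [Finite E] [Finite E'] (h : G.SameConjEdgeNumbers P H) {a : AffPoint V P}
    (ha : ∀ b, G.Conj P a b ↔ H.Conj P a b) :
    {e | G.NearConj P a (G.affInit P e)}.ncard = {e | H.NearConj P a (H.affInit P e)}.ncard := by
  have hshift : ∀ δ : ZMod 2, ∀ b, G.Conj P (a.shift (δ, 0)) b ↔ H.Conj P (a.shift (δ, 0)) b := by
    intro δ b
    rw [conj_shift_sign_iff, ha, conj_shift_sign_iff]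
  have hcls : ∀ δ : ZMod 2, {e | G.Conj P (a.shift (δ, 0)) (G.affInit P e)}.ncard =
      {e | H.Conj P (a.shift (δ, 0)) (H.affInit P e)}.ncard := by
    intro δ
    have heq : {b | G.Conj P (a.shift (δ, 0)) b} = {b | H.Conj P (a.shift (δ, 0)) b} :=
      Set.ext (hshift δ)
    by_cases hC : G.IsEdgeConjClass P {b | G.Conj P (a.shift (δ, 0)) b}
    · have := (h _).2 hC
      refine this.trans (congrArg Set.ncard (Set.ext fun e => hshift δ _))
    · have hC' := (not_congr (h _).1).mp hC
      have e1 : {e | G.Conj P (a.shift (δ, 0)) (G.affInit P e)} = ∅ :=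
        Set.eq_empty_of_forall_notMem fun e he => hC ⟨⟨_, rfl⟩, e, he⟩
      have e2 : {e | H.Conj P (a.shift (δ, 0)) (H.affInit P e)} = ∅ :=
        Set.eq_empty_of_forall_notMem fun e he => hC' ⟨⟨_, heq⟩, e, (hshift δ _).mpr he⟩
      rw [e1, e2, Set.ncard_empty, Set.ncard_empty]
  rw [setOf_nearConj, setOf_nearConj]
  -- the two conjugacy classes coincide or are disjoint, simultaneously in both graphs
  by_cases h01 : G.Conj P (a.shift (0, 0)) (a.shift (1, 0))
  · have h01' := (hshift _ _).mp h01
    have e1 : {e | G.Conj P (a.shift (1, 0)) (G.affInit P e)} =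
        {e | G.Conj P (a.shift (0, 0)) (G.affInit P e)} :=
      Set.ext fun e => ⟨fun h => h01.trans h, fun h => h01.symm.trans h⟩
    have e2 : {e | H.Conj P (a.shift (1, 0)) (H.affInit P e)} =
        {e | H.Conj P (a.shift (0, 0)) (H.affInit P e)} :=
      Set.ext fun e => ⟨fun h => h01'.trans h, fun h => h01'.symm.trans h⟩
    rw [e1, e2, Set.union_self, Set.union_self, hcls]
  · have h01' := fun h => h01 ((hshift _ _).mpr h)
    have d1 : Disjoint {e | G.Conj P (a.shift (0, 0)) (G.affInit P e)}
        {e | G.Conj P (a.shift (1, 0)) (G.affInit P e)} :=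
      Set.disjoint_left.mpr fun e he he' => h01 (Conj.trans he (Conj.symm he'))
    have d2 : Disjoint {e | H.Conj P (a.shift (0, 0)) (H.affInit P e)}
        {e | H.Conj P (a.shift (1, 0)) (H.affInit P e)} :=
      Set.disjoint_left.mpr fun e he he' => h01' (Conj.trans he (Conj.symm he'))
    rw [Set.ncard_union_eq d1, Set.ncard_union_eq d2, hcls, hcls]

/-- Conjugacies with endpoints of edges are the same in both graphs. -/
def EdgeConjEq (P : Finset ℕ) (G : GBSGraph V E) (H : GBSGraph V E') : Prop :=
  ∀ a, ((∃ e, a.Near (G.affInit P e)) ∨ ∃ e, a.Near (H.affInit P e)) →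
    ∀ b, G.Conj P a b ↔ H.Conj P a b

lemma edgeConjEq_of_sameConjEdgeNumbers (hs : SignEquiv P G G')
    (h : G'.SameConjEdgeNumbers P H) : EdgeConjEq P G H := by
  intro a ha b
  rcases ha with ⟨e, he⟩ | ⟨e, he⟩
  · obtain ⟨δ, h1, -⟩ := hs e
    obtain ⟨δ', h2⟩ := near_iff.mp (he.trans (h1 ▸ near_shift_sign _ δ : (G.affInit P e).Near
      (G'.affInit P e))).symm
    rw [h2, conj_shift_sign_iff, conj_shift_sign_iff, ← hs.conj_iff]
    exact conj_iff_of_sameConjEdgeNumbers h (.inl ⟨e, rfl⟩) _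
  · obtain ⟨δ', h2⟩ := near_iff.mp he.symm
    rw [h2, conj_shift_sign_iff, conj_shift_sign_iff, ← hs.conj_iff]
    exact conj_iff_of_sameConjEdgeNumbers h (.inr ⟨e, rfl⟩) _

lemma EdgeConjEq.edgeClass_eq (h : EdgeConjEq P G H) {e : E} {e' : E'}
    (hn : G.NearConj P (G.affInit P e) (H.affInit P e')) : G.edgeClass P e = H.edgeClass P e' := by
  rw [edgeClass_eq_iff.mpr hn.symm]
  ext b
  refine ⟨fun hb => ?_, fun hb => ?_⟩
  · obtain ⟨δ, hδ⟩ := NearConj.symm hb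
    exact NearConj.symm ⟨δ, (h _ (.inr ⟨e', (near_shift_sign _ δ).symm⟩) b).mp hδ⟩
  · obtain ⟨δ, hδ⟩ := NearConj.symm hb
    exact NearConj.symm ⟨δ, (h _ (.inr ⟨e', (near_shift_sign _ δ).symm⟩) b).mpr hδ⟩

/-- Up to the `ℤ/2` component, every class contains the same number of edges of both graphs. -/
lemma ncard_edgeClass_eq [Finite E] [Finite E'] (hs : SignEquiv P G G')
    (h : G'.SameConjEdgeNumbers P H) (C : Set (AffPoint V P)) :
    {e | G.edgeClass P e = C}.ncard = {e | H.edgeClass P e = C}.ncard := by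
  have hG : ∀ e, G'.edgeClass P e = G.edgeClass P e := by
    intro e
    obtain ⟨δ, h1, -⟩ := hs e
    have hn : G.NearConj P (G.affInit P e) (G'.affInit P e) :=
      nearConj_of_near (h1 ▸ near_shift_sign _ δ)
    rw [edgeClass_eq_iff.mpr hn.symm]
    ext b
    refine exists_congr fun δ => hs.conj_iff
  simp only [← hG]
  have key : ∀ a : AffPoint V P, ((∃ e, a = G'.affInit P e) ∨ ∃ e, a = H.affInit P e) →
      (C = {b | G'.NearConj P b a} ∨ C = {b | H.NearConj P b a}) →
      {e | G'.edgeClass P e = C}.ncard = {e | H.edgeClass P e = C}.ncard := by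
    intro a ha hC
    have hc := conj_iff_of_sameConjEdgeNumbers h ha
    have hn : ∀ b, G'.NearConj P b a ↔ H.NearConj P b a := by
      intro b
      constructor
      · rintro ⟨δ, hδ⟩
        exact ⟨δ, ((hc _).mp (Conj.symm hδ)).symm⟩
      · rintro ⟨δ, hδ⟩
        exact ⟨δ, ((hc _).mpr (Conj.symm hδ)).symm⟩
    have hC1 : C = {b | G'.NearConj P b a} := by
      rcases hC with rfl | rfl
      · rfl
      · ext b; exact (hn b).symm
    have hC2 : C = {b | H.NearConj P b a} := by
      rw [hC1]; ext b; exact hn b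
    have e1 : {e | G'.edgeClass P e = C} = {e | G'.NearConj P a (G'.affInit P e)} := by
      ext e; rw [hC1]; exact edgeClass_eq_iff
    have e2 : {e | H.edgeClass P e = C} = {e | H.NearConj P a (H.affInit P e)} := by
      ext e; rw [hC2]; exact edgeClass_eq_iff
    rw [e1, e2]
    exact ncard_nearConj_eq h hc
  by_cases h1 : ∃ e, G'.edgeClass P e = C
  · obtain ⟨e, rfl⟩ := h1
    exact key _ (.inl ⟨e, rfl⟩) (.inl rfl)
  · by_cases h2 : ∃ e, H.edgeClass P e = C
    · obtain ⟨e, rfl⟩ := h2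
      exact key _ (.inr ⟨e, rfl⟩) (.inr rfl)
    · push Not at h1 h2
      simp [h1, h2]

/-! ### Orientations -/

lemma exists_isOrientation [Finite E] (h : G.Clean P p) : ∃ O, G.IsOrientation P p O := by
  obtain ⟨n, ⟨f⟩⟩ := Finite.exists_equiv_fin E
  refine ⟨{e | G.affInit P e ∈ G.qcMin P p ∨ (G.affTer P e ∉ G.qcMin P p ∧ f e < f (G.rev e))},
    fun e he => .inl he, fun e => ?_⟩
  have h1 := h.2 e
  have h2 : f e ≠ f (G.rev e) := fun h => G.rev_ne e (f.injective h).symm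
  simp only [Set.mem_ofPred_eq, affInit_rev, affTer_rev, G.rev_rev]
  have : f (G.rev e) < f e ↔ ¬ f e < f (G.rev e) :=
    ⟨fun h => h.not_gt, fun h => lt_of_le_of_ne (not_lt.mp h) h2.symm⟩
  rw [this]
  tauto

variable {O : Set E} {O' : Set E'}

namespace IsOrientation

lemma ncard_eq [Finite E] (hO : G.IsOrientation P p O) (D : Set E)
    (hD : ∀ e, G.rev e ∈ D ↔ e ∈ D) : D.ncard = 2 * (O ∩ D).ncard := by
  have hinj : Function.Injective G.rev := fun a b h => by rw [← G.rev_rev a, h, G.rev_rev]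
  have : D = (O ∩ D) ∪ G.rev '' (O ∩ D) := by
    ext e
    constructor
    · intro he
      by_cases heO : e ∈ O
      · exact .inl ⟨heO, he⟩
      · exact .inr ⟨G.rev e, ⟨(hO.rev_mem e).mpr heO, (hD e).mpr he⟩, G.rev_rev e⟩
    · rintro (he | ⟨e', he', rfl⟩)
      · exact he.2
      · exact (hD e').mpr he'.2
  conv_lhs => rw [this]
  rw [Set.ncard_union_eq, Set.ncard_image_of_injective _ hinj, two_mul]
  rw [Set.disjoint_left]
  rintro _ h1 ⟨e, he, rfl⟩
  exact (hO.rev_mem e).mp h1.1 he.1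

/-- The oriented edges, in terms of an indexing of the orientation. -/
lemma exists_equiv {K : Type*} (hO : G.IsOrientation P p O) (κ : K ≃ O) :
    ∃ φ : E ≃ K × Bool, (∀ k, φ (κ k) = (k, true)) ∧ ∀ e, φ (G.rev e) = opp (φ e) := by
  have hbij : Function.Bijective
      (fun x : K × Bool => if x.2 then (κ x.1 : E) else G.rev (κ x.1)) := by
    constructor
    · rintro ⟨k, b⟩ ⟨k', b'⟩ h
      have hne : ∀ k k', (κ k : E) ≠ G.rev (κ k') := fun k k' h =>
        (hO.rev_mem _).mp (h ▸ (κ k).2) (κ k').2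
      cases b <;> cases b'
      · simp only [Bool.false_eq_true, if_false] at h
        have : (κ k : E) = κ k' := by rw [← G.rev_rev (κ k), h, G.rev_rev]
        rw [κ.injective (Subtype.ext this)]
      · simp only [Bool.false_eq_true, if_false, if_true] at h
        exact absurd h.symm (hne _ _)
      · simp only [Bool.false_eq_true, if_false, if_true] at h
        exact absurd h (hne _ _)
      · simp only [if_true] at h
        rw [κ.injective (Subtype.ext h)]
    · intro e
      by_cases he : e ∈ O
      · exact ⟨(κ.symm ⟨e, he⟩, true), by simp⟩
      · exact ⟨(κ.symm ⟨G.rev e, (hO.rev_mem e).mpr he⟩, false), by simp [G.rev_rev]⟩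
  refine ⟨(Equiv.ofBijective _ hbij).symm, fun k => ?_, fun e => ?_⟩
  · rw [Equiv.symm_apply_eq]; simp
  · obtain ⟨⟨k, b⟩, rfl⟩ := (Equiv.ofBijective _ hbij).surjective e
    rw [Equiv.symm_apply_apply, Equiv.symm_apply_eq]
    cases b <;> simp [opp, G.rev_rev]

end IsOrientation

/-- The edges of two graphs correspond to each other in such a way that edges at minimal points
correspond to edges at the same minimal points, and all edges to edges in the same class. -/
lemma exists_matching [Finite E] [Finite E'] (hO : G.IsOrientation P p O)
    (hO' : H.IsOrientation P q O') (hG : G.Clean P p) (hH : H.Clean P q)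
    (hmin : G.qcMin P p = H.qcMin P q) (hc : EdgeConjEq P G H)
    (hnum : ∀ C, {e | G.edgeClass P e = C}.ncard = {e | H.edgeClass P e = C}.ncard) :
    ∃ ψ : O' ≃ O, ∀ o : O', ∃ δ : ZMod 2,
      G.Conj P ((G.affInit P (ψ o)).shift (δ, 0)) (H.affInit P o) ∧
      (H.affInit P o ∈ H.qcMin P q → (G.affInit P (ψ o)).shift (δ, 0) = H.affInit P o) ∧
      (G.affInit P (ψ o) ∈ H.qcMin P q → H.affInit P o ∈ H.qcMin P q) := by
  have half : ∀ C, {o : O' | H.edgeClass P o = C}.ncard = {o : O | G.edgeClass P o = C}.ncard := by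
    intro C
    have e1 := hO.ncard_eq {e | G.edgeClass P e = C} fun e => by
      rw [Set.mem_ofPred_eq, edgeClass_rev]; rfl
    have e2 := hO'.ncard_eq {e | H.edgeClass P e = C} fun e => by
      rw [Set.mem_ofPred_eq, edgeClass_rev]; rfl
    have e3 : Subtype.val '' {o : O | G.edgeClass P o = C} = O ∩ {e | G.edgeClass P e = C} := by
      ext e; simp [and_comm]
    have e4 : Subtype.val '' {o : O' | H.edgeClass P o = C} = O' ∩ {e | H.edgeClass P e = C} := by
      ext e; simp [and_comm]
    rw [← Set.ncard_image_of_injective _ Subtype.val_injective, e4,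
      ← Set.ncard_image_of_injective {o : O | G.edgeClass P o = C} Subtype.val_injective, e3]
    have := hnum C
    omega
  let X : Set O' := {o | H.affInit P o ∈ H.qcMin P q}
  let Y : Set O := {o | G.affInit P o ∈ H.qcMin P q}
  have hβ : ∀ x : X, ∃ y : Y, (G.affInit P y).Near (H.affInit P x) := by
    rintro ⟨x, hx⟩
    obtain ⟨e, he, -⟩ := hG.1 _ (hmin.symm.subset hx)
    have hem := near_mem_qcMin hx he.symm
    exact ⟨⟨⟨e, hO.min_mem e (hmin.symm.subset hem)⟩, hem⟩, he⟩
  choose β hβn using hβ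
  have hbij : Function.Bijective β := by
    constructor
    · intro x x' h
      have h1 := hβn x
      rw [h] at h1
      have := (hH.1 _ (near_mem_qcMin x.2 h1.symm)).unique h1.symm (hβn x').symm
      exact Subtype.ext (Subtype.ext this)
    · intro y
      obtain ⟨e, he, -⟩ := hH.1 _ y.2
      have hem := near_mem_qcMin y.2 he.symm
      refine ⟨⟨⟨e, hO'.min_mem e hem⟩, hem⟩, ?_⟩
      have h1 := hβn ⟨⟨e, hO'.min_mem e hem⟩, hem⟩
      exact Subtype.ext (Subtype.ext ((hG.1 _ (hmin.symm.subset hem)).unique h1 he.symm))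
  obtain ⟨ψ, hψ, hψc⟩ := exists_equiv_extending (fun o : O' => H.edgeClass P o)
    (fun o : O => G.edgeClass P o) half X Y (Equiv.ofBijective β hbij)
    (fun x => hc.edgeClass_eq (nearConj_of_near (hβn x)))
  refine ⟨ψ, fun o => ?_⟩
  by_cases ho : o ∈ X
  · have h1 : ψ o = β ⟨o, ho⟩ := hψ ⟨o, ho⟩
    obtain ⟨δ, hδ⟩ := near_iff.mp (hβn ⟨o, ho⟩)
    rw [h1]
    exact ⟨δ, hδ ▸ .refl, fun _ => hδ.symm, fun _ => ho⟩
  · have h1 : H.NearConj P (G.affInit P (ψ o)) (H.affInit P o) := by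
      have : G.affInit P (ψ o) ∈ G.edgeClass P (ψ o) := Conj.nearConj .refl
      rwa [show G.edgeClass P (ψ o) = H.edgeClass P o from hψc o] at this
    obtain ⟨δ, hδ⟩ := h1
    refine ⟨δ, (hc _ (.inl ⟨ψ o, (near_shift_sign _ δ).symm⟩) _).mpr hδ, fun h => absurd h ho,
      fun h => ?_⟩
    obtain ⟨x, hx⟩ := hbij.surjective ⟨ψ o, h⟩
    have h2 : ψ x = β x := hψ x
    rw [hx] at h2
    have := ψ.injective h2
    exact this ▸ x.2

end GBSGraph

/-! ### Normal forms in standard position -/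

namespace AffGraph

open AffPoint

variable {V K : Type*} {P : Finset ℕ} [DecidableEq K]

/-- Edge sign-changes at an arbitrary set of edges. -/
lemma reach_signs [Finite K] (s : AffGraph V P K) (δ : K → ZMod 2) :
    Reach s (fun k => ((s k).1.shift (δ k, 0), (s k).2.shift (δ k, 0))) := by
  classical
  have := Fintype.ofFinite K
  have hz : ∀ δ : ZMod 2, δ = 0 ∨ δ = 1 := by decide
  have h0 : ∀ a : AffPoint V P, a.shift (0, 0) = a := fun a => a.shift_zero
  have key : ∀ T : Finset K, Reach s (fun k => if k ∈ T then
      ((s k).1.shift (δ k, 0), (s k).2.shift (δ k, 0)) else s k) := by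
    intro T
    induction T using Finset.induction_on with
    | empty => simpa using Relation.ReflTransGen.refl
    | insert j T hj ih =>
      rcases hz (δ j) with h | h
      · convert ih using 1
        funext k
        by_cases hk : k = j
        · subst hk; simp [hj, h, h0]
        · simp [hk]
      · refine ih.tail ?_
        convert AffMove.sign _ j using 1
        funext k
        by_cases hk : k = j
        · subst hk; simp [hj, h]
        · simp [hk]
  simpa using key Finset.univ

end AffGraph

namespace GBSGraph

open AffPoint

variable {V E E' : Type*} {P : Finset ℕ} {G : GBSGraph V E} {H : GBSGraph V E'}
  {p q a b : AffPoint V P} {F₀ : Set (AffPoint V P)} {mF : Set (AffPoint V P) → AffPoint V P}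
  {O : Set E} {O' : Set E'} {e : E} {e' : E'}

namespace IsNormal

lemma chosen_mem (h : G.IsNormal P p F₀ mF) (hO : G.IsOrientation P p O)
    (he : G.Chosen P p F₀ mF e) : e ∈ O := hO.min_mem e (h.chosen_spec he).1

lemma deep_ter (h : G.IsNormal P p F₀ mF) (hO : G.IsOrientation P p O) (he : e ∈ O)
    (hc : ¬ G.Chosen P p F₀ mF e) : G.DeepIn P p (G.fam P p (G.affInit P e)) (G.affTer P e) := by
  by_cases hm : G.affInit P e ∈ G.qcMin P p
  · exact h.staying hm hc
  · obtain ⟨h1, h2⟩ := h.floating_of_mem hO he hm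
    rwa [h.fam_eq_of_mem_base h1.1]

/-- The distinguished family contains the initial point of an edge at a minimal point. -/
lemma exists_root (h : G.IsNormal P p F₀ mF) (hO : G.IsOrientation P p O) :
    ∃ e ∈ O, ¬ G.Chosen P p F₀ mF e ∧ G.affInit P e ∈ G.qcMin P p ∧
      G.fam P p (G.affInit P e) = F₀ := by
  obtain ⟨a, ha, hF⟩ := isFamily_iff.mp h.form.isFamily
  obtain ⟨m, hm, hup⟩ := exists_min_up ha
  obtain ⟨e, he, -⟩ := h.clean.1 m hm
  have hem := near_mem_qcMin hm he.symm
  have hfam : G.fam P p (G.affInit P e) = F₀ := by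
    have h1 : G.fam P p a = G.fam P p m := fam_eq_of_up hm.1 hup
    have h2 : G.fam P p m = G.fam P p (G.affInit P e) := fam_eq_of_up hem.1 (he.up _)
    rw [← h2, ← h1, hF]; rfl
  exact ⟨e, hO.min_mem e hem, fun hc => (h.chosen_spec hc).2.1 hfam, hem, hfam⟩

/-- If there are more edges than minimal points, then some edge is floating. -/
lemma exists_floating [Finite E] (h : G.IsNormal P p F₀ mF) (hO : G.IsOrientation P p O)
    (hf : G.HasFloatingPieces P p) : ∃ e ∈ O, G.affInit P e ∉ G.qcMin P p := by
  by_contra hcon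
  push Not at hcon
  have hcard : Nat.card E = 2 * O.ncard := by
    have := hO.ncard_eq Set.univ (by simp)
    rwa [Set.ncard_univ, Set.inter_univ] at this
  let g : E → V × (P → ℕ) := fun e => ((G.affInit P e).1, (G.affInit P e).2.2)
  have hg : ∀ a b : AffPoint V P, (a.1, a.2.2) = (b.1, b.2.2) → a.Near b := fun a b hab => by
    refine near_iff.mpr ⟨b.2.1 - a.2.1, ?_⟩
    refine Prod.ext (congrArg Prod.fst hab).symm (Prod.ext ?_ ?_)
    · show b.2.1 = a.2.1 + (b.2.1 - a.2.1); abel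
    · show b.2.2 = a.2.2 + 0
      rw [add_zero]; exact (congrArg Prod.snd hab).symm
  have himg : (fun a : AffPoint V P => (a.1, a.2.2)) '' G.qcMin P p = g '' O := by
    ext x
    constructor
    · rintro ⟨m, hm, rfl⟩
      obtain ⟨e, he, -⟩ := h.clean.1 m hm
      refine ⟨e, hO.min_mem e (near_mem_qcMin hm he.symm), ?_⟩
      obtain ⟨δ, rfl⟩ := near_iff.mp he
      exact Prod.ext rfl (add_zero _).symm
    · rintro ⟨e, he, rfl⟩
      exact ⟨_, hcon e he, rfl⟩
  have hinj : Set.InjOn g O := fun e he e' he' hee =>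
    h.eq_of_near_min (hcon e' he') (hg _ _ hee) (Near.refl _)
  have h1 := hf.2
  rw [numMinPoints, himg, hinj.ncard_image, numEdges, hcard] at h1
  omega

/-- The edges of a graph in normal form, as an index set: those that stay in their family, and those
that start at chosen minimal points. -/
abbrev Index (P : Finset ℕ) (G : GBSGraph V E) (p : AffPoint V P) (F₀ : Set (AffPoint V P))
    (mF : Set (AffPoint V P) → AffPoint V P) (O : Set E) : Type _ :=
  {o : O // ¬ G.Chosen P p F₀ mF o} ⊕ {o : O // G.Chosen P p F₀ mF o}

/-- The edge with a given index. -/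
def Index.edge {P : Finset ℕ} {G : GBSGraph V E} {p : AffPoint V P} {F₀ : Set (AffPoint V P)}
    {mF : Set (AffPoint V P) → AffPoint V P} {O : Set E} : Index P G p F₀ mF O → O :=
  Sum.elim Subtype.val Subtype.val

lemma Index.edge_bijective : Function.Bijective (Index.edge (P := P) (G := G) (p := p) (F₀ := F₀)
    (mF := mF) (O := O)) := by
  constructor
  · rintro (⟨o, ho⟩ | ⟨o, ho⟩) (⟨o', ho'⟩ | ⟨o', ho'⟩) (h : o = o')
    · subst h; rfl
    · subst h; exact absurd ho' ho
    · subst h; exact absurd ho ho'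
    · subst h; rfl
  · intro o
    by_cases ho : G.Chosen P p F₀ mF o
    · exact ⟨.inr ⟨o, ho⟩, rfl⟩
    · exact ⟨.inl ⟨o, ho⟩, rfl⟩

/-- The frame `f` records the initial points and the families of the edges of a graph in normal
form. -/
structure Describes (P : Finset ℕ) (G : GBSGraph V E) (p : AffPoint V P) (F₀ : Set (AffPoint V P))
    (mF : Set (AffPoint V P) → AffPoint V P) (O : Set E)
    (f : Frame V P {o : O // ¬ G.Chosen P p F₀ mF o} {o : O // G.Chosen P p F₀ mF o}) : Prop where
  S_eq : f.S = G.qcSupp P p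
  m₀_mem : f.m₀ ∈ G.qcMin P p
  fam_m₀ : G.fam P p f.m₀ = F₀
  m₀_eq : f.m₀ = G.affInit P f.root
  hub_eq : ∀ c, f.hub c = G.affInit P c
  base_eq : ∀ i, f.base i = G.affInit P i
  mem_floats : ∀ i, i ∈ f.floats ↔ G.affInit P i ∉ G.qcMin P p
  ref_mem : ∀ i, f.ref i ∈ G.qcMin P p
  fam_ref : ∀ i, G.fam P p (f.ref i) = G.fam P p (G.affInit P i)

lemma exists_frame (h : G.IsNormal P p F₀ mF) (hO : G.IsOrientation P p O) :
    ∃ f, Describes P G p F₀ mF O f := by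
  classical
  obtain ⟨e₀, he₀, hc₀, hm₀, hf₀⟩ := h.exists_root hO
  have hhome : ∀ i : {o : O // ¬ G.Chosen P p F₀ mF o},
      ∃ x : Option {o : O // G.Chosen P p F₀ mF o},
        (G.fam P p (G.affInit P i) = F₀ → x = none) ∧
        (x.elim (G.affInit P e₀) fun c => G.affInit P c) ∈ G.qcMin P p ∧
        G.fam P p (x.elim (G.affInit P e₀) fun c => G.affInit P c) =
          G.fam P p (G.affInit P i) := by
    intro i
    by_cases hi : G.fam P p (G.affInit P i) = F₀
    · exact ⟨none, fun _ => rfl, hm₀, hf₀.trans hi.symm⟩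
    · obtain ⟨e, he, hfe⟩ := h.exists_chosen (h.qconj_init _) hi
      exact ⟨some ⟨⟨e, h.chosen_mem hO he⟩, he⟩, fun h0 => absurd h0 hi, (h.chosen_spec he).1, hfe⟩
  choose home hnone hmin hfam using hhome
  refine ⟨⟨G.qcSupp P p, G.affInit P e₀, fun c => G.affInit P c, home, fun i => G.affInit P i,
    ⟨⟨e₀, he₀⟩, hc₀⟩, {i | G.affInit P i.1.1 ∉ G.qcMin P p}, rfl,
      fun h => h hm₀, hnone _ hf₀, ?_, ?_⟩,
    rfl, hm₀, hf₀, rfl, fun _ => rfl, fun _ => rfl, fun _ => Iff.rfl, hmin, hfam⟩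
  · exact fun i hi => hnone i (h.fam_eq_of_mem_base (h.floating_of_mem hO i.1.2 hi).1.1)
  · intro i hi
    have hd := h.deep_ter hO i.1.2 i.2
    refine ⟨G.affTer P i, hd.up (not_not.mp hi) (mem_fam_self (h.qconj_init _)),
      hd.up (hmin i) ?_⟩
    rw [← hfam i]
    exact mem_fam_self (hmin i).1

end IsNormal

/-- The quasi-conjugacy classes of `p` in `G` and of `q` in `H` have the same minimal points and the
same support, and hence the same points. -/
structure SameClass (P : Finset ℕ) (G : GBSGraph V E) (H : GBSGraph V E') (p q : AffPoint V P) :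
    Prop where
  min : G.qcMin P p = H.qcMin P q
  supp : G.qcSupp P p = H.qcSupp P q

namespace SameClass

variable (hs : SameClass P G H p q)
include hs

lemma qconj_iff : G.QConj P a p ↔ H.QConj P a q := by
  rw [GBSGraph.qconj_iff, GBSGraph.qconj_iff, hs.min, hs.supp]

lemma fam_eq (a : AffPoint V P) : G.fam P p a = H.fam P q a := by
  have : {b | G.QConj P b p} = {b | H.QConj P b q} := Set.ext fun b => hs.qconj_iff
  rw [fam, fam, this, hs.supp]

lemma isFamily_iff {F : Set (AffPoint V P)} : G.IsFamily P p F ↔ H.IsFamily P q F := by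
  have : {b | G.QConj P b p} = {b | H.QConj P b q} := Set.ext fun b => hs.qconj_iff
  rw [GBSGraph.isFamily_iff, GBSGraph.isFamily_iff, this, hs.supp]
  exact exists_congr fun a => and_congr_left fun _ => hs.qconj_iff

lemma chosen_iff (hn : (G.affInit P e).Near (H.affInit P e')) :
    G.Chosen P p F₀ mF e ↔ H.Chosen P q F₀ mF e' :=
  exists_congr fun _ => and_congr hs.isFamily_iff (and_congr_right fun _ =>
    ⟨fun h => hn.symm.trans h, fun h => hn.trans h⟩)

end SameClass

namespace IsNormal

/-- The affine graph of a graph in normal form, after adjusting signs, is in standard position with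
respect to the frame of another such graph. -/
lemma good_of_matching (hG : G.IsNormal P p F₀ mF) (hO : G.IsOrientation P p O)
    (hH : H.IsNormal P q F₀ mF) (hO' : H.IsOrientation P q O') (hs : SameClass P G H p q)
    {f : Frame V P {o : O' // ¬ H.Chosen P q F₀ mF o} {o : O' // H.Chosen P q F₀ mF o}}
    (hf : Describes P H q F₀ mF O' f)
    (s : AffGraph V P (Index P H q F₀ mF O')) (ε : Index P H q F₀ mF O' → O)
    (h1 : ∀ k, (G.affInit P (ε k)).Near (s k).1) (h2 : ∀ k, (G.affTer P (ε k)).Near (s k).2)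
    (hmin : ∀ k, H.affInit P k.edge ∈ H.qcMin P q → (s k).1 = H.affInit P k.edge)
    (hnmin : ∀ k, H.affInit P k.edge ∉ H.qcMin P q → G.affInit P (ε k) ∉ H.qcMin P q) :
    f.Good s ∧ (∀ k, G.Chosen P p F₀ mF (ε k) ↔ H.Chosen P q F₀ mF k.edge) ∧
      ∀ k, G.fam P p (G.affInit P (ε k)) = H.fam P q (H.affInit P k.edge) := by
  have hcho : ∀ k, G.Chosen P p F₀ mF (ε k) ↔ H.Chosen P q F₀ mF k.edge := by
    intro k
    by_cases hk : H.affInit P k.edge ∈ H.qcMin P q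
    · exact hs.chosen_iff (hmin k hk ▸ h1 k)
    · refine iff_of_false (fun hc => hnmin k hk ?_) fun hc => hk (hH.chosen_spec hc).1
      rw [← hs.min]; exact (hG.chosen_spec hc).1
  have hfam : ∀ k, G.fam P p (G.affInit P (ε k)) = H.fam P q (H.affInit P k.edge) := by
    intro k
    by_cases hk : H.affInit P k.edge ∈ H.qcMin P q
    · rw [hs.fam_eq, ← hmin k hk]
      exact (fam_eq_of_up (hs.qconj_iff.mp (hG.qconj_init _)) ((h1 k).up _)).symm
    · rw [hG.fam_eq_of_mem_base (hG.floating_of_mem hO (ε k).2 (hs.min ▸ hnmin k hk)).1.1,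
        hH.fam_eq_of_mem_base (hH.floating_of_mem hO' k.edge.2 hk).1.1]
  have hm₀' : f.m₀ ∈ G.qcMin P p := hs.min.symm.subset hf.m₀_mem
  have hmF : f.m₀ ∈ F₀ := hf.fam_m₀.subset (mem_fam_self hf.m₀_mem.1)
  have hS' : f.S = G.qcSupp P p := hf.S_eq.trans hs.supp.symm
  refine ⟨⟨?_, ?_, ?_, ?_, ?_, ?_⟩, hcho, hfam⟩
  · have e1 : (s (.inl f.root)).1 = f.m₀ := by
      rw [hf.m₀_eq]; exact hmin (.inl f.root) (hf.m₀_eq ▸ hf.m₀_mem)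
    have hd := hG.deep_ter hO (ε (.inl f.root)).2 fun hc => f.root.2 ((hcho (.inl f.root)).mp hc)
    have e2 : f.m₀ ∈ G.fam P p (G.affInit P (ε (.inl f.root))) := by
      rw [hfam]
      show f.m₀ ∈ H.fam P q (H.affInit P f.root)
      rw [← hf.m₀_eq]; exact mem_fam_self hf.m₀_mem.1
    obtain ⟨w, hw, hws⟩ := hd.exists_shift hm₀' e2
    obtain ⟨δ, hδ⟩ := near_iff.mp (h2 (.inl f.root))
    refine ⟨w + (δ, 0), ?_, Prod.ext e1 ?_⟩
    · rw [hS', ← hws]; ext r; simp [AffCone.supp]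
    · rw [hδ, hw, shift_shift]
  · intro c
    rw [hf.hub_eq]
    exact hmin (.inr c) (hH.chosen_spec c.2).1
  · intro c
    rw [hS']
    exact ((hG.chosen_deep ((hcho (.inr c)).mpr c.2)).up hm₀' hmF).trans ((h2 (.inr c)).up _)
  · intro i hi
    rw [hf.base_eq]
    refine hmin (.inl i) ?_
    rw [hf.mem_floats] at hi
    exact not_not.mp hi
  · intro i
    have hd := hG.deep_ter hO (ε (.inl i)).2 fun hc => i.2 ((hcho (.inl i)).mp hc)
    rw [hS']
    refine (hd.up (hs.min ▸ hf.ref_mem i) ?_).trans ((h2 (.inl i)).up _)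
    rw [hfam]
    show f.ref i ∈ H.fam P q (H.affInit P i)
    rw [← hf.fam_ref i]
    exact mem_fam_self (hf.ref_mem i).1
  · intro i hi
    rw [hf.mem_floats] at hi
    have := hG.floating_of_mem hO (ε (.inl i)).2 (hs.min ▸ hnmin (.inl i) hi)
    rw [hS']
    exact (this.1.up hm₀' hmF).trans ((h1 (.inl i)).up _)

end IsNormal

end GBSGraph

/-! ### Comparison of two graphs in normal form -/

namespace GBSGraph

open AffPoint AffGraph

variable {V E E' : Type*} {P : Finset ℕ} {G : GBSGraph V E} {H : GBSGraph V E'}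
  {p q : AffPoint V P} {F₀ : Set (AffPoint V P)} {mF : Set (AffPoint V P) → AffPoint V P}
  {O : Set E} {O' : Set E'}

/-- A graph is recovered from the affine graph formed by the edges of an orientation. -/
lemma IsOrientation.exists_eq_ofAff {K : Type*} (hO : G.IsOrientation P p O)
    (hP : ∀ r ∈ P, r.Prime) (hG : G.primes = (P : Set ℕ)) (κ : K ≃ O) :
    ∃ φ : E ≃ K × Bool, G = ofAff hP φ (fun k => (G.affInit P (κ k), G.affTer P (κ k))) := by
  obtain ⟨φ, hφ, hrev⟩ := hO.exists_equiv κ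
  refine ⟨φ, eq_ofAff hP hG.subset φ _ hrev fun e => ?_⟩
  have he : ∀ k, G.affInit P (κ k) = endpoint
      (fun k => (G.affInit P (κ k), G.affTer P (κ k))) (φ (κ k)) := fun k => by
    rw [hφ]; rfl
  by_cases h : e ∈ O
  · have := he (κ.symm ⟨e, h⟩)
    rwa [Equiv.apply_symm_apply] at this
  · obtain ⟨k, hk⟩ := κ.surjective ⟨G.rev e, (hO.rev_mem e).mpr h⟩
    have h1 : e = G.rev (κ k) := by rw [hk, G.rev_rev]
    rw [h1, hrev, hφ, affInit_rev]
    rfl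

lemma sameUpToEdgeNames_ofAff {K : Type*} (hP : ∀ r ∈ P, r.Prime) (φ : E ≃ K × Bool)
    (φ' : E' ≃ K × Bool) (s : AffGraph V P K) :
    (ofAff hP φ s).SameUpToEdgeNames (ofAff hP φ' s) :=
  ⟨φ.trans φ'.symm, fun e => by simp [ofAff]⟩

namespace IsNormal

/-- The displacements of the edges that stay in their family generate the linear algebra. -/
lemma coe_span_vec_eq_linAlg (hG : G.IsNormal P p F₀ mF) (hO : G.IsOrientation P p O)
    {ι τ : Type*} (s : AffGraph V P (ι ⊕ τ)) (κ : ι ⊕ τ ≃ O)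
    (hc : ∀ i, ¬ G.Chosen P p F₀ mF (κ (.inl i))) (hc' : ∀ c, G.Chosen P p F₀ mF (κ (.inr c)))
    (hs : ∀ i, Frame.vec s i =
      (G.affTer P (κ (.inl i))).val - (G.affInit P (κ (.inl i))).val) :
    (Submodule.span ℤ (Set.range (Frame.vec s)) : Set (AffGroup P)) = G.linAlg P p := by
  rw [← hG.coe_span_eq_linAlg hO]
  congr 2
  ext x
  constructor
  · rintro ⟨i, rfl⟩
    exact ⟨κ (.inl i), (κ _).2, hc i, hs i⟩
  · rintro ⟨e, he, hce, rfl⟩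
    obtain ⟨k, hk⟩ := κ.surjective ⟨e, he⟩
    rcases k with i | c
    · exact ⟨i, by rw [hs, hk]⟩
    · have := hc' c
      rw [hk] at this
      exact absurd this hce

/-- Graphs in normal form whose edges can be matched are connected by moves of affine graphs. -/
lemma reach [Finite E] [Finite E'] [DecidableEq (Index P H q F₀ mF O')]
    (hG : G.IsNormal P p F₀ mF) (hO : G.IsOrientation P p O)
    (hH : H.IsNormal P q F₀ mF) (hO' : H.IsOrientation P q O') (hs : SameClass P G H p q)
    (hla : G.linAlg P p = H.linAlg P q) (hfloat : H.HasFloatingPieces P q)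
    (hconj : EdgeConjEq P G H) (κ' : Index P H q F₀ mF O' ≃ O') (hκ' : ∀ k, κ' k = k.edge)
    (ψ : O' ≃ O)
    (hψ : ∀ o : O', ∃ δ : ZMod 2,
      G.Conj P ((G.affInit P (ψ o)).shift (δ, 0)) (H.affInit P o) ∧
      (H.affInit P o ∈ H.qcMin P q → (G.affInit P (ψ o)).shift (δ, 0) = H.affInit P o) ∧
      (G.affInit P (ψ o) ∈ H.qcMin P q → H.affInit P o ∈ H.qcMin P q)) :
    AffGraph.Reach
      (fun k : Index P H q F₀ mF O' => (G.affInit P (ψ (κ' k)), G.affTer P (ψ (κ' k))))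
      (fun k => (H.affInit P (κ' k), H.affTer P (κ' k))) := by
  classical
  choose δ hδ hδmin hmem using hψ
  obtain ⟨f, hf⟩ := hH.exists_frame hO'
  -- all decidability instances agree
  have hDE : ‹DecidableEq (Index P H q F₀ mF O')› = instDecidableEqSum := Subsingleton.elim _ _
  subst hDE
  refine (reach_signs _ fun k => δ (κ' k)).trans ?_
  set s : AffGraph V P (Index P H q F₀ mF O') := fun k =>
    ((G.affInit P (ψ (κ' k))).shift (δ (κ' k), 0), (G.affTer P (ψ (κ' k))).shift (δ (κ' k), 0))
    with hsdef
  set t : AffGraph V P (Index P H q F₀ mF O') := fun k => (H.affInit P (κ' k), H.affTer P (κ' k))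
    with htdef
  have hself : SameClass P H H q q := ⟨rfl, rfl⟩
  obtain ⟨ht, -, -⟩ := hH.good_of_matching hO' hH hO' hself hf t κ' (fun k => Near.refl _)
    (fun k => Near.refl _) (fun k _ => by rw [htdef, ← hκ']) (fun k hk => by rwa [hκ'])
  obtain ⟨hgs, hcho, hfam⟩ := hG.good_of_matching hO hH hO' hs hf s (fun k => ψ (κ' k))
    (fun k => near_shift_sign _ _) (fun k => near_shift_sign _ _)
    (fun k hk => by rw [← hκ'] at hk ⊢; exact hδmin _ hk)
    (fun k hk hk' => hk (by rw [← hκ']; exact hmem _ hk'))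
  have hvs : (Submodule.span ℤ (Set.range (Frame.vec s)) : Set (AffGroup P)) = G.linAlg P p := by
    refine hG.coe_span_vec_eq_linAlg hO s (κ'.trans ψ) (fun i hc => i.2 ((hcho (.inl i)).mp hc))
      (fun c => (hcho (.inr c)).mpr c.2) fun i => ?_
    simp [Frame.vec, hsdef]
  have hvt : (Submodule.span ℤ (Set.range (Frame.vec t)) : Set (AffGroup P)) = H.linAlg P q :=
    hH.coe_span_vec_eq_linAlg hO' t κ' (fun i hc => i.2 (by rw [hκ'] at hc; exact hc))
      (fun c => by rw [hκ']; exact c.2) fun i => rfl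
  have hspan : Submodule.span ℤ (Set.range (Frame.vec s)) =
      Submodule.span ℤ (Set.range (Frame.vec t)) :=
    SetLike.coe_injective (hvs.trans (hla.trans hvt.symm))
  have hS : f.S.Nonempty := hf.S_eq ▸ hfloat.1
  have hfl : f.floats.Nonempty := by
    obtain ⟨e, he, hem⟩ := hH.exists_floating hO' hfloat
    refine ⟨⟨⟨e, he⟩, fun hc => hem (hH.chosen_spec hc).1⟩, ?_⟩
    rw [hf.mem_floats]
    exact hem
  -- conjugate points of the distinguished family are congruent modulo the displacements
  have hsub : ∀ a b, a ∈ F₀ → b ∈ F₀ → G.QConj P a p → G.Conj P a b →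
      b.val - a.val ∈ Submodule.span ℤ (Set.range (Frame.vec t)) := by
    intro a b ha hb hq hab
    refine hG.sub_mem_of_conj hO _ (fun e he hce => ?_) hq hab
      ((hG.fam_eq_of_mem_base ha).trans (hG.fam_eq_of_mem_base hb).symm)
    have : (G.affTer P e).val - (G.affInit P e).val ∈ G.linAlg P p := by
      rw [← hG.coe_span_eq_linAlg hO]
      exact Submodule.subset_span ⟨e, he, hce, rfl⟩
    rwa [← hvs, hspan] at this
  have hbase : ∀ {a b : AffPoint V P}, a ∈ F₀ → Up (G.qcSupp P p) a b → b ∈ F₀ := by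
    intro a b ha hab
    obtain ⟨c, hc, hF⟩ := isFamily_iff.mp hG.form.isFamily
    have h1 : G.QConj P a p := by rw [hF] at ha; exact ha.1
    have h2 : b ∈ G.fam P p b := mem_fam_self (h1.up hab)
    rwa [fam_eq_of_up h1 hab, hG.fam_eq_of_mem_base ha] at h2
  have hm₀ : f.m₀ ∈ F₀ := hf.fam_m₀.subset (mem_fam_self hf.m₀_mem.1)
  have hup : ∀ {a : AffPoint V P}, Up f.S f.m₀ a → a ∈ F₀ := fun h =>
    hbase hm₀ (by rwa [hf.S_eq, ← hs.supp] at h)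
  refine Frame.reach_of_good hgs ht hS hfl hspan (fun i hi => ?_) fun c => ?_
  · exact hsub _ _ (hup (hgs.float_up i hi)) (hup (ht.float_up i hi))
      ((hG.qconj_init _).near (near_shift_sign _ _)) (hδ _)
  · refine hsub _ _ (hup (hgs.hub_snd c)) (hup (ht.hub_snd c))
      ((hG.qconj_ter _).near (near_shift_sign _ _)) ?_
    have e1 : G.Conj P (s (.inr c)).1 (s (.inr c)).2 := (conj_edge G _).shift _
    have e2 : G.Conj P (t (.inr c)).1 (t (.inr c)).2 :=
      (hconj _ (.inr ⟨_, Near.refl _⟩) _).mpr (conj_edge H _)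
    rw [ht.hub_fst] at e2
    rw [hgs.hub_fst] at e1
    exact e1.symm.trans e2

end IsNormal

end GBSGraph

theorem mainTheorem7 {V E E' : Type*} [Finite V] [Finite E] [Finite E']
    (G : GBSGraph V E) (H : GBSGraph V E')
    (P : Finset ℕ) (hGP : G.primes = (P : Set ℕ)) (hHP : H.primes = (P : Set ℕ))
    (p q : AffPoint V P)
    (hGone : G.OneQCClass P p) (hHone : H.OneQCClass P q)
    (hGclean : G.Clean P p) (hHclean : H.Clean P q)
    (hGfloat : G.HasFloatingPieces P p) (hHfloat : H.HasFloatingPieces P q)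
    (F₀ : Set (AffPoint V P)) (mF : Set (AffPoint V P) → AffPoint V P)
    (hGnf : G.NormalForm P p F₀ mF) (hHnf : H.NormalForm P q F₀ mF)
    (hmin : G.qcMin P p = H.qcMin P q)
    (hsupp : G.qcSupp P p = H.qcSupp P q)
    (hla : G.linAlg P p = H.linAlg P q)
    (hnum : ∃ G' : GBSGraph V E, Relation.ReflTransGen GBSGraph.EdgeSignChange G G' ∧
      G'.SameConjEdgeNumbers P H) :
    ∃ K : GBSGraph V E, Relation.ReflTransGen GBSGraph.Move G K ∧ K.SameUpToEdgeNames H := by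
  classical
  have hP : ∀ r ∈ P, r.Prime := fun r hr => (hGP.symm.subset hr).1
  obtain ⟨G', hGG', hn⟩ := hnum
  have hsign := GBSGraph.signEquiv_of_reflTransGen (P := P) hGG'
  have hG : G.IsNormal P p F₀ mF := ⟨hGone, hGclean, hGnf⟩
  have hH : H.IsNormal P q F₀ mF := ⟨hHone, hHclean, hHnf⟩
  obtain ⟨O, hO⟩ := GBSGraph.exists_isOrientation hGclean
  obtain ⟨O', hO'⟩ := GBSGraph.exists_isOrientation hHclean
  have hconj := GBSGraph.edgeConjEq_of_sameConjEdgeNumbers hsign hn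
  obtain ⟨ψ, hψ⟩ := GBSGraph.exists_matching hO hO' hGclean hHclean hmin hconj
    (GBSGraph.ncard_edgeClass_eq hsign hn)
  let κ' : GBSGraph.IsNormal.Index P H q F₀ mF O' ≃ O' :=
    Equiv.ofBijective _ GBSGraph.IsNormal.Index.edge_bijective
  have hreach := hG.reach hO hH hO' ⟨hmin, hsupp⟩ hla hHfloat hconj κ' (fun _ => rfl) ψ hψ
  obtain ⟨φ, hφ⟩ := hO.exists_eq_ofAff hP hGP (κ'.trans ψ)
  obtain ⟨φ₁, hφ₁⟩ := hO'.exists_eq_ofAff hP hHP κ'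
  obtain ⟨φ₂, hφ₂⟩ := GBSGraph.exists_moves_of_reach hP hreach φ
  have hφ₃ := GBSGraph.sameUpToEdgeNames_ofAff hP φ₂ φ₁
    (fun k => (H.affInit P (κ' k), H.affTer P (κ' k)))
  rw [← hφ₁] at hφ₃
  simp only [Equiv.trans_apply] at hφ
  rw [← hφ] at hφ₂
  exact ⟨_, hφ₂, hφ₃⟩
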